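/- Let $p\ge 1$ and let $\boldsymbol\mu=(\mu^{i,j})_{1\le i,j\le p}$ be a matrix of locally finite measures on $[0,\infty)$. Write $\mathcal L\boldsymbol\mu(z)=\big(\int e^{-zx}\,\mu^{i,j}(\mathrm dx)\big)_{i,j}$ for its Laplace transform, with domain $\mathcal D=\{z\in\mathbb C:\int e^{-\mathrm{Re}(z)x}\,\mu^{i,j}(\mathrm dx)<\infty\text{ for all }i,j\}$, and $\boldsymbol U=\sum_{n\ge 0}\boldsymbol\mu^{*n}$ for the Markov renewal measure, $\boldsymbol U(t)=\boldsymbol U([0,t])$. Put $\Lambda=\{\lambda\in\mathcal D:\det(\mathbf I_p-\mathcal L\boldsymbol\mu(\lambda))=0\}$ and $\Lambda_\theta=\{\lambda\in\Lambda:\mathrm{Re}(\lambda)>\theta\}$. For $\lambda\in\Lambda$ let $\mathtt k(\lambda)$ be the order of the pole of $(\mathbf I_p-\mathcal L\boldsymbol\mu(z))^{-1}$ at $z=\lambda$, i.e. the smallest $n$ such that all entries of $(z-\lambda)^n(\mathbf I_p-\mathcal L\boldsymbol\mu(z))^{-1}$ extend holomorphically to a neighbourhood of $\lambda$; put $\mathtt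 k(z)=0$ for $z\notin\Lambda$. Let $\vartheta\in\mathbb R$ be an interior point of $\mathcal D$. Suppose that the matrix $(\mu^{i,j}(\{0\}))_{i,j}$ has spectral radius $<1$, that $\mathbf I_p-\mathcal L\boldsymbol\mu(\vartheta+\mathrm i\eta)$ is invertible for every $\eta\in\mathbb R$ with $\sup_{\eta\in\mathbb R}\|(\mathbf I_p-\mathcal L\boldsymbol\mu(\vartheta+\mathrm i\eta))^{-1}\|<\infty$, and that $\Lambda_\vartheta$ is finite. Then $\boldsymbol U(t)$ is finite for all $t$, and there are matrices $C_{\lambda,k},B_{\lambda,k}\in\mathbb C^{p\times p}$, depending on $\boldsymbol\mu$ and $\vartheta$ only, with the following properties. The $C_{\lambda,k}$ are the coefficients of the expansion of the renewal function, $$\boldsymbol U(t)=\sum_{\lambda\in\Lambda_\vartheta}e^{\lambda t}\sum_{k=0}^{\mathtt k(\lambda)-1}t^kC_{\lambda,k}+t^{\mathtt k(0)}C_{0,\mathtt k(0)}+O(te^{\vartheta t})\quad(t\to\infty),$$ and, with $C_{\lambda,\mathtt k(\lambda)}=0$ for $\lambda\in\Lambda_\vartheta\setminus\{0\}$, $$B_{\lambda,k}=(k+1)C_{\lambda,k+1}+\lambda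 C_{\lambda,k},\qquad \lambda\in\Lambda_\vartheta,\ 0\le k<\mathtt k(\lambda).$$ Let $f:\mathbb R\to\mathbb R^p$ be right-continuous with left limits, vanish on $(-\infty,0)$, and satisfy $\int_0^\infty e^{-\theta x}\,\mathrm Vf_i(x)\,\mathrm dx<\infty$ for $i=1,\dots,p$ and some $\theta>\vartheta$ with $\Lambda_\vartheta=\Lambda_\theta$, where $\mathrm Vf_i(x)$ is the total variation of $f_i$ on $(-\infty,x]$. Then $F=\boldsymbol U*f$, i.e. $F_i(t)=\sum_j\int f_j(t-x)\,U^{i,j}(\mathrm dx)$, solves the Markov renewal equation $F=f+\boldsymbol\mu*F$, and, as $t\to\infty$, componentwise, $$F(t)=\sum_{\lambda\in\Lambda_\theta}e^{\lambda t}\sum_{k=0}^{\mathtt k(\lambda)-1}B_{\lambda,k}\int_0^tf(x)(t-x)^ke^{-\lambda x}\,\mathrm dx+O(e^{\theta t}).$$ Moreover, for every $\varepsilon>0$, $$F(t)=\sum_{\lambda\in\Lambda_\theta}e^{\lambda t}\sum_{k=0}^{\mathtt k(\lambda)-1}B_{\lambda,k}\int_0^\infty f(x)(t-x)^ke^{-\lambda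 x}\,\mathrm dx+O(e^{(\theta+\varepsilon)t}),$$ where the integrals converge absolutely, and there are vectors $b_{\lambda,k,f}\in\mathbb C^p$, not depending on $\varepsilon$, such that for every $\varepsilon>0$ $$F(t)=\sum_{\lambda\in\Lambda_\theta}e^{\lambda t}\sum_{k=0}^{\mathtt k(\lambda)-1}t^k\,b_{\lambda,k,f}+O(e^{(\theta+\varepsilon)t}).$$ -/

import Mathlib

open MeasureTheory Filter Topology Asymptotics Set
open scoped Matrix ENNReal

noncomputable section

namespace MarkovRenewal

variable {p : ℕ}

/-- The `n`-fold convolution power of a matrix of measures on the line; the zeroth power is the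
identity matrix times the unit mass at `0`. -/
def convPow (μ : Fin p → Fin p → Measure ℝ) : ℕ → Fin p → Fin p → Measure ℝ
  | 0 => fun i j => if i = j then Measure.dirac 0 else 0
  | n + 1 => fun i j => ∑ k, (μ i k).conv (convPow μ n k j)

/-- The Markov renewal measure: the sum of all convolution powers. -/
def renewalMeasure (μ : Fin p → Fin p → Measure ℝ) (i j : Fin p) : Measure ℝ :=
  Measure.sum fun n => convPow μ n i j

/-- The convolution of a matrix of measures and a column vector of functions,
`(μ * f)ᵢ(t) = ∑ⱼ ∫ fⱼ(t - x) μⁱʲ(dx)`. -/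
def convVec (μ : Fin p → Fin p → Measure ℝ) (f : ℝ → Fin p → ℝ) (t : ℝ) (i : Fin p) : ℝ :=
  ∑ j, ∫ x, f (t - x) j ∂(μ i j)

/-- The domain of the Laplace transform of a matrix of measures. -/
def laplaceDomain (μ : Fin p → Fin p → Measure ℝ) : Set ℂ :=
  {z | ∀ i j, Integrable (fun x : ℝ => Real.exp (-z.re * x)) (μ i j)}

/-- The entrywise Laplace transform of a matrix of measures. -/
def laplace (μ : Fin p → Fin p → Measure ℝ) (z : ℂ) : Matrix (Fin p) (Fin p) ℂ :=
  Matrix.of fun i j => ∫ x : ℝ, Complex.exp (-z * (x : ℂ)) ∂(μ i j)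

/-- The matrix of the masses at `0`. -/
def massAtZero (μ : Fin p → Fin p → Measure ℝ) : Matrix (Fin p) (Fin p) ℂ :=
  Matrix.of fun i j => (((μ i j).real {0} : ℝ) : ℂ)

/-- The roots of the characteristic equation `det (I - ℒμ(z)) = 0` in the domain. -/
def charRoots (μ : Fin p → Fin p → Measure ℝ) : Set ℂ :=
  {z | z ∈ laplaceDomain μ ∧ (1 - laplace μ z).det = 0}

/-- The roots of the characteristic equation with real part larger than `θ`. -/
def charRootsAbove (μ : Fin p → Fin p → Measure ℝ) (θ : ℝ) : Set ℂ :=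
  {z | z ∈ charRoots μ ∧ θ < z.re}

open Classical in
/-- For a root `z₀` of the characteristic equation, the pole order of `(I - ℒμ(z))⁻¹` at `z₀`: the
smallest `n` such that all entries of `(z - z₀) ^ n • (I - ℒμ(z))⁻¹` extend holomorphically to a
neighbourhood of `z₀`. It is `0` at the points that are not roots. -/
def poleOrder (μ : Fin p → Fin p → Measure ℝ) (z₀ : ℂ) : ℕ :=
  if z₀ ∈ charRoots μ then
    sInf {n : ℕ | ∀ i j, ∃ g : ℂ → ℂ, AnalyticAt ℂ g z₀ ∧
      ∀ᶠ z in 𝓝[≠] z₀, (z - z₀) ^ n * (1 - laplace μ z)⁻¹ i j = g z}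
  else 0

/-- `sup_η ‖(I - ℒμ(ϑ + iη))⁻¹‖ < ∞`, which includes that all these matrices are invertible.
All norms on a space of matrices are equivalent; here the maximum norm of the entries is used. -/
def BoundedInverseOnLine (μ : Fin p → Fin p → Measure ℝ) (ϑ : ℝ) : Prop :=
  ∃ M : ℝ, ∀ η : ℝ, (1 - laplace μ (ϑ + η * Complex.I)).det ≠ 0 ∧
    ∀ i j, ‖(1 - laplace μ (ϑ + η * Complex.I))⁻¹ i j‖ ≤ M

/-- Right-continuous with left limits. -/
def IsCadlag (f : ℝ → Fin p → ℝ) : Prop :=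
  ∀ x, ContinuousWithinAt f (Ici x) x ∧ ∃ l, Tendsto f (𝓝[<] x) (𝓝 l)

/-- The total variation function `x ↦ V g(x)`, the total variation of `g` on `(-∞, x]`. -/
def totalVar (g : ℝ → ℝ) (x : ℝ) : ℝ≥0∞ :=
  eVariationOn g (Iic x)

end MarkovRenewal

end

/-! For large real part the Neumann series of `ℒμ` converges, because `ℒμ(s)` tends to the matrix of
masses at `0` as `s → ∞`, and that matrix has spectral radius below `1`. There `ℒU = (I - ℒμ)⁻¹`,
and the distribution function `U(t)` has the transform `z⁻¹ (I - ℒμ(z))⁻¹`. This function is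
meromorphic near the closed half plane `Re z ≥ ϑ`, with possible poles only at the roots in `Λ_ϑ`
and, if `ϑ ≤ 0`, at `0`. A polar term `c / (z - w)^(k+1)` is the transform of `c t^k e^{wt} / k!`;
the sum of these over all poles is the main term `m`, and the transform `H` of `U - m` extends
holomorphically up to the line `Re z = ϑ`.

Two obstacles remain. The inverse is assumed bounded only on the line `Re z = ϑ`. Between it and a
line far to the right, `det (I - ℒμ)` is bounded, bounded below on both lines, and zero-free high up
since `Λ_ϑ` is finite. The Borel–Carathéodory inequality for its logarithm on discs then bounds it
below (`exists_norm_ge_in_strip`), and Cramer's rule bounds the inverse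
(`exists_norm_inv_le_in_strip`). Moreover `H` decays only like `1 / |Im z|`, too slowly for an
absolutely convergent inversion integral. Averaging `U - m` over a window of length `h` multiplies
`H` by a kernel of size `1 / (h |Im z|)`, and shifting the line to `ϑ` bounds the averages by
`e^{ϑt} log (1 + 1/h)` up to constants (`norm_average_le`). A monotone function is trapped between
its averages; a window exponentially small in `t` makes the variation of `m` harmless and turns the
logarithm into the factor `t` (`norm_monotone_sub_le`).

Each component of `f` is a difference of distribution functions of measures `ν` with `∫ e^{-θs}
ν(ds) < ∞` (`exists_isExpBounded_sub`). For one such part, `U * f` is `∫ U(t - s) ν(ds)`. Replacing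
`U` by `m` costs `O(e^{θt})`, and integration by parts yields `∫₀ᵗ f(x) m'(t - x) dx` plus a
boundary term `m(0) f(t) = O(e^{θt})` (`exists_norm_integral_sub_le`). The matrices `B` are the
coefficients of `m'`. Since all roots involved satisfy `Re λ > θ`, extending the integrals to
infinity again costs `O(e^{θt})` (`exists_norm_tail_le`), and the binomial theorem produces the
polynomial form. -/

namespace MarkovRenewal

/-! ### Contour shifts and Laplace inversion of window averages. -/

/-- Shifting a vertical line of integration through a strip of holomorphy. -/
theorem integral_vertical_eq {J : ℂ → ℂ} {a b M : ℝ} (hab : a ≤ b)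
    (hJ : ∀ z : ℂ, a ≤ z.re → z.re ≤ b → DifferentiableAt ℂ J z)
    (hM : ∀ z : ℂ, a ≤ z.re → z.re ≤ b → ‖J z‖ ≤ M / (1 + z.im ^ 2)) :
    ∫ η : ℝ, J (a + η * Complex.I) = ∫ η : ℝ, J (b + η * Complex.I) := by
  have hint : ∀ c : ℝ, a ≤ c → c ≤ b → Integrable (fun η : ℝ => J (c + η * Complex.I)) := by
    intro c hac hcb
    have hc : Continuous fun η : ℝ => J (c + η * Complex.I) := by
      rw [continuous_iff_continuousAt]
      intro η
      have h1 : ContinuousAt J ((c : ℂ) + η * Complex.I) :=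
        (hJ _ (by simpa using hac) (by simpa using hcb)).continuousAt
      exact ContinuousAt.comp (f := fun η : ℝ => (c : ℂ) + η * Complex.I) h1 (by fun_prop)
    refine Integrable.mono' (integrable_inv_one_add_sq.const_mul M) hc.aestronglyMeasurable
      (Eventually.of_forall fun η => ?_)
    simpa [div_eq_mul_inv] using hM (c + η * Complex.I) (by simpa using hac) (by simpa using hcb)
  -- Cauchy's theorem on the rectangle of height `2n` leaves the two horizontal sides, each of
  -- length `b - a` with integrand at most `M / (1 + n²)`.
  have hrect : ∀ n : ℕ, ‖(∫ y in (-n : ℝ)..n, J (b + y * Complex.I))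
      - ∫ y in (-n : ℝ)..n, J (a + y * Complex.I)‖ ≤ 2 * ((b - a) * (M / (1 + (n : ℝ) ^ 2))) := by
    intro n
    have h := Complex.integral_boundary_rect_eq_zero_of_differentiableOn J
      (a + (-n : ℝ) * Complex.I) (b + (n : ℝ) * Complex.I) (by
        intro z hz
        rw [Complex.mem_reProdIm] at hz
        have h1 : z.re ∈ Icc a b := by simpa [uIcc_of_le hab] using hz.1
        exact (hJ z h1.1 h1.2).differentiableWithinAt)
    have hb : ∀ s : ℝ, s ^ 2 = (n : ℝ) ^ 2 →
        ‖∫ x in a..b, J (x + s * Complex.I)‖ ≤ (b - a) * (M / (1 + (n : ℝ) ^ 2)) := by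
      intro s hs
      have := intervalIntegral.norm_integral_le_of_norm_le_const (a := a) (b := b)
        (f := fun x : ℝ => J (x + s * Complex.I)) (C := M / (1 + (n : ℝ) ^ 2)) (by
          intro x hx
          rw [uIoc_of_le hab] at hx
          have := hM (x + s * Complex.I) (by simpa using hx.1.le) (by simpa using hx.2)
          simpa [hs] using this)
      rwa [abs_of_nonneg (by linarith), mul_comm (M / _)] at this
    have h1 := hb (-n) (by ring)
    have h2 := hb n rfl
    simp only [Complex.add_re, Complex.ofReal_re, Complex.mul_re, Complex.I_re, mul_zero,
      Complex.ofReal_im, Complex.I_im, mul_one, sub_self, add_zero, Complex.add_im, Complex.mul_im,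
      zero_add, smul_eq_mul] at h
    set A := ∫ x in a..b, J (x + (-n : ℝ) * Complex.I)
    set B := ∫ x in a..b, J (x + (n : ℝ) * Complex.I)
    set P := ∫ y in (-n : ℝ)..n, J (b + y * Complex.I)
    set Q := ∫ y in (-n : ℝ)..n, J (a + y * Complex.I)
    have h3 : Complex.I * (P - Q) = B - A := by linear_combination h
    calc ‖P - Q‖ = ‖Complex.I * (P - Q)‖ := by simp
      _ = ‖B - A‖ := by rw [h3]
      _ ≤ ‖B‖ + ‖A‖ := norm_sub_le _ _
      _ ≤ _ := by linarith
  have hn : Tendsto (fun n : ℕ => (n : ℝ)) atTop atTop := tendsto_natCast_atTop_atTop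
  have hn' : Tendsto (fun n : ℕ => -(n : ℝ)) atTop atBot := tendsto_neg_atTop_atBot.comp hn
  have l1 := intervalIntegral_tendsto_integral (hint b hab le_rfl) hn' hn
  have l2 := intervalIntegral_tendsto_integral (hint a le_rfl hab) hn' hn
  have l3 := (l1.sub l2).norm
  have l4 : Tendsto (fun n : ℕ => 2 * ((b - a) * (M / (1 + (n : ℝ) ^ 2)))) atTop (𝓝 0) := by
    have : Tendsto (fun n : ℕ => 1 + (n : ℝ) ^ 2) atTop atTop :=
      tendsto_atTop_add_const_left _ _ ((tendsto_pow_atTop two_ne_zero).comp hn)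
    have := (this.const_div_atTop M).const_mul (b - a) |>.const_mul 2
    simpa using this
  have := le_of_tendsto_of_tendsto' l3 l4 hrect
  have h0 := norm_le_zero_iff.1 this
  exact (sub_eq_zero.1 h0).symm

/-- The Laplace transform of the uniform distribution on `[-h, 0]`. -/
noncomputable def avgKernel (h : ℝ) (z : ℂ) : ℂ := dslope Complex.exp 0 (z * h)

theorem differentiable_avgKernel (h : ℝ) : Differentiable ℂ (avgKernel h) := by
  have h1 : Differentiable ℂ (dslope Complex.exp 0) := by
    have := (Complex.differentiableOn_dslope (f := Complex.exp) (c := 0) (s := univ)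
      (by simp)).2 Complex.differentiable_exp.differentiableOn
    simpa [differentiableOn_univ] using this
  exact h1.comp (by fun_prop)

theorem integral_exp_mul_eq_avgKernel {h : ℝ} (hh : 0 < h) (z : ℂ) :
    ∫ u in (0 : ℝ)..h, Complex.exp (z * u) = h * avgKernel h z := by
  have hh' : (h : ℂ) ≠ 0 := by exact_mod_cast hh.ne'
  rcases eq_or_ne z 0 with rfl | hz
  · simp [avgKernel, dslope_same]
  · rw [integral_exp_mul_complex hz, avgKernel, dslope_of_ne _ (mul_ne_zero hz hh'), slope_def_field]
    simp
    field_simp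

/-- The trivial bound by `e^{|Re z|}` serves low frequencies, and `z h · avgKernel h z = e^{zh} - 1`
gives the decay in `h |Im z|` with constant `2`. The assumption `h ≤ 1` keeps the constants
independent of `h`. -/
theorem norm_avgKernel_le {h : ℝ} (hh : 0 < h) (hh1 : h ≤ 1) (z : ℂ) :
    ‖avgKernel h z‖ * (1 + h * |z.im|) ≤ 3 * Real.exp |z.re| := by
  have h1 : ‖avgKernel h z‖ ≤ Real.exp |z.re| := by
    have h2 : ‖∫ u in (0 : ℝ)..h, Complex.exp (z * u)‖ ≤ Real.exp |z.re| * |h - 0| := by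
      apply intervalIntegral.norm_integral_le_of_norm_le_const
      intro u hu
      rw [uIoc_of_le hh.le] at hu
      rw [Complex.norm_exp]
      apply Real.exp_le_exp.2
      simp only [Complex.mul_re, Complex.ofReal_re, Complex.ofReal_im, mul_zero, sub_zero]
      calc z.re * u ≤ |z.re| * u := by gcongr; exact hu.1.le; exact le_abs_self _
        _ ≤ |z.re| * 1 := by gcongr; exact hu.2.trans hh1
        _ = _ := mul_one _
    rw [integral_exp_mul_eq_avgKernel hh, norm_mul, Complex.norm_real, Real.norm_eq_abs,
      abs_of_pos hh, sub_zero, abs_of_pos hh, mul_comm] at h2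
    exact le_of_mul_le_mul_right h2 hh
  have h3 : ‖avgKernel h z‖ * (h * |z.im|) ≤ 2 * Real.exp |z.re| := by
    have h4 : z * h * avgKernel h z = Complex.exp (z * h) - 1 := by
      have := sub_smul_dslope Complex.exp 0 (z * h)
      simpa [avgKernel] using this
    have h5 : ‖Complex.exp (z * h) - 1‖ ≤ 2 * Real.exp |z.re| := by
      refine (norm_sub_le _ _).trans ?_
      rw [Complex.norm_exp, norm_one]
      have : Real.exp (z * h).re ≤ Real.exp |z.re| := by
        apply Real.exp_le_exp.2
        simp only [Complex.mul_re, Complex.ofReal_re, Complex.ofReal_im, mul_zero, sub_zero]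
        calc z.re * h ≤ |z.re| * h := by gcongr; exact le_abs_self _
          _ ≤ |z.re| * 1 := by gcongr
          _ = _ := mul_one _
      have : 1 ≤ Real.exp |z.re| := Real.one_le_exp (abs_nonneg _)
      linarith
    calc ‖avgKernel h z‖ * (h * |z.im|) ≤ ‖avgKernel h z‖ * (h * ‖z‖) := by
          gcongr; exact Complex.abs_im_le_norm z
      _ = ‖z * h * avgKernel h z‖ := by
          rw [norm_mul, norm_mul, Complex.norm_real, Real.norm_eq_abs, abs_of_pos hh]; ring
      _ ≤ _ := by rw [h4]; exact h5
  linarith [mul_add ‖avgKernel h z‖ 1 (h * |z.im|), mul_one ‖avgKernel h z‖]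

end MarkovRenewal

namespace MarkovRenewal

/-- Licenses Fubini for the window integral and the Laplace integral: translates of `G` all have the
same `L¹` norm, and the window has finite length. -/
theorem integrable_exp_mul_comp_add {G : ℝ → ℂ} (hG : Integrable G) (h : ℝ) (z : ℂ) :
    Integrable (fun q : ℝ × ℝ => Complex.exp (z * q.2) * G (q.1 + q.2))
      (volume.prod (volume.restrict (Ioc 0 h))) := by
  have hm : AEStronglyMeasurable (fun q : ℝ × ℝ => G (q.1 + q.2))
      (volume.prod (volume.restrict (Ioc 0 h))) := by
    have h1 : AEStronglyMeasurable (fun q : ℝ × ℝ => G (q.1 + q.2))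
        ((volume : Measure ℝ).prod (volume : Measure ℝ)) :=
      hG.aestronglyMeasurable.comp_quasiMeasurePreserving (quasiMeasurePreserving_add _ _)
    refine h1.mono_ac ?_
    exact Measure.AbsolutelyContinuous.prod Measure.AbsolutelyContinuous.rfl
      Measure.restrict_le_self.absolutelyContinuous
  have hi : Integrable (fun q : ℝ × ℝ => G (q.1 + q.2))
      (volume.prod (volume.restrict (Ioc 0 h))) := by
    rw [integrable_prod_iff' hm]
    refine ⟨Eventually.of_forall fun u => hG.comp_add_right u, ?_⟩
    have : (fun u : ℝ => ∫ x : ℝ, ‖G (x + u)‖) = fun _ => ∫ x : ℝ, ‖G x‖ := by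
      funext u
      exact integral_add_right_eq_self (fun x => ‖G x‖) u
    simp only [this]
    exact integrable_const _
  refine hi.bdd_mul (c := Real.exp (|z.re| * |h|)) ?_ ?_
  · exact Continuous.aestronglyMeasurable (by fun_prop)
  · have : ∀ᵐ q : ℝ × ℝ ∂(volume.prod (volume.restrict (Ioc 0 h))), q.2 ∈ Ioc 0 h := by
      have h3 : ∀ᵐ u ∂(volume.restrict (Ioc (0 : ℝ) h)), u ∈ Ioc 0 h :=
        ae_restrict_mem measurableSet_Ioc
      exact Measure.quasiMeasurePreserving_snd.ae h3
    filter_upwards [this] with q hq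
    rw [Complex.norm_exp]
    apply Real.exp_le_exp.2
    simp only [Complex.mul_re, Complex.ofReal_re, Complex.ofReal_im, mul_zero, sub_zero]
    calc z.re * q.2 ≤ |z.re * q.2| := le_abs_self _
      _ = |z.re| * |q.2| := abs_mul _ _
      _ ≤ _ := by
        rw [abs_of_pos hq.1]
        gcongr
        exact hq.2.trans (le_abs_self _)

/-- By translation invariance, the inner integral after the exchange depends on `u` only through
`exp (z u)`, so the transform of the window splits off as a factor. -/
theorem integral_average {G : ℝ → ℂ} (hG : Integrable G) {h : ℝ} (hh : 0 < h) (z : ℂ) :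
    Integrable (fun x : ℝ => ∫ u in (0 : ℝ)..h, Complex.exp (z * u) * G (x + u)) ∧
    ∫ x : ℝ, ∫ u in (0 : ℝ)..h, Complex.exp (z * u) * G (x + u)
      = h * avgKernel h z * ∫ x, G x := by
  have hi := integrable_exp_mul_comp_add hG h z
  simp only [intervalIntegral.integral_of_le hh.le]
  refine ⟨hi.integral_prod_left, ?_⟩
  rw [integral_integral_swap hi]
  have : ∀ u : ℝ, ∫ x : ℝ, Complex.exp (z * u) * G (x + u)
      = Complex.exp (z * u) * ∫ x, G x := by
    intro u
    rw [integral_const_mul, integral_add_right_eq_self (fun x => G x) u]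
  simp only [this]
  rw [integral_mul_const, ← intervalIntegral.integral_of_le hh.le,
    integral_exp_mul_eq_avgKernel hh]

/-- The average of `R` over `[x, x + h]`. -/
noncomputable def average (h : ℝ) (R : ℝ → ℂ) (x : ℝ) : ℂ := (h : ℂ)⁻¹ * ∫ y in x..(x + h), R y

/-- Splitting the weight at the base point into the weight at `x + u` and `exp (z u)` brings the
average into the form treated by `integral_average`. -/
theorem exp_mul_average (h : ℝ) (R : ℝ → ℂ) (x : ℝ) (z : ℂ) :
    Complex.exp (-z * x) * average h R x = (h : ℂ)⁻¹ *
      ∫ u in (0 : ℝ)..h, Complex.exp (z * u) * (Complex.exp (-z * ↑(x + u)) * R (x + u)) := by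
  have h1 : ∀ u : ℝ, Complex.exp (z * u) * (Complex.exp (-z * ↑(x + u)) * R (x + u))
      = Complex.exp (-z * x) * R (x + u) := by
    intro u
    rw [← mul_assoc, ← Complex.exp_add]
    congr 2
    push_cast
    ring
  simp only [h1]
  rw [intervalIntegral.integral_const_mul, intervalIntegral.integral_comp_add_left, add_zero,
    average]
  ring

/-- Laplace inversion for averages. -/
theorem average_eq_integral {R : ℝ → ℂ} {σ h : ℝ} (hh : 0 < h)
    (hR : Integrable fun x : ℝ => Complex.exp (-(σ : ℂ) * x) * R x) {H : ℂ → ℂ}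
    (hH : ∀ z : ℂ, z.re = σ → ∫ x : ℝ, Complex.exp (-z * x) * R x = H z)
    (hInt : Integrable fun η : ℝ => avgKernel h (σ + η * Complex.I) * H (σ + η * Complex.I))
    (t : ℝ) :
    2 * Real.pi * average h R t = ∫ η : ℝ, Complex.exp ((σ + η * Complex.I) * t) *
      (avgKernel h (σ + η * Complex.I) * H (σ + η * Complex.I)) := by
  have hpi : (0 : ℝ) < 2 * Real.pi := by positivity
  have hh' : (h : ℂ) ≠ 0 := by exact_mod_cast hh.ne'
  -- The tilted average is integrable and continuous with integrable Fourier transform, so Fourier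
  -- inversion recovers it at every single point.
  set q : ℝ → ℂ := fun x => Complex.exp (-(σ : ℂ) * x) * average h R x with hq
  have hRloc : ∀ a b, IntervalIntegrable R volume a b := by
    intro a b
    have h1 : IntervalIntegrable (fun x : ℝ => Complex.exp (-(σ : ℂ) * x) * R x) volume a b :=
      hR.intervalIntegrable
    have h2 := h1.continuousOn_mul (g := fun x : ℝ => Complex.exp ((σ : ℂ) * x))
      (by fun_prop)
    refine h2.congr (fun x _ => ?_)
    rw [← mul_assoc, ← Complex.exp_add]
    simp
  have hqc : Continuous q := by
    have h1 : Continuous fun x => ∫ y in (0 : ℝ)..x, R y :=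
      intervalIntegral.continuous_primitive hRloc 0
    have h2 : average h R = fun x => (h : ℂ)⁻¹ *
        ((∫ y in (0 : ℝ)..(x + h), R y) - ∫ y in (0 : ℝ)..x, R y) := by
      funext x
      rw [average, intervalIntegral.integral_interval_sub_left (hRloc _ _) (hRloc _ _)]
    rw [hq, h2]
    have h3 : Continuous fun x => ∫ y in (0 : ℝ)..(x + h), R y := h1.comp (continuous_add_const h)
    fun_prop
  have hGz : ∀ z : ℂ, z.re = σ → Integrable fun x : ℝ => Complex.exp (-z * x) * R x := by
    intro z hz
    have : (fun x : ℝ => Complex.exp (-z * x) * R x) = fun x : ℝ =>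
        Complex.exp (-(z.im : ℂ) * Complex.I * x) * (Complex.exp (-(σ : ℂ) * x) * R x) := by
      funext x
      rw [← mul_assoc, ← Complex.exp_add]
      congr 2
      conv_lhs => rw [← Complex.re_add_im z, hz]
      ring
    rw [this]
    refine hR.bdd_mul (c := 1) (Continuous.aestronglyMeasurable (by fun_prop))
      (Eventually.of_forall fun x => ?_)
    rw [Complex.norm_exp]
    simp
  have hqi : Integrable q := by
    have := (integral_average (hGz σ (by simp)) hh (σ : ℂ)).1.const_mul (h : ℂ)⁻¹
    exact this.congr (Eventually.of_forall fun x => (exp_mul_average h R x σ).symm)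
  -- The frequency `ξ` sits at the point `σ + 2πiξ` of the line; rescaling by `2π` produces the
  -- factor in the conclusion.
  have hF : ∀ ξ : ℝ, FourierTransform.fourier q ξ = avgKernel h (σ + (2 * Real.pi * ξ : ℝ) * Complex.I)
      * H (σ + (2 * Real.pi * ξ : ℝ) * Complex.I) := by
    intro ξ
    set z : ℂ := σ + (2 * Real.pi * ξ : ℝ) * Complex.I with hz
    have hzre : z.re = σ := by simp [hz]
    have h1 := (integral_average (hGz z hzre) hh z).2
    rw [hH z hzre] at h1
    rw [Real.fourier_eq']
    have h2 : ∀ x : ℝ, Complex.exp (↑(-2 * Real.pi * inner ℝ x ξ) * Complex.I) • q x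
        = (h : ℂ)⁻¹ * ∫ u in (0 : ℝ)..h,
          Complex.exp (z * u) * (Complex.exp (-z * ↑(x + u)) * R (x + u)) := by
      intro x
      rw [← exp_mul_average, hq, smul_eq_mul, ← mul_assoc, ← Complex.exp_add]
      congr 2
      simp [hz]
      ring
    simp only [h2]
    rw [integral_const_mul, h1]
    field_simp
  have hFi : Integrable (FourierTransform.fourier q) := by
    have h1 := hInt.comp_mul_left' hpi.ne'
    exact h1.congr (Eventually.of_forall fun ξ => by rw [hF])
  have hinv := hqi.fourierInv_fourier_eq hFi hqc.continuousAt (v := t)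
  rw [Real.fourierInv_eq'] at hinv
  have h4 : ∀ ξ : ℝ, Complex.exp (↑(2 * Real.pi * inner ℝ ξ t) * Complex.I) •
      FourierTransform.fourier q ξ = Complex.exp (-(σ : ℂ) * t) * (fun η : ℝ =>
        Complex.exp ((σ + η * Complex.I) * t) *
      (avgKernel h (σ + η * Complex.I) * H (σ + η * Complex.I))) (2 * Real.pi * ξ) := by
    intro ξ
    rw [hF, smul_eq_mul]
    simp only
    rw [← mul_assoc (Complex.exp (-(σ : ℂ) * t)), ← Complex.exp_add]
    congr 2
    simp
    ring
  simp only [h4] at hinv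
  rw [integral_const_mul, Measure.integral_comp_mul_left (fun η : ℝ =>
        Complex.exp ((σ + η * Complex.I) * t) *
      (avgKernel h (σ + η * Complex.I) * H (σ + η * Complex.I))), hq] at hinv
  have h5 := mul_left_cancel₀ (Complex.exp_ne_zero _) hinv
  rw [← h5, abs_of_pos (by positivity), Complex.real_smul]
  push_cast
  rw [mul_inv_cancel_left₀ (by simp)]

/-- The half line is split at `1/h`. Below, dropping `1 + h|η|` leaves `log (1 + 1/h)`; above, the
integrand is at most `h⁻¹ η⁻²`, with integral `1`. -/
theorem integral_inv_mul_inv_le {h : ℝ} (hh : 0 < h) :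
    Integrable (fun η : ℝ => ((1 + h * |η|) * (1 + |η|))⁻¹) ∧
    ∫ η : ℝ, ((1 + h * |η|) * (1 + |η|))⁻¹ ≤ 2 * (Real.log (1 + h⁻¹) + 1) := by
  have hi : Integrable (fun η : ℝ => ((1 + h * |η|) * (1 + |η|))⁻¹) := by
    have hc : Continuous fun η : ℝ => ((1 + h * |η|) * (1 + |η|))⁻¹ :=
      Continuous.inv₀ (by fun_prop) fun η => by positivity
    refine Integrable.mono' (integrable_inv_one_add_sq.const_mul (1 + h⁻¹)) hc.aestronglyMeasurable
      (Eventually.of_forall fun η => ?_)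
    rw [Real.norm_of_nonneg (by positivity), ← div_eq_mul_inv, inv_eq_one_div,
      div_le_div_iff₀ (by positivity) (by positivity), ← sq_abs]
    have h1 : h⁻¹ * h = 1 := inv_mul_cancel₀ hh.ne'
    have h2 : 0 ≤ |η| := abs_nonneg η
    have h3 : (1 + h⁻¹) * ((1 + h * |η|) * (1 + |η|)) = 1 + |η| ^ 2 + h * |η| + h * |η| ^ 2 + |η|
        + h⁻¹ + |η| + h⁻¹ * |η| := by linear_combination (|η| + |η| ^ 2) * h1
    rw [h3, one_mul]
    have : 0 < h⁻¹ := by positivity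
    nlinarith [mul_nonneg hh.le h2, mul_nonneg hh.le (sq_nonneg |η|), mul_nonneg this.le h2]
  refine ⟨hi, ?_⟩
  rw [integral_comp_abs (f := fun x : ℝ => ((1 + h * x) * (1 + x))⁻¹)]
  gcongr
  have hi' : IntegrableOn (fun x : ℝ => ((1 + h * x) * (1 + x))⁻¹) (Ioi 0) :=
    hi.integrableOn.congr_fun (fun x hx => by simp only; rw [abs_of_pos hx]) measurableSet_Ioi
  have hp : 0 < h⁻¹ := by positivity
  rw [← Ioc_union_Ioi_eq_Ioi hp.le, setIntegral_union (Ioc_disjoint_Ioi le_rfl) measurableSet_Ioi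
    (hi'.mono_set Ioc_subset_Ioi_self) (hi'.mono_set (Ioi_subset_Ioi hp.le))]
  gcongr
  · have h1 : ∫ x in (0 : ℝ)..h⁻¹, (1 + x)⁻¹ = Real.log (1 + h⁻¹) := by
      rw [intervalIntegral.integral_comp_add_left (fun x => x⁻¹), integral_inv_of_pos (by norm_num)
        (by positivity)]
      simp
    rw [← h1, intervalIntegral.integral_of_le hp.le]
    refine setIntegral_mono_on (hi'.mono_set Ioc_subset_Ioi_self) ?_ measurableSet_Ioc ?_
    · have : IntervalIntegrable (fun x : ℝ => (1 + x)⁻¹) volume 0 h⁻¹ := by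
        refine ContinuousOn.intervalIntegrable ?_
        rw [uIcc_of_le hp.le]
        exact ContinuousOn.inv₀ (by fun_prop) fun x hx => by have := hx.1; positivity
      exact (intervalIntegrable_iff_integrableOn_Ioc_of_le hp.le).1 this
    · intro x hx
      have := hx.1
      apply inv_anti₀ (by positivity)
      have : 0 ≤ h * x := by positivity
      nlinarith
  · have h1 : ∫ x in Ioi h⁻¹, h⁻¹ * x ^ (-2 : ℝ) = 1 := by
      rw [integral_const_mul, integral_Ioi_rpow_of_lt (by norm_num) hp]
      norm_num
      rw [Real.rpow_neg hp.le, Real.rpow_one]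
      field_simp
    refine le_trans ?_ h1.le
    refine setIntegral_mono_on (hi'.mono_set (Ioi_subset_Ioi hp.le))
      ((integrableOn_Ioi_rpow_of_lt (by norm_num) hp).const_mul _) measurableSet_Ioi ?_
    intro x hx
    have hx0 : 0 < x := hp.trans hx
    rw [Real.rpow_neg hx0.le, show (2 : ℝ) = ((2 : ℕ) : ℝ) by norm_num, Real.rpow_natCast,
      ← mul_inv]
    apply inv_anti₀ (by positivity)
    nlinarith [mul_pos hh hx0]

end MarkovRenewal

/-! ### A Tauberian theorem with exponential remainder. -/

namespace MarkovRenewal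

/-- If the Laplace transform of `R` extends holomorphically to a strip to the left, where it decays
like `1 / |Im z|`, then the averages of `R` grow at most like the left edge of the strip, up to a
factor that is logarithmic in the window. -/
theorem norm_average_le {R : ℝ → ℂ} {ϑ σ M : ℝ} (hϑσ : ϑ < σ)
    (hR : Integrable fun x : ℝ => Complex.exp (-(σ : ℂ) * x) * R x) {H : ℂ → ℂ}
    (hH : ∀ z : ℂ, z.re = σ → ∫ x : ℝ, Complex.exp (-z * x) * R x = H z)
    (hd : ∀ z : ℂ, ϑ ≤ z.re → z.re ≤ σ → DifferentiableAt ℂ H z)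
    (hM : ∀ z : ℂ, ϑ ≤ z.re → z.re ≤ σ → ‖H z‖ ≤ M / (1 + |z.im|)) :
    ∃ K, 0 ≤ K ∧ ∀ h, 0 < h → h ≤ 1 → ∀ t,
      ‖average h R t‖ ≤ K * Real.exp (ϑ * t) * (Real.log (1 + h⁻¹) + 1) := by
  have hM0 : 0 ≤ M := by
    have := (norm_nonneg _).trans (hM ϑ (by simp) (by simpa using hϑσ.le))
    simpa using this
  have hk : ∀ h, 0 < h → h ≤ 1 → ∀ z : ℂ, ϑ ≤ z.re → z.re ≤ σ →
      ‖avgKernel h z * H z‖ ≤ 3 * Real.exp |z.re| * M * ((1 + h * |z.im|) * (1 + |z.im|))⁻¹ := by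
    intro h hh hh1 z h1 h2
    have h3 := norm_avgKernel_le hh hh1 z
    rw [← le_div_iff₀ (by positivity)] at h3
    rw [norm_mul]
    calc ‖avgKernel h z‖ * ‖H z‖ ≤ (3 * Real.exp |z.re| / (1 + h * |z.im|)) * (M / (1 + |z.im|)) := by
          gcongr; exact hM z h1 h2
      _ = _ := by field_simp
  refine ⟨3 * Real.exp |ϑ| * M, by positivity, fun h hh hh1 t => ?_⟩
  have hpi : 1 ≤ Real.pi := by linarith [Real.pi_gt_three]
  obtain ⟨hi, hle⟩ := integral_inv_mul_inv_le hh
  set J : ℂ → ℂ := fun z => Complex.exp (z * t) * (avgKernel h z * H z) with hJ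
  have hJd : ∀ z : ℂ, ϑ ≤ z.re → z.re ≤ σ → DifferentiableAt ℂ J z := by
    intro z h1 h2
    have := (differentiable_avgKernel h) z
    have := hd z h1 h2
    fun_prop
  have hline : ∀ η : ℝ, ((1 + h * |η|) * (1 + |η|))⁻¹ ≤ h⁻¹ / (1 + η ^ 2) := by
    intro η
    rw [inv_eq_one_div, div_le_div_iff₀ (by positivity) (by positivity), one_mul, ← sq_abs]
    have h3 : h⁻¹ * ((1 + h * |η|) * (1 + |η|)) = h⁻¹ + h⁻¹ * |η| + |η| + |η| ^ 2 := by
      field_simp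
      ring
    have h4 : 1 ≤ h⁻¹ := (one_le_inv₀ hh).2 hh1
    rw [h3]
    nlinarith [abs_nonneg η]
  -- This constant depends on `h` and `t`, which is harmless: it only permits the shift of the line.
  -- The quantitative bound is taken afterwards on `Re z = ϑ`.
  have hMJ : ∀ z : ℂ, ϑ ≤ z.re → z.re ≤ σ → ‖J z‖ ≤
      (Real.exp ((|ϑ| + |σ|) * |t|) * (3 * Real.exp (|ϑ| + |σ|) * M) * h⁻¹) / (1 + z.im ^ 2) := by
    intro z h1 h2
    have h5 : |z.re| ≤ |ϑ| + |σ| := by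
      rw [abs_le]
      constructor <;> cases abs_cases ϑ <;> cases abs_cases σ <;> linarith
    have h6 : ‖Complex.exp (z * t)‖ ≤ Real.exp ((|ϑ| + |σ|) * |t|) := by
      rw [Complex.norm_exp]
      apply Real.exp_le_exp.2
      simp only [Complex.mul_re, Complex.ofReal_re, Complex.ofReal_im, mul_zero, sub_zero]
      calc z.re * t ≤ |z.re * t| := le_abs_self _
        _ = |z.re| * |t| := abs_mul _ _
        _ ≤ _ := by gcongr
    rw [hJ, norm_mul, mul_assoc, mul_div_assoc]
    refine mul_le_mul h6 ?_ (norm_nonneg _) (by positivity)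
    refine (hk h hh hh1 z h1 h2).trans ?_
    rw [mul_div_assoc]
    gcongr
    exact hline z.im
  have hintσ : Integrable fun η : ℝ => avgKernel h (σ + η * Complex.I) * H (σ + η * Complex.I) := by
    have hc : Continuous fun η : ℝ =>
        avgKernel h (σ + η * Complex.I) * H (σ + η * Complex.I) := by
      rw [continuous_iff_continuousAt]
      intro η
      have h1 : ContinuousAt (fun z => avgKernel h z * H z) ((σ : ℂ) + η * Complex.I) :=
        (((differentiable_avgKernel h) _).mul
          (hd _ (by simpa using hϑσ.le) (by simp))).continuousAt
      exact ContinuousAt.comp (f := fun η : ℝ => (σ : ℂ) + η * Complex.I) h1 (by fun_prop)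
    refine (hi.const_mul (3 * Real.exp |σ| * M)).mono' hc.aestronglyMeasurable
      (Eventually.of_forall fun η => ?_)
    simpa using hk h hh hh1 (σ + η * Complex.I) (by simpa using hϑσ.le) (by simp)
  have h1 := average_eq_integral hh hR hH hintσ t
  have h2 := integral_vertical_eq hϑσ.le hJd hMJ
  rw [← h2] at h1
  have h3 : ‖∫ η : ℝ, J (ϑ + η * Complex.I)‖ ≤
      ∫ η : ℝ, Real.exp (ϑ * t) * (3 * Real.exp |ϑ| * M) * ((1 + h * |η|) * (1 + |η|))⁻¹ := by
    refine norm_integral_le_of_norm_le (hi.const_mul _) (Eventually.of_forall fun η => ?_)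
    rw [hJ, norm_mul, Complex.norm_exp, mul_assoc (Real.exp _)]
    have := hk h hh hh1 (ϑ + η * Complex.I) (by simp) (by simpa using hϑσ.le)
    have h4 : (((ϑ : ℂ) + η * Complex.I) * t).re = ϑ * t := by simp
    rw [h4]
    gcongr
    simpa using this
  rw [integral_const_mul] at h3
  rw [← h1, norm_mul, norm_mul, Complex.norm_real, Complex.norm_ofNat, Real.norm_eq_abs,
    abs_of_pos Real.pi_pos] at h3
  have hlog : 0 ≤ Real.log (1 + h⁻¹) := Real.log_nonneg (by have : 0 < h⁻¹ := by positivity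
                                                            linarith)
  have h5 : 2 * ‖average h R t‖ ≤ 2 * Real.pi * ‖average h R t‖ := by
    nlinarith [norm_nonneg (average h R t)]
  have h6 := h5.trans (h3.trans (mul_le_mul_of_nonneg_left hle (by positivity)))
  nlinarith

/-- This is where monotonicity enters: the window ending at a point bounds the value there from
below, the window starting there from above. -/
theorem average_bounds {u : ℝ → ℝ} (hu : Monotone u) {h : ℝ} (hh : 0 < h) (x : ℝ) :
    ∃ a : ℝ, average h (fun y => (u y : ℂ)) x = a ∧ u x ≤ a ∧ a ≤ u (x + h) := by
  refine ⟨h⁻¹ * ∫ y in x..(x + h), u y, ?_, ?_, ?_⟩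
  · rw [average, intervalIntegral.integral_ofReal]
    push_cast
    rfl
  · have h1 : ∫ _ in x..(x + h), u x ≤ ∫ y in x..(x + h), u y :=
      intervalIntegral.integral_mono_on (by linarith) (by simp) hu.intervalIntegrable
        fun y hy => hu hy.1
    rw [intervalIntegral.integral_const, add_sub_cancel_left, smul_eq_mul] at h1
    rw [inv_mul_eq_div, le_div_iff₀ hh]
    linarith
  · have h1 : ∫ y in x..(x + h), u y ≤ ∫ _ in x..(x + h), u (x + h) :=
      intervalIntegral.integral_mono_on (by linarith) hu.intervalIntegrable (by simp)
        fun y hy => hu hy.2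
    rw [intervalIntegral.integral_const, add_sub_cancel_left, smul_eq_mul] at h1
    rw [inv_mul_eq_div, div_le_iff₀ hh]
    linarith

theorem norm_average_sub_le {m : ℝ → ℂ} (hm : Continuous m) {h : ℝ} (hh : 0 < h) {x B : ℝ} {w : ℂ}
    (hB : ∀ y ∈ Icc x (x + h), ‖m y - w‖ ≤ B) : ‖average h m x - w‖ ≤ B := by
  have hh' : (h : ℂ) ≠ 0 := by exact_mod_cast hh.ne'
  have h1 : average h m x - w = (h : ℂ)⁻¹ * ∫ y in x..(x + h), (m y - w) := by
    rw [intervalIntegral.integral_sub (hm.intervalIntegrable _ _) (by simp),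
      intervalIntegral.integral_const, average, mul_sub, add_sub_cancel_left, Complex.real_smul]
    field_simp
  have h2 := intervalIntegral.norm_integral_le_of_norm_le_const (a := x) (b := x + h)
    (f := fun y => m y - w) (C := B) (fun y hy => by
      rw [uIoc_of_le (by linarith)] at hy
      exact hB y ⟨hy.1.le, hy.2⟩)
  rw [add_sub_cancel_left, abs_of_pos hh] at h2
  rw [h1, norm_mul, norm_inv, Complex.norm_real, Real.norm_eq_abs, abs_of_pos hh,
    inv_mul_eq_div, div_le_iff₀ hh]
  exact h2

/-- A Tauberian theorem for monotone functions with an exponentially small remainder. -/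
theorem norm_monotone_sub_le {u : ℝ → ℝ} (hu : Monotone u) {m m' : ℝ → ℂ}
    (hm : ∀ t, HasDerivAt m (m' t) t) {ϑ s σ K M : ℝ} (hs : 0 ≤ s) (hϑs : ϑ < s) (hsσ : s ≤ σ)
    (hm' : ∀ t, 0 ≤ t → ‖m' t‖ ≤ K * Real.exp (s * t)) {R : ℝ → ℂ}
    (hRu : ∀ t, 0 ≤ t → R t = u t - m t)
    (hR : Integrable fun x : ℝ => Complex.exp (-(σ : ℂ) * x) * R x) {H : ℂ → ℂ}
    (hH : ∀ z : ℂ, z.re = σ → ∫ x : ℝ, Complex.exp (-z * x) * R x = H z)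
    (hd : ∀ z : ℂ, ϑ ≤ z.re → z.re ≤ σ → DifferentiableAt ℂ H z)
    (hM : ∀ z : ℂ, ϑ ≤ z.re → z.re ≤ σ → ‖H z‖ ≤ M / (1 + |z.im|)) :
    ∃ K', ∀ t, 1 ≤ t → ‖(u t : ℂ) - m t‖ ≤ K' * t * Real.exp (ϑ * t) := by
  obtain ⟨A, hA0, hA⟩ := norm_average_le (hϑs.trans_le hsσ) hR hH hd hM
  have hK : 0 ≤ K := by
    have := (norm_nonneg _).trans (hm' 0 le_rfl)
    simpa using this
  have hmc : Continuous m := continuous_iff_continuousAt.2 fun t => (hm t).continuousAt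
  set c := s - ϑ with hc
  have hc0 : 0 < c := sub_pos.2 hϑs
  refine ⟨3 * (A * Real.exp |ϑ| * (c + 2) + K * Real.exp s), fun t ht => ?_⟩
  -- Over such a window `m` varies by about `h e^{st} = e^{ϑt}`, while `log (1 + 1/h)` grows
  -- linearly in `t`.
  set h := Real.exp (-(c * t)) with hh_def
  have hh : 0 < h := Real.exp_pos _
  have hh1 : h ≤ 1 := by
    rw [hh_def, Real.exp_le_one_iff]
    nlinarith
  have hlog : Real.log (1 + h⁻¹) + 1 ≤ (c + 2) * t := by
    have h1 : 1 + h⁻¹ ≤ 2 * Real.exp (c * t) := by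
      rw [hh_def, Real.exp_neg, inv_inv]
      have := Real.one_le_exp (x := c * t) (by positivity)
      linarith
    have h2 := Real.log_le_log (by positivity) h1
    rw [Real.log_mul (by norm_num) (Real.exp_ne_zero _), Real.log_exp] at h2
    have := Real.log_two_lt_d9
    nlinarith
  have hlog0 : 0 ≤ Real.log (1 + h⁻¹) + 1 := by
    have : 0 ≤ Real.log (1 + h⁻¹) := Real.log_nonneg (le_add_of_nonneg_right (by positivity))
    linarith
  -- Both windows `[t - h, t]` and `[t, t + h]` are covered; `t ≥ 1 ≥ h` keeps them in the range
  -- where `R` equals `u - m`.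
  have key : ∀ x, t - h ≤ x → x ≤ t → ‖average h (fun y => (u y : ℂ)) x - m t‖ ≤
      (A * Real.exp |ϑ| * (c + 2) + K * Real.exp s) * t * Real.exp (ϑ * t) := by
    intro x hx1 hx2
    have hx0 : 0 ≤ x := by linarith
    have h1 : average h R x = average h (fun y => (u y : ℂ)) x - average h m x := by
      rw [average, average, average, ← mul_sub, ← intervalIntegral.integral_sub]
      · congr 1
        refine intervalIntegral.integral_congr fun y hy => ?_
        rw [uIcc_of_le (by linarith)] at hy
        exact hRu y (hx0.trans hy.1)
      · have : IntervalIntegrable u volume x (x + h) := hu.intervalIntegrable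
        exact ⟨this.1.ofReal, this.2.ofReal⟩
      · exact hmc.intervalIntegrable _ _
    have h2 : ‖average h m x - m t‖ ≤ K * Real.exp s * Real.exp (ϑ * t) := by
      refine norm_average_sub_le hmc hh fun y hy => ?_
      have h3 := (convex_Icc (t - h) (t + h)).norm_image_sub_le_of_norm_hasDerivWithin_le
        (f := m) (f' := m') (C := K * Real.exp (s * (t + 1))) (x := t) (y := y)
        (fun z _ => (hm z).hasDerivWithinAt) (fun z hz => (hm' z (by linarith [hz.1])).trans (by
          gcongr; linarith [hz.2])) ⟨by linarith, by linarith⟩ ⟨by linarith [hy.1], by linarith [hy.2]⟩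
      have h4 : ‖y - t‖ ≤ h := by
        rw [Real.norm_eq_abs, abs_le]
        constructor <;> linarith [hy.1, hy.2]
      calc ‖m y - m t‖ ≤ K * Real.exp (s * (t + 1)) * h := h3.trans (by gcongr)
        _ = K * Real.exp s * Real.exp (ϑ * t) := by
          rw [hh_def, mul_assoc, mul_assoc, ← Real.exp_add, ← Real.exp_add]
          congr 2
          rw [hc]; ring
    have h5 : ‖average h R x‖ ≤ A * Real.exp |ϑ| * (c + 2) * t * Real.exp (ϑ * t) := by
      have h6 : Real.exp (ϑ * x) ≤ Real.exp |ϑ| * Real.exp (ϑ * t) := by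
        rw [← Real.exp_add]
        apply Real.exp_le_exp.2
        have h7 : ϑ * (x - t) ≤ |ϑ| * 1 := by
          calc ϑ * (x - t) ≤ |ϑ * (x - t)| := le_abs_self _
            _ = |ϑ| * |x - t| := abs_mul _ _
            _ ≤ _ := by
              gcongr
              rw [abs_le]; constructor <;> linarith
        linarith
      calc ‖average h R x‖ ≤ A * Real.exp (ϑ * x) * (Real.log (1 + h⁻¹) + 1) := hA h hh hh1 x
        _ ≤ A * (Real.exp |ϑ| * Real.exp (ϑ * t)) * ((c + 2) * t) := by gcongr
        _ = _ := by ring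
    calc _ = ‖average h R x + (average h m x - m t)‖ := by rw [h1]; congr 1; ring
      _ ≤ _ := norm_add_le _ _
      _ ≤ A * Real.exp |ϑ| * (c + 2) * t * Real.exp (ϑ * t) + K * Real.exp s * Real.exp (ϑ * t) :=
          add_le_add h5 h2
      _ ≤ A * Real.exp |ϑ| * (c + 2) * t * Real.exp (ϑ * t)
          + K * Real.exp s * t * Real.exp (ϑ * t) := by
          have h7 : K * Real.exp s ≤ K * Real.exp s * t :=
            le_mul_of_one_le_right (by positivity) ht
          exact add_le_add le_rfl (mul_le_mul_of_nonneg_right h7 (Real.exp_nonneg _))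
      _ = _ := by ring
  obtain ⟨a, ha, -, ha2⟩ := average_bounds hu hh (t - h)
  obtain ⟨b, hb, hb1, -⟩ := average_bounds hu hh t
  have ka := key (t - h) le_rfl (by linarith)
  have kb := key t (by linarith) le_rfl
  rw [ha] at ka
  rw [hb] at kb
  rw [sub_add_cancel] at ha2
  -- From `a ≤ u t ≤ b` the error is at most `‖b - m t‖ + 2 ‖a - m t‖`, hence the factor `3` in the
  -- constant.
  have h8 : ‖(u t : ℂ) - a‖ ≤ ‖(b : ℂ) - a‖ := by
    rw [← Complex.ofReal_sub, ← Complex.ofReal_sub, Complex.norm_real, Complex.norm_real,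
      Real.norm_of_nonneg (by linarith), Real.norm_of_nonneg (by linarith)]
    linarith
  have h9 : ‖(b : ℂ) - a‖ ≤ ‖(b : ℂ) - m t‖ + ‖(a : ℂ) - m t‖ := by
    rw [show (b : ℂ) - a = (b - m t) - (a - m t) by ring]
    exact norm_sub_le _ _
  have h10 : ‖(u t : ℂ) - m t‖ ≤ ‖(u t : ℂ) - a‖ + ‖(a : ℂ) - m t‖ := by
    rw [show (u t : ℂ) - m t = (u t - a) + (a - m t) by ring]
    exact norm_add_le _ _
  linarith

end MarkovRenewal

/-! ### Spectral radius and powers of matrices. -/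

namespace MarkovRenewal

section SpectralRadius

variable {p : ℕ}

/-- Gelfand's formula in the row-sum norm, stated through entries so that the choice of norm stays
local. -/
theorem eventually_sum_norm_pow_le {A : Matrix (Fin p) (Fin p) ℂ} (hA : spectralRadius ℂ A < 1) :
    ∃ r : ℝ, 0 ≤ r ∧ r < 1 ∧ ∀ᶠ n in atTop, ∀ i, ∑ j, ‖(A ^ n) i j‖ ≤ r ^ n := by
  let _ : NormedRing (Matrix (Fin p) (Fin p) ℂ) := Matrix.linftyOpNormedRing
  let _ : NormedAlgebra ℂ (Matrix (Fin p) (Fin p) ℂ) := Matrix.linftyOpNormedAlgebra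
  have : CompleteSpace (Matrix (Fin p) (Fin p) ℂ) := FiniteDimensional.complete ℂ _
  obtain ⟨r, hr1, hr2⟩ := ENNReal.lt_iff_exists_nnreal_btwn.1 hA
  have hr2' : (r : ℝ) < 1 := by exact_mod_cast hr2
  refine ⟨r, r.2, hr2', ?_⟩
  have h := spectrum.pow_nnnorm_pow_one_div_tendsto_nhds_spectralRadius A
  filter_upwards [h.eventually (gt_mem_nhds hr1), eventually_gt_atTop 0] with n hn hn0 i
  have hn0' : (n : ℝ) ≠ 0 := by exact_mod_cast hn0.ne'
  have h1 : (‖A ^ n‖₊ : ℝ≥0∞) ≤ (r : ℝ≥0∞) ^ n := by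
    have h2 := ENNReal.rpow_le_rpow hn.le (Nat.cast_nonneg n)
    rwa [← ENNReal.rpow_mul, one_div, inv_mul_cancel₀ hn0', ENNReal.rpow_one,
      ENNReal.rpow_natCast] at h2
  have h3 : ‖A ^ n‖₊ ≤ r ^ n := by exact_mod_cast h1
  have h4 : ∑ j, ‖(A ^ n) i j‖₊ ≤ ‖A ^ n‖₊ := by
    rw [Matrix.linfty_opNNNorm_def]
    exact Finset.le_sup (f := fun i => ∑ j, ‖(A ^ n) i j‖₊) (Finset.mem_univ i)
  have h5 := NNReal.coe_le_coe.2 (h4.trans h3)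
  rw [NNReal.coe_sum, NNReal.coe_pow] at h5
  exact h5

/-- The spectral radius is at most the root of the norm of any power, up to a power of the norm of
the identity; a nonempty index set makes that norm `1`. -/
theorem spectralRadius_lt_one_of_sum_norm_pow_lt [NeZero p] {A : Matrix (Fin p) (Fin p) ℂ} {n : ℕ}
    (h : ∀ i, ∑ j, ‖(A ^ (n + 1)) i j‖ < 1) : spectralRadius ℂ A < 1 := by
  let _ : NormedRing (Matrix (Fin p) (Fin p) ℂ) := Matrix.linftyOpNormedRing
  let _ : NormedAlgebra ℂ (Matrix (Fin p) (Fin p) ℂ) := Matrix.linftyOpNormedAlgebra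
  have : CompleteSpace (Matrix (Fin p) (Fin p) ℂ) := FiniteDimensional.complete ℂ _
  have h1 : ‖A ^ (n + 1)‖₊ < 1 := by
    rw [Matrix.linfty_opNNNorm_def, Finset.sup_lt_iff (by simp)]
    intro i _
    have h0 := h i
    rw [← NNReal.coe_lt_coe, NNReal.coe_sum]
    exact h0
  have h2 : ‖(1 : Matrix (Fin p) (Fin p) ℂ)‖₊ = 1 := by
    rw [Matrix.linfty_opNNNorm_def]
    apply le_antisymm
    · refine Finset.sup_le fun i _ => ?_
      rw [Finset.sum_eq_single i] <;> simp +contextual [eq_comm]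
    · have := Finset.le_sup (f := fun i => ∑ j, ‖(1 : Matrix (Fin p) (Fin p) ℂ) i j‖₊)
        (Finset.mem_univ (0 : Fin p))
      refine le_trans ?_ this
      refine le_trans ?_ (Finset.single_le_sum (fun j _ => bot_le) (Finset.mem_univ (0 : Fin p)))
      simp
  have h3 := spectrum.spectralRadius_le_pow_nnnorm_pow_one_div ℂ A n
  rw [h2] at h3
  refine h3.trans_lt ?_
  rw [ENNReal.coe_one, ENNReal.one_rpow, mul_one]
  exact ENNReal.rpow_lt_one (by exact_mod_cast h1) (by positivity)

end SpectralRadius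

variable {p : ℕ}

/-! ### The Markov renewal measure and its real Laplace transform. -/

section Measures

instance sFinite_finsetSum {ι : Type*} (s : Finset ι) (m : ι → Measure ℝ) [∀ i, SFinite (m i)] :
    SFinite (∑ i ∈ s, m i) := by
  classical
  induction s using Finset.induction_on with
  | empty => simp only [Finset.sum_empty]; infer_instance
  | insert a s ha ih => rw [Finset.sum_insert ha]; infer_instance

instance sFinite_convPow (μ : Fin p → Fin p → Measure ℝ) [∀ i j, SFinite (μ i j)] (n : ℕ)
    (i j : Fin p) : SFinite (convPow μ n i j) := by
  induction n generalizing i j with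
  | zero =>
    by_cases h : i = j <;> simp only [convPow, h, if_true, if_false] <;> infer_instance
  | succ n ih =>
    rw [convPow]
    infer_instance

instance sFinite_renewalMeasure (μ : Fin p → Fin p → Measure ℝ) [∀ i j, SFinite (μ i j)]
    (i j : Fin p) : SFinite (renewalMeasure μ i j) := by
  rw [renewalMeasure]
  infer_instance

/-- The renewal equation for the Markov renewal measure. -/
theorem renewalMeasure_eq (μ : Fin p → Fin p → Measure ℝ) [∀ i j, SFinite (μ i j)] (i j : Fin p) :
    renewalMeasure μ i j = (if i = j then Measure.dirac 0 else 0) +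
      ∑ k, (μ i k).conv (renewalMeasure μ k j) := by
  refine Measure.ext_of_lintegral _ fun f hf => ?_
  rw [lintegral_add_measure, lintegral_finsetSum_measure, renewalMeasure, lintegral_sum_measure,
    tsum_eq_zero_add' ENNReal.summable]
  congr 1
  have h1 : ∀ k, ∫⁻ x, f x ∂((μ i k).conv (renewalMeasure μ k j))
      = ∑' n, ∫⁻ x, f x ∂((μ i k).conv (convPow μ n k j)) := by
    intro k
    rw [Measure.lintegral_conv hf]
    simp only [Measure.lintegral_conv hf, renewalMeasure, lintegral_sum_measure]
    rw [lintegral_tsum]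
    intro n
    exact (Measurable.lintegral_prod_right' (f := fun q : ℝ × ℝ => f (q.1 + q.2))
      (by fun_prop)).aemeasurable
  simp only [h1]
  rw [← Summable.tsum_finsetSum fun k _ => ENNReal.summable]
  refine tsum_congr fun n => ?_
  rw [convPow, lintegral_finsetSum_measure]

/-- The real Laplace transform with values in `[0, ∞]`. -/
noncomputable def laplaceENN (μ : Fin p → Fin p → Measure ℝ) (s : ℝ) :
    Matrix (Fin p) (Fin p) ℝ≥0∞ :=
  Matrix.of fun i j => ∫⁻ x, ENNReal.ofReal (Real.exp (-s * x)) ∂(μ i j)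

/-- With values in `[0, ∞]`, convolution turns into matrix multiplication with no integrability
condition. -/
theorem laplaceENN_convPow (μ : Fin p → Fin p → Measure ℝ) [∀ i j, SFinite (μ i j)] (s : ℝ)
    (n : ℕ) : laplaceENN (convPow μ n) s = laplaceENN μ s ^ n := by
  induction n with
  | zero =>
    ext i j
    by_cases h : i = j
    · simp [laplaceENN, convPow, h]
    · simp [laplaceENN, convPow, h]
  | succ n ih =>
    rw [pow_succ', ← ih]
    ext i j
    simp only [laplaceENN, Matrix.mul_apply, Matrix.of_apply, convPow]
    rw [lintegral_finsetSum_measure]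
    refine Finset.sum_congr rfl fun k _ => ?_
    rw [Measure.lintegral_conv (by fun_prop), ← lintegral_mul_const _ (by fun_prop)]
    refine lintegral_congr fun x => ?_
    rw [← lintegral_const_mul _ (by fun_prop)]
    refine lintegral_congr fun y => ?_
    rw [← ENNReal.ofReal_mul (Real.exp_nonneg _), ← Real.exp_add, mul_add]

theorem laplaceENN_renewalMeasure (μ : Fin p → Fin p → Measure ℝ) [∀ i j, SFinite (μ i j)] (s : ℝ)
    (i j : Fin p) : laplaceENN (renewalMeasure μ) s i j = ∑' n, (laplaceENN μ s ^ n) i j := by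
  simp only [← laplaceENN_convPow]
  simp only [laplaceENN, Matrix.of_apply, renewalMeasure, lintegral_sum_measure]

theorem laplaceENN_lt_top_iff (μ : Fin p → Fin p → Measure ℝ) (s : ℝ) (i j : Fin p) :
    laplaceENN μ s i j < ∞ ↔ Integrable (fun x : ℝ => Real.exp (-s * x)) (μ i j) := by
  have hm : Measurable fun x : ℝ => Real.exp (-s * x) := by fun_prop
  have h0 := hasFiniteIntegral_iff_ofReal (μ := μ i j) (f := fun x : ℝ => Real.exp (-s * x))
    (Eventually.of_forall fun x => Real.exp_nonneg _)
  change ∫⁻ x, ENNReal.ofReal (Real.exp (-s * x)) ∂(μ i j) < ∞ ↔ _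
  rw [← h0]
  exact ⟨fun h => ⟨hm.aestronglyMeasurable, h⟩, fun h => h.2⟩

/-- The transform of the renewal measure is the Neumann series of `ℒμ(s)`, which converges
geometrically. All entries are nonnegative, so summability in `ℂ` is the same as finiteness in `[0,
∞]`. -/
theorem laplaceDomain_renewalMeasure (μ : Fin p → Fin p → Measure ℝ)
    [∀ i j, SFinite (μ i j)] {s : ℝ} (hs : (s : ℂ) ∈ laplaceDomain μ)
    (hr : spectralRadius ℂ (laplace μ s) < 1) : (s : ℂ) ∈ laplaceDomain (renewalMeasure μ) := by
  intro i j
  have hs' : ∀ i j, Integrable (fun x : ℝ => Real.exp (-s * x)) (μ i j) := by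
    intro i j
    simpa using hs i j
  rw [Complex.ofReal_re, ← laplaceENN_lt_top_iff, laplaceENN_renewalMeasure]
  -- Both the `ℝ≥0∞`-valued and the complex transform are images of `A` under ring homomorphisms,
  -- which commute with powers.
  set A : Matrix (Fin p) (Fin p) NNReal :=
    Matrix.of fun i j => (laplaceENN μ s i j).toNNReal with hA
  have h1 : laplaceENN μ s = ENNReal.ofNNRealHom.mapMatrix A := by
    ext i j
    exact (ENNReal.coe_toNNReal ((laplaceENN_lt_top_iff μ s i j).2 (hs' i j)).ne).symm
  have h2 : laplace μ s = (algebraMap NNReal ℂ).mapMatrix A := by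
    ext i j
    simp only [hA, RingHom.mapMatrix_apply, Matrix.map_apply, Matrix.of_apply, laplace, laplaceENN]
    have h3 : ∀ x : ℝ, Complex.exp (-(s : ℂ) * x) = ((Real.exp (-s * x) : ℝ) : ℂ) := by
      intro x; push_cast; rfl
    simp only [h3]
    rw [integral_complex_ofReal, integral_eq_lintegral_of_nonneg_ae
      (Eventually.of_forall fun x => Real.exp_nonneg _)
      (by fun_prop)]
    rfl
  obtain ⟨r, hr0, hr1, hev⟩ := eventually_sum_norm_pow_le hr
  have h4 : ∀ n, (laplaceENN μ s ^ n) i j = ((A ^ n) i j : NNReal) := by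
    intro n
    rw [h1, ← map_pow]
    rfl
  have h5 : ∀ n, ‖(laplace μ s ^ n) i j‖ = ((A ^ n) i j : NNReal) := by
    intro n
    rw [h2, ← map_pow]
    simp [RingHom.mapMatrix_apply]
  have h6 : Summable fun n => (((A ^ n) i j : NNReal) : ℝ) := by
    refine Summable.of_norm_bounded_eventually_nat (summable_geometric_of_lt_one hr0 hr1) ?_
    filter_upwards [hev] with n hn
    rw [Real.norm_of_nonneg (NNReal.coe_nonneg _), ← h5]
    exact (Finset.single_le_sum (f := fun j => ‖(laplace μ s ^ n) i j‖)
      (fun j _ => norm_nonneg _) (Finset.mem_univ j)).trans (hn i)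
  simp only [h4]
  exact (ENNReal.tsum_coe_ne_top_iff_summable.2 (NNReal.summable_coe.1 h6)).lt_top

end Measures

end MarkovRenewal

/-! ### Analytic properties of the Laplace transform. -/

namespace MarkovRenewal

variable {p : ℕ} {μ : Fin p → Fin p → Measure ℝ}

theorem norm_exp_neg_mul (z : ℂ) (x : ℝ) :
    ‖Complex.exp (-z * x)‖ = Real.exp (-z.re * x) := by
  rw [Complex.norm_exp]
  simp

theorem ae_nonneg_of_measure_Iio {ν : Measure ℝ} (h : ν (Iio 0) = 0) : ∀ᵐ x ∂ν, 0 ≤ x := by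
  rw [ae_iff]
  convert h using 2
  ext x
  simp

theorem laplaceDomain_mono (hμ : ∀ i j, μ i j (Iio 0) = 0) {w z : ℂ} (hw : w ∈ laplaceDomain μ)
    (h : w.re ≤ z.re) : z ∈ laplaceDomain μ := by
  intro i j
  refine (hw i j).mono' (by fun_prop) ?_
  filter_upwards [ae_nonneg_of_measure_Iio (hμ i j)] with x hx
  rw [Real.norm_of_nonneg (Real.exp_nonneg _)]
  apply Real.exp_le_exp.2
  nlinarith

theorem integrable_cexp {z : ℂ} (hz : z ∈ laplaceDomain μ) (i j : Fin p) :
    Integrable (fun x : ℝ => Complex.exp (-z * x)) (μ i j) :=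
  (hz i j).mono' (by fun_prop) (Eventually.of_forall fun x => (norm_exp_neg_mul z x).le)

theorem exists_mem_laplaceDomain_of_interior {ϑ : ℝ} (hϑ : (ϑ : ℂ) ∈ interior (laplaceDomain μ)) :
    ∃ δ : ℝ, 0 < δ ∧ ((ϑ - δ : ℝ) : ℂ) ∈ laplaceDomain μ := by
  obtain ⟨r, hr, h⟩ := Metric.isOpen_iff.1 isOpen_interior _ hϑ
  refine ⟨r / 2, by positivity, interior_subset (h ?_)⟩
  rw [mem_ball_iff_norm, ← Complex.ofReal_sub, Complex.norm_real, Real.norm_eq_abs,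
    sub_sub_cancel_left, abs_neg, abs_of_pos (by positivity)]
  linarith

theorem norm_laplace_le (hμ : ∀ i j, μ i j (Iio 0) = 0) {w z : ℂ} (hw : w ∈ laplaceDomain μ)
    (h : w.re ≤ z.re) (i j : Fin p) :
    ‖laplace μ z i j‖ ≤ ∫ x, Real.exp (-w.re * x) ∂(μ i j) := by
  refine norm_integral_le_of_norm_le (hw i j) ?_
  filter_upwards [ae_nonneg_of_measure_Iio (hμ i j)] with x hx
  rw [norm_exp_neg_mul]
  apply Real.exp_le_exp.2
  nlinarith

/-- The transform is the complex moment generating function of `x ↦ -x`, holomorphic over the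
interior of its set of exponents; a point of the domain strictly to the left puts `z` there. -/
theorem differentiableAt_laplace (hμ : ∀ i j, μ i j (Iio 0) = 0) {w z : ℂ}
    (hw : w ∈ laplaceDomain μ) (h : w.re < z.re) (i j : Fin p) :
    DifferentiableAt ℂ (fun z => laplace μ z i j) z := by
  have h1 : z.re ∈ interior (ProbabilityTheory.integrableExpSet (fun x : ℝ => -x) (μ i j)) := by
    rw [mem_interior]
    refine ⟨Ioi w.re, fun s hs => ?_, isOpen_Ioi, h⟩
    have h2 := laplaceDomain_mono hμ hw (z := s) (le_of_lt hs) i j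
    change Integrable (fun x : ℝ => Real.exp (s * -x)) (μ i j)
    simpa using h2
  have h3 := (ProbabilityTheory.differentiableOn_complexMGF (X := fun x : ℝ => -x)
    (μ := μ i j)).differentiableAt ((isOpen_interior.preimage Complex.continuous_re).mem_nhds h1)
  convert h3 using 1
  funext z
  simp only [laplace, Matrix.of_apply, ProbabilityTheory.complexMGF]
  congr 1
  funext x
  push_cast
  congr 1
  ring

/-- Dominated convergence: on `[0, ∞)` the weights `e^{-sx}` decrease to the indicator of `{0}`. -/
theorem tendsto_laplace_atTop (hμ : ∀ i j, μ i j (Iio 0) = 0) {w : ℂ} (hw : w ∈ laplaceDomain μ)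
    (i j : Fin p) :
    Tendsto (fun s : ℝ => laplace μ s i j) atTop (𝓝 (massAtZero μ i j)) := by
  have h0 : massAtZero μ i j = ∫ x : ℝ, ({0} : Set ℝ).indicator (fun _ => (1 : ℂ)) x ∂(μ i j) := by
    rw [integral_indicator (measurableSet_singleton 0)]
    simp [massAtZero, Measure.real]
  rw [h0]
  refine tendsto_integral_filter_of_dominated_convergence (fun x => Real.exp (-w.re * x))
    (Eventually.of_forall fun s => by fun_prop) ?_ (hw i j) ?_
  · filter_upwards [eventually_ge_atTop w.re] with s hs
    filter_upwards [ae_nonneg_of_measure_Iio (hμ i j)] with x hx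
    rw [norm_exp_neg_mul, Complex.ofReal_re]
    apply Real.exp_le_exp.2
    nlinarith
  · filter_upwards [ae_nonneg_of_measure_Iio (hμ i j)] with x hx
    rcases hx.eq_or_lt with rfl | hx
    · simp
    · have h1 : Tendsto (fun s : ℝ => Real.exp (-(s * x))) atTop (𝓝 0) :=
        Real.tendsto_exp_neg_atTop_nhds_zero.comp (tendsto_id.atTop_mul_const hx)
      have h2 := (Complex.continuous_ofReal.tendsto 0).comp h1
      have h3 : ({0} : Set ℝ).indicator (fun _ => (1 : ℂ)) x = 0 := by simp [hx.ne']
      rw [h3]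
      rw [Complex.ofReal_zero] at h2
      convert h2 using 2 with s
      simp

/-- Some power of the limit matrix has all row sums below `1`. This is an open condition, so the
same power of `ℒμ(s)` satisfies it for large `s`. -/
theorem eventually_spectralRadius_laplace_lt_one [NeZero p] (hμ : ∀ i j, μ i j (Iio 0) = 0) {w : ℂ}
    (hw : w ∈ laplaceDomain μ) (h0 : spectralRadius ℂ (massAtZero μ) < 1) :
    ∀ᶠ s : ℝ in atTop, spectralRadius ℂ (laplace μ s) < 1 := by
  obtain ⟨r, hr0, hr1, hev⟩ := eventually_sum_norm_pow_le h0
  obtain ⟨n, hn, hn0⟩ := (hev.and (eventually_gt_atTop 0)).exists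
  obtain ⟨n, rfl⟩ := Nat.exists_eq_succ_of_ne_zero hn0.ne'
  have h1 : Tendsto (fun s : ℝ => laplace μ s) atTop (𝓝 (massAtZero μ)) := by
    exact tendsto_pi_nhds.2 fun i => tendsto_pi_nhds.2 fun j => tendsto_laplace_atTop hμ hw i j
  have h2 : Tendsto (fun s : ℝ => laplace μ s ^ (n + 1)) atTop (𝓝 (massAtZero μ ^ (n + 1))) :=
    h1.pow _
  have h3 : ∀ i, ∀ᶠ s : ℝ in atTop, ∑ j, ‖(laplace μ s ^ (n + 1)) i j‖ < 1 := by
    intro i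
    have h4 : Tendsto (fun s : ℝ => ∑ j, ‖(laplace μ s ^ (n + 1)) i j‖) atTop
        (𝓝 (∑ j, ‖(massAtZero μ ^ (n + 1)) i j‖)) := by
      refine tendsto_finsetSum _ fun j _ => ?_
      have := (tendsto_pi_nhds.1 (tendsto_pi_nhds.1 h2 i) j)
      exact this.norm
    refine h4.eventually (gt_mem_nhds ((hn i).trans_lt ?_))
    exact pow_lt_one₀ hr0 hr1 (by simp)
  filter_upwards [eventually_all.2 h3] with s hs
  exact spectralRadius_lt_one_of_sum_norm_pow_lt hs

theorem renewalMeasure_Iio [∀ i j, SFinite (μ i j)] (hμ : ∀ i j, μ i j (Iio 0) = 0) (i j : Fin p) :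
    renewalMeasure μ i j (Iio 0) = 0 := by
  rw [renewalMeasure, Measure.sum_apply _ measurableSet_Iio, ENNReal.tsum_eq_zero]
  intro n
  induction n generalizing i j with
  | zero => by_cases h : i = j <;> simp [convPow, h]
  | succ n ih =>
    simp only [convPow]
    rw [Measure.finsetSum_apply]
    refine Finset.sum_eq_zero fun k _ => ?_
    rw [Measure.conv, Measure.map_apply measurable_add measurableSet_Iio]
    have h1 : ∀ᵐ q ∂((μ i k).prod (convPow μ n k j)), 0 ≤ q.1 ∧ 0 ≤ q.2 :=
      (Measure.quasiMeasurePreserving_fst.ae (ae_nonneg_of_measure_Iio (hμ i k))).and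
        (Measure.quasiMeasurePreserving_snd.ae (ae_nonneg_of_measure_Iio (ih k j)))
    refine measure_mono_null ?_ (ae_iff.1 h1)
    intro q hq
    have hq' : q.1 + q.2 < 0 := hq
    intro h
    have h' : 0 ≤ q.1 ∧ 0 ≤ q.2 := h
    linarith [h'.1, h'.2]

theorem measure_Icc_lt_top {ν : Measure ℝ} {s : ℝ}
    (h : Integrable (fun x : ℝ => Real.exp (-s * x)) ν) (a b : ℝ) : ν (Icc a b) < ∞ := by
  have h1 : Integrable (fun x : ℝ => Real.exp (-s * x)) (ν.restrict (Icc a b)) := h.restrict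
  obtain ⟨c, hc, hle⟩ : ∃ c : ℝ, 0 < c ∧ ∀ x ∈ Icc a b, c ≤ Real.exp (-s * x) := by
    refine ⟨Real.exp (-(|s| * (|a| + |b|))), Real.exp_pos _, fun x hx => Real.exp_le_exp.2 ?_⟩
    have h2 : |x| ≤ |a| + |b| := by
      rw [abs_le]
      constructor <;> linarith [hx.1, hx.2, neg_abs_le a, le_abs_self b, abs_nonneg a, abs_nonneg b]
    have h3 : s * x ≤ |s| * (|a| + |b|) :=
      (le_abs_self _).trans (by rw [abs_mul]; gcongr)
    linarith
  have h2 : IntegrableOn (fun _ : ℝ => c) (Icc a b) ν := by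
    refine Integrable.mono' h1 aestronglyMeasurable_const ?_
    filter_upwards [ae_restrict_mem measurableSet_Icc] with x hx
    rw [Real.norm_of_nonneg hc.le]
    exact hle x hx
  have h3 := (integrableOn_const_iff (by simp)).1 h2
  simpa [hc.ne'] using h3

/-- The transform of `renewalMeasure_eq` reads `ℒU = 1 + ℒμ · ℒU`. Integrability against `U` passes
to each summand of its decomposition because measures are nonnegative. -/
theorem one_sub_laplace_mul_laplace_renewalMeasure [∀ i j, SFinite (μ i j)]
    {z : ℂ} (hU : z ∈ laplaceDomain (renewalMeasure μ)) :
    (1 - laplace μ z) * laplace (renewalMeasure μ) z = 1 := by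
  have key : laplace (renewalMeasure μ) z = 1 + laplace μ z * laplace (renewalMeasure μ) z := by
    ext i j
    have hint := integrable_cexp hU i j
    rw [Matrix.add_apply, Matrix.mul_apply]
    conv_lhs => rw [laplace, Matrix.of_apply, renewalMeasure_eq]
    rw [renewalMeasure_eq, integrable_add_measure, integrable_finsetSum_measure] at hint
    rw [integral_add_measure hint.1 (integrable_finsetSum_measure.2 hint.2),
      integral_finsetSum_measure (fun k hk => hint.2 k hk)]
    congr 1
    · rw [Matrix.one_apply]
      by_cases h : i = j
      · simp [h]
      · simp [h]
    · refine Finset.sum_congr rfl fun k hk => ?_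
      rw [integral_conv (hint.2 k hk)]
      simp only [laplace, Matrix.of_apply]
      rw [← integral_mul_const]
      congr 1
      funext x
      rw [← integral_const_mul]
      congr 1
      funext y
      rw [← Complex.exp_add]
      push_cast
      ring_nf
  rw [sub_mul, one_mul]
  nth_rewrite 1 [key]
  rw [add_sub_cancel_right]

/-! ### Entrywise bounds for determinants, adjugates and inverses. -/

section Matrix

/-- An entry of the adjugate is the determinant of the matrix with one row replaced by a unit
vector, hence `max B 1`. -/
theorem norm_adjugate_le {A : Matrix (Fin p) (Fin p) ℂ} {B : ℝ} (hB : ∀ i j, ‖A i j‖ ≤ B)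
    (i j : Fin p) : ‖A.adjugate i j‖ ≤ p.factorial * (max B 1) ^ p := by
  rw [Matrix.adjugate_apply]
  have h1 := Matrix.det_le (A := A.updateRow j (Pi.single i 1)) (abv := NormedField.toAbsoluteValue ℂ)
    (x := max B 1) (by
      intro k l
      change ‖A.updateRow j (Pi.single i 1) k l‖ ≤ _
      rw [Matrix.updateRow_apply]
      split_ifs
      · rw [Pi.single_apply]
        split_ifs <;> simp
      · exact (hB k l).trans (le_max_left _ _))
  rw [nsmul_eq_mul, Fintype.card_fin] at h1
  exact h1

theorem norm_det_le {A : Matrix (Fin p) (Fin p) ℂ} {B : ℝ} (hB : ∀ i j, ‖A i j‖ ≤ B) :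
    ‖A.det‖ ≤ p.factorial * B ^ p := by
  have h1 := Matrix.det_le (A := A) (abv := NormedField.toAbsoluteValue ℂ) (x := B) hB
  rw [nsmul_eq_mul, Fintype.card_fin] at h1
  exact h1

theorem inv_apply_eq_adjugate_div (A : Matrix (Fin p) (Fin p) ℂ) (i j : Fin p) :
    A⁻¹ i j = A.adjugate i j / A.det := by
  rw [Matrix.inv_def, Matrix.smul_apply, smul_eq_mul, Ring.inverse_eq_inv', div_eq_inv_mul]

/-- A lower bound for the determinant in terms of an upper bound for the inverse. -/
theorem inv_le_norm_det {A : Matrix (Fin p) (Fin p) ℂ} (h : A.det ≠ 0) {B : ℝ}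
    (hB : ∀ i j, ‖A⁻¹ i j‖ ≤ B) : (p.factorial * (max B 1) ^ p)⁻¹ ≤ ‖A.det‖ := by
  -- A lower bound for `det A` is an upper bound for `det A⁻¹`, which the Leibniz formula supplies.
  have h1 : A.det * A⁻¹.det = 1 := by
    rw [← Matrix.det_mul, Matrix.mul_nonsing_inv _ (isUnit_iff_ne_zero.2 h), Matrix.det_one]
  have h2 := norm_det_le (fun i j => (hB i j).trans (le_max_left B 1))
  have h3 : ‖A.det‖ * ‖A⁻¹.det‖ = 1 := by rw [← norm_mul, h1, norm_one]
  have h4 : 0 < ‖A.det‖ := norm_pos_iff.2 h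
  have h5 : 0 < max B 1 := lt_max_of_lt_right one_pos
  rw [inv_le_iff_one_le_mul₀ (by positivity)]
  exact h3.symm.le.trans (mul_le_mul_of_nonneg_left h2 h4.le)

end Matrix

end MarkovRenewal

/-! ### Lower bounds for zero-free holomorphic functions. -/

namespace MarkovRenewal

/-- A zero-free holomorphic function on a disc has a holomorphic logarithm with prescribed value at
the centre. -/
theorem exists_log_on_ball {D : ℂ → ℂ} {w : ℂ} {R : ℝ} (hR : 0 < R)
    (hD : DifferentiableOn ℂ D (Metric.ball w R)) (h0 : ∀ z ∈ Metric.ball w R, D z ≠ 0) :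
    ∃ f : ℂ → ℂ, DifferentiableOn ℂ f (Metric.ball w R) ∧ f w = Complex.log (D w) ∧
      ∀ z ∈ Metric.ball w R, Complex.exp (f z) = D z := by
  have hw : w ∈ Metric.ball w R := Metric.mem_ball_self hR
  have hD' : DifferentiableOn ℂ (deriv D) (Metric.ball w R) := hD.deriv Metric.isOpen_ball
  -- A primitive of the logarithmic derivative exists on a disc; after normalisation at the centre,
  -- `D · exp (-f)` has derivative `0` and equals `1`.
  obtain ⟨g, hg⟩ := (hD'.div hD h0).isExactOn_ball
  set f : ℂ → ℂ := fun z => g z - g w + Complex.log (D w) with hf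
  have hfd : ∀ z ∈ Metric.ball w R, HasDerivAt f (deriv D z / D z) z := by
    intro z hz
    exact ((hg z hz).sub_const _).add_const _
  have hfw : f w = Complex.log (D w) := by simp [hf]
  refine ⟨f, fun z hz => (hfd z hz).differentiableAt.differentiableWithinAt, hfw, ?_⟩
  set q : ℂ → ℂ := fun z => D z * Complex.exp (-f z) with hq
  have hqd : ∀ z ∈ Metric.ball w R, HasDerivAt q 0 z := by
    intro z hz
    have h1 := ((hD.differentiableAt (Metric.isOpen_ball.mem_nhds hz)).hasDerivAt).mul
      ((hfd z hz).neg.cexp)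
    refine h1.congr_deriv ?_
    have := h0 z hz
    field_simp
    simp
  intro z hz
  have hconst := (convex_ball w R).is_const_of_fderivWithin_eq_zero (𝕜 := ℂ) (f := q)
    (fun x hx => (hqd x hx).differentiableAt.differentiableWithinAt) (fun x hx => by
      rw [fderivWithin_of_isOpen Metric.isOpen_ball hx, (hqd x hx).hasFDerivAt.fderiv]
      ext
      simp) hz hw
  have h2 : q w = 1 := by
    simp only [hq, hfw]
    rw [Complex.exp_neg, Complex.exp_log (h0 w hw), mul_inv_cancel₀ (h0 w hw)]
  rw [h2] at hconst
  simp only [hq] at hconst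
  rw [Complex.exp_neg] at hconst
  have := Complex.exp_ne_zero (f z)
  field_simp at hconst
  exact hconst.symm

/-- A bounded zero-free holomorphic function on a disc of radius `R` is bounded below on smaller
discs, in terms of its value at the centre. -/
theorem exists_norm_ge_of_zero_free {R ε B c : ℝ} (hε : 0 < ε) (hεR : ε ≤ R) (hc : 0 < c) :
    ∃ c', 0 < c' ∧ ∀ (D : ℂ → ℂ) (w : ℂ), DifferentiableOn ℂ D (Metric.ball w R) →
      (∀ z ∈ Metric.ball w R, D z ≠ 0) → (∀ z ∈ Metric.ball w R, ‖D z‖ ≤ B) → c ≤ ‖D w‖ →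
      ∀ z, ‖z - w‖ ≤ R - ε → c' ≤ ‖D z‖ := by
  have hR : 0 < R := hε.trans_le hεR
  -- `M` is a positive upper bound for `Re f = log ‖D‖`, and `A` bounds `‖f w‖`, the `π` accounting
  -- for the argument. In the Borel–Carathéodory inequality `R - ‖z - w‖ ≥ ε` goes into the
  -- denominator.
  set M := max 1 (Real.log B) with hM
  have hM0 : 0 < M := lt_max_of_lt_left one_pos
  set A := |Real.log c| + |Real.log B| + Real.pi with hA
  refine ⟨Real.exp (-((2 * M * R + A * (2 * R)) / ε)), Real.exp_pos _, ?_⟩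
  intro D w hD h0 hB hcw z hz
  have hw : w ∈ Metric.ball w R := Metric.mem_ball_self hR
  obtain ⟨f, hf, hfw, hfe⟩ := exists_log_on_ball hR hD h0
  have hadd : ∀ ζ ∈ Metric.ball (0 : ℂ) R, w + ζ ∈ Metric.ball w R := by
    intro ζ hζ
    simpa using hζ
  have hre : ∀ y ∈ Metric.ball w R, (f y).re = Real.log ‖D y‖ := by
    intro y hy
    rw [← hfe y hy, Complex.norm_exp, Real.log_exp]
  have hA' : ‖f (w + 0)‖ ≤ A := by
    rw [add_zero, hfw]
    refine (Complex.norm_le_abs_re_add_abs_im _).trans ?_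
    rw [Complex.log_re, Complex.log_im]
    have h1 := Complex.abs_arg_le_pi (D w)
    have h2 := Real.log_le_log hc hcw
    have h3 := Real.log_le_log (hc.trans_le hcw) (hB w hw)
    have h4 : |Real.log ‖D w‖| ≤ |Real.log c| + |Real.log B| := by
      rw [abs_le]
      constructor <;> linarith [neg_abs_le (Real.log c), le_abs_self (Real.log B),
        abs_nonneg (Real.log c), abs_nonneg (Real.log B)]
    linarith
  have hzR : z - w ∈ Metric.ball (0 : ℂ) R := by
    rw [mem_ball_zero_iff]
    linarith
  have hbc := Complex.borelCaratheodory (f := fun ζ => f (w + ζ)) hM0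
    (hf.comp (by fun_prop) hadd) (fun ζ hζ => by
      change (f (w + ζ)).re ≤ M
      have hy := hadd ζ hζ
      rw [hre _ hy]
      exact (Real.log_le_log (norm_pos_iff.2 (h0 _ hy)) (hB _ hy)).trans (le_max_right _ _)) hR hzR
  simp only [add_sub_cancel] at hbc
  have hzw : z ∈ Metric.ball w R := by
    have := hadd _ hzR
    rwa [add_sub_cancel] at this
  rw [← hfe z hzw, Complex.norm_exp]
  apply Real.exp_le_exp.2
  have h5 : ‖f z‖ ≤ (2 * M * R + A * (2 * R)) / ε := by
    refine hbc.trans ?_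
    rw [← add_div]
    have hn := norm_nonneg (z - w)
    gcongr <;> linarith
  have h6 := Complex.abs_re_le_norm (f z)
  linarith [neg_abs_le (f z).re]

/-- A bounded holomorphic function which is bounded below on two vertical lines and has no zeros
high up in between is bounded below there. -/
theorem exists_norm_ge_in_strip {D : ℂ → ℂ} {a b δ B c T : ℝ} (hab : a < b) (hδ : 0 < δ)
    (hc : 0 < c) (hd : ∀ z : ℂ, a - δ < z.re → DifferentiableAt ℂ D z)
    (hB : ∀ z : ℂ, a - δ < z.re → ‖D z‖ ≤ B) (ha : ∀ z : ℂ, z.re = a → c ≤ ‖D z‖)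
    (hb : ∀ z : ℂ, z.re = b → c ≤ ‖D z‖) (h0 : ∀ z : ℂ, a < z.re → T < |z.im| → D z ≠ 0) :
    ∃ c' T', 0 < c' ∧ ∀ z : ℂ, a ≤ z.re → z.re ≤ b → T' ≤ |z.im| → c' ≤ ‖D z‖ := by
  set L := B / (δ / 2) with hL
  have hB0 : 0 ≤ B := (norm_nonneg _).trans (hB a (by simpa using hδ))
  have hL0 : 0 ≤ L := by positivity
  -- Cauchy's estimate on circles of radius `δ / 2`, which stay inside the half plane `Re > a - δ`.
  have hderiv : ∀ z : ℂ, a ≤ z.re → ‖deriv D z‖ ≤ L := by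
    intro z hz
    have hsub : ∀ y ∈ Metric.closedBall z (δ / 2), a - δ < y.re := by
      intro y hy
      have h1 := (Complex.abs_re_le_norm (y - z)).trans (mem_closedBall_iff_norm.1 hy)
      rw [Complex.sub_re] at h1
      linarith [neg_abs_le (y.re - z.re)]
    refine Complex.norm_deriv_le_of_forall_mem_sphere_norm_le (by positivity)
      ⟨fun y hy => (hd y (hsub y (Metric.ball_subset_closedBall hy))).differentiableWithinAt,
        ?_⟩ fun y hy => hB y (hsub y (Metric.sphere_subset_closedBall hy))
    rw [closure_ball _ (by positivity)]
    exact fun y hy => (hd y (hsub y hy)).continuousAt.continuousWithinAt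
  -- Within `ε` of the left line, the derivative bound loses at most half of `c`. The rest is
  -- reached by discs of radius `b - a` centred on the right line, which come arbitrarily close to
  -- the left line without meeting it.
  set ε := min (b - a) (c / (2 * (L + 1))) with hε
  have hε0 : 0 < ε := lt_min (by linarith) (by positivity)
  obtain ⟨c₁, hc₁, h₁⟩ := exists_norm_ge_of_zero_free (R := b - a) (B := B) hε0 (min_le_left _ _) hc
  -- At this height, discs of radius `b - a` stay in `|Im| > T`, where there are no zeros.
  refine ⟨min (c / 2) c₁, |T| + (b - a) + 1, lt_min (by positivity) hc₁, fun z hza hzb hzT => ?_⟩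
  rcases le_total z.re (a + ε) with hz | hz
  · refine (min_le_left _ _).trans ?_
    set z' : ℂ := ⟨a, z.im⟩ with hz'
    have hconv : Convex ℝ {y : ℂ | a ≤ y.re} := convex_halfSpace_re_ge a
    have h2 := hconv.norm_image_sub_le_of_norm_deriv_le (f := D) (C := L) (x := z') (y := z)
      (fun y hy => hd y (by have : a ≤ y.re := hy
                            linarith)) (fun y hy => hderiv y hy) (show a ≤ z'.re from le_rfl) hza
    have h3 : ‖z - z'‖ ≤ ε := by
      have : z - z' = ((z.re - a : ℝ) : ℂ) := by
        apply Complex.ext <;> simp [hz']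
      rw [this, Complex.norm_real, Real.norm_of_nonneg (by linarith)]
      linarith
    have h4 : L * ‖z - z'‖ ≤ c / 2 := by
      calc L * ‖z - z'‖ ≤ (L + 1) * (c / (2 * (L + 1))) := by
            gcongr
            · linarith
            · exact h3.trans (min_le_right _ _)
        _ = c / 2 := by field_simp
    have h5 := ha z' rfl
    have h6 := norm_sub_norm_le (D z') (D z)
    rw [norm_sub_rev] at h6
    linarith
  · refine (min_le_right _ _).trans ?_
    set w : ℂ := ⟨b, z.im⟩ with hw
    have hball : ∀ y ∈ Metric.ball w (b - a), a < y.re ∧ T < |y.im| := by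
      intro y hy
      rw [mem_ball_iff_norm] at hy
      have h1 := (Complex.abs_re_le_norm (y - w)).trans_lt hy
      have h2 := (Complex.abs_im_le_norm (y - w)).trans_lt hy
      rw [Complex.sub_re] at h1
      rw [Complex.sub_im] at h2
      have h3 : w.re = b := rfl
      have h4 : w.im = z.im := rfl
      rw [h3] at h1
      rw [h4] at h2
      refine ⟨by linarith [neg_abs_le (y.re - b)], ?_⟩
      have h5 := abs_sub_abs_le_abs_sub z.im y.im
      rw [abs_sub_comm] at h5
      linarith [le_abs_self T]
    refine h₁ D w (fun y hy => (hd y (by linarith [(hball y hy).1])).differentiableWithinAt)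
      (fun y hy => h0 y (hball y hy).1 (hball y hy).2)
      (fun y hy => hB y (by linarith [(hball y hy).1])) (hb w rfl) z ?_
    have : z - w = ((z.re - b : ℝ) : ℂ) := by
      apply Complex.ext <;> simp [hw]
    rw [this, Complex.norm_real, Real.norm_eq_abs, abs_of_nonpos (by linarith)]
    linarith

end MarkovRenewal

/-! ### Principal parts and pole orders. -/

namespace MarkovRenewal

/-- Splitting off the principal part at a pole. -/
theorem exists_principal_part {z₀ : ℂ} (n : ℕ) {φ G : ℂ → ℂ} (hG : AnalyticAt ℂ G z₀)
    (h : ∀ᶠ z in 𝓝[≠] z₀, (z - z₀) ^ n * φ z = G z) :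
    ∃ (c : ℕ → ℂ) (g : ℂ → ℂ), AnalyticAt ℂ g z₀ ∧
      ∀ᶠ z in 𝓝[≠] z₀, φ z - ∑ k ∈ Finset.range n, c k / (z - z₀) ^ (k + 1) = g z := by
  induction n generalizing φ G with
  | zero => exact ⟨0, G, hG, by simpa using h⟩
  | succ n ih =>
    obtain ⟨q, hq⟩ := hG
    have hG' : AnalyticAt ℂ (dslope G z₀) z₀ := ⟨_, hq.has_fpower_series_dslope_fslope⟩
    -- Removing the top polar term, with coefficient `G z₀`, lowers the order by one; the divided
    -- difference of `G` is the new analytic factor.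
    have h' : ∀ᶠ z in 𝓝[≠] z₀, (z - z₀) ^ n * (φ z - G z₀ / (z - z₀) ^ (n + 1))
        = dslope G z₀ z := by
      filter_upwards [h, self_mem_nhdsWithin] with z hz hne
      have h1 : z - z₀ ≠ 0 := sub_ne_zero.2 hne
      rw [dslope_of_ne _ hne, slope_def_field, ← hz]
      field_simp
      ring
    obtain ⟨c, g, hg, hc⟩ := ih hG' h'
    refine ⟨Function.update c n (G z₀), g, hg, ?_⟩
    filter_upwards [hc] with z hz
    rw [Finset.sum_range_succ, Function.update_self, ← hz]
    have : ∑ k ∈ Finset.range n, Function.update c n (G z₀) k / (z - z₀) ^ (k + 1)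
        = ∑ k ∈ Finset.range n, c k / (z - z₀) ^ (k + 1) :=
      Finset.sum_congr rfl fun k hk => by
        rw [Function.update_of_ne (Finset.mem_range.1 hk).ne]
    rw [this]
    ring

/-- Subtracting the principal parts at finitely many poles leaves a holomorphic function. -/
theorem exists_sub_principal_parts {Ω : Set ℂ} (S : Finset ℂ) (N : ℂ → ℕ) {φ : ℂ → ℂ}
    (hφ : ∀ z ∈ Ω, z ∉ S → DifferentiableAt ℂ φ z)
    (hS : ∀ s ∈ S, ∃ G : ℂ → ℂ, AnalyticAt ℂ G s ∧
      ∀ᶠ z in 𝓝[≠] s, (z - s) ^ N s * φ z = G z) :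
    ∃ (c : ℂ → ℕ → ℂ) (H : ℂ → ℂ), (∀ z ∈ Ω, DifferentiableAt ℂ H z) ∧
      ∀ z ∉ S, H z = φ z - ∑ s ∈ S, ∑ k ∈ Finset.range (N s), c s k / (z - s) ^ (k + 1) := by
  have h1 : ∀ s, ∃ (c : ℕ → ℂ) (g : ℂ → ℂ), s ∈ S → AnalyticAt ℂ g s ∧
      ∀ᶠ z in 𝓝[≠] s, φ z - ∑ k ∈ Finset.range (N s), c k / (z - s) ^ (k + 1) = g z := by
    intro s
    by_cases hs : s ∈ S
    · obtain ⟨G, hG, hG'⟩ := hS s hs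
      obtain ⟨c, g, h⟩ := exists_principal_part _ hG hG'
      exact ⟨c, g, fun _ => h⟩
    · exact ⟨0, 0, fun h => absurd h hs⟩
  choose c g hcg using h1
  classical
  set P : ℂ → ℂ → ℂ := fun s z => ∑ k ∈ Finset.range (N s), c s k / (z - s) ^ (k + 1) with hP
  have hPd : ∀ s z, z ≠ s → AnalyticAt ℂ (P s) z := by
    intro s z hz
    refine Finset.analyticAt_fun_sum _ fun k _ => ?_
    refine analyticAt_const.div (by fun_prop) ?_
    exact pow_ne_zero _ (sub_ne_zero.2 hz)
  -- Near `s` the principal parts at the other poles are analytic, so `g' s` is the local regular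
  -- part of the full difference; it also supplies the value at `s`, since `φ` is known only on
  -- punctured neighbourhoods.
  set g' : ℂ → ℂ → ℂ := fun s z => g s z - ∑ s' ∈ S.erase s, P s' z with hg'
  have hg'd : ∀ s ∈ S, AnalyticAt ℂ (g' s) s := by
    intro s hs
    refine (hcg s hs).1.sub (Finset.analyticAt_fun_sum _ fun s' hs' => hPd s' s ?_)
    exact (Finset.ne_of_mem_erase hs').symm
  set H : ℂ → ℂ := fun z => if z ∈ S then g' z z else φ z - ∑ s ∈ S, P s z with hH
  have hHS : ∀ z ∉ S, H z = φ z - ∑ s ∈ S, P s z := fun z hz => if_neg hz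
  refine ⟨c, H, fun z hz => ?_, hHS⟩
  by_cases hzS : z ∈ S
  · have hne : ∀ᶠ y in 𝓝[≠] z, y ∉ S.erase z := by
      have : ∀ᶠ y in 𝓝 z, y ∉ S.erase z :=
        (S.erase z).finite_toSet.isClosed.isOpen_compl.mem_nhds (Finset.notMem_erase z S)
      exact this.filter_mono nhdsWithin_le_nhds
    have hev : ∀ᶠ y in 𝓝[≠] z, H y = g' z y := by
      filter_upwards [hne, (hcg z hzS).2, self_mem_nhdsWithin] with y hy hy2 hy3
      have hyS : y ∉ S := fun h => hy (Finset.mem_erase.2 ⟨hy3, h⟩)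
      rw [hHS y hyS, hg', ← Finset.add_sum_erase _ _ hzS]
      simp only
      rw [← hy2]
      ring
    have hev' : H =ᶠ[𝓝 z] g' z := by
      rw [eventually_nhdsWithin_iff] at hev
      filter_upwards [hev] with y hy
      by_cases hyz : y = z
      · rw [hyz, hH]
        exact if_pos hzS
      · exact hy hyz
    exact (hg'd z hzS).differentiableAt.congr_of_eventuallyEq hev'
  · have hev : H =ᶠ[𝓝 z] fun y => φ y - ∑ s ∈ S, P s y := by
      have : ∀ᶠ y in 𝓝 z, y ∉ S := S.finite_toSet.isClosed.isOpen_compl.mem_nhds hzS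
      filter_upwards [this] with y hy
      exact hHS y hy
    refine DifferentiableAt.congr_of_eventuallyEq ?_ hev
    refine (hφ z hz hzS).sub (DifferentiableAt.fun_sum fun s hs => ?_)
    exact (hPd s z (by rintro rfl; exact hzS hs)).differentiableAt

variable {p : ℕ} {μ : Fin p → Fin p → Measure ℝ}

theorem analyticAt_det {A : ℂ → Matrix (Fin p) (Fin p) ℂ} {z : ℂ}
    (h : ∀ i j, AnalyticAt ℂ (fun z => A z i j) z) : AnalyticAt ℂ (fun z => (A z).det) z := by
  simp only [Matrix.det_apply]
  refine Finset.analyticAt_fun_sum _ fun σ _ => ?_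
  simp only [Units.smul_def, zsmul_eq_mul]
  exact analyticAt_const.mul (Finset.analyticAt_fun_prod _ fun i _ => h _ _)

theorem analyticAt_adjugate {A : ℂ → Matrix (Fin p) (Fin p) ℂ} {z : ℂ}
    (h : ∀ i j, AnalyticAt ℂ (fun z => A z i j) z) (i j : Fin p) :
    AnalyticAt ℂ (fun z => (A z).adjugate i j) z := by
  simp only [Matrix.adjugate_apply]
  refine analyticAt_det fun k l => ?_
  simp only [Matrix.updateRow_apply]
  split_ifs
  · exact analyticAt_const
  · exact h k l

/-- The infimum is attained once some exponent is admissible. The vanishing order of the determinant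
is one, because the inverse is the adjugate over the determinant; `hdet` makes this order finite. -/
theorem poleOrder_spec {z₀ : ℂ} (hz₀ : z₀ ∈ charRoots μ)
    (hL : ∀ i j, AnalyticAt ℂ (fun z => (1 - laplace μ z) i j) z₀)
    (hdet : ∃ᶠ z in 𝓝 z₀, (1 - laplace μ z).det ≠ 0) (i j : Fin p) :
    ∃ g : ℂ → ℂ, AnalyticAt ℂ g z₀ ∧
      ∀ᶠ z in 𝓝[≠] z₀, (z - z₀) ^ poleOrder μ z₀ * (1 - laplace μ z)⁻¹ i j = g z := by
  have hne : {n : ℕ | ∀ i j, ∃ g : ℂ → ℂ, AnalyticAt ℂ g z₀ ∧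
      ∀ᶠ z in 𝓝[≠] z₀, (z - z₀) ^ n * (1 - laplace μ z)⁻¹ i j = g z}.Nonempty := by
    have hD := analyticAt_det hL
    obtain ⟨n, g, hg, hg0, hDg⟩ := hD.exists_eventuallyEq_pow_smul_nonzero_iff.2 (by simpa using hdet)
    refine ⟨n, fun i j => ⟨fun z => (1 - laplace μ z).adjugate i j / g z,
      (analyticAt_adjugate hL i j).div hg hg0, ?_⟩⟩
    have hg0' : ∀ᶠ z in 𝓝 z₀, g z ≠ 0 := hg.continuousAt.eventually_ne hg0
    filter_upwards [hDg.filter_mono nhdsWithin_le_nhds, hg0'.filter_mono nhdsWithin_le_nhds,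
      self_mem_nhdsWithin] with z hz hgz hne
    have h1 : z - z₀ ≠ 0 := sub_ne_zero.2 hne
    rw [Matrix.inv_def, Matrix.smul_apply, smul_eq_mul, Ring.inverse_eq_inv', hz, smul_eq_mul]
    field_simp
  have := Nat.sInf_mem hne i j
  rw [poleOrder, if_pos hz₀]
  exact this

end MarkovRenewal

/-! ### Transforms of exponential monomials and of distribution functions. -/

namespace MarkovRenewal

theorem pow_le_mul_exp (k : ℕ) {ε x : ℝ} (hε : 0 < ε) (hx : 0 ≤ x) :
    x ^ k ≤ k.factorial / ε ^ k * Real.exp (ε * x) := by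
  have h := Real.pow_div_factorial_le_exp (ε * x) (by positivity) k
  rw [div_le_iff₀ (by positivity), mul_pow] at h
  rw [div_mul_eq_mul_div, le_div_iff₀ (by positivity)]
  linarith

theorem integrableOn_pow_mul_exp (k : ℕ) {w : ℂ} (hw : w.re < 0) :
    IntegrableOn (fun x : ℝ => (x : ℂ) ^ k * Complex.exp (w * x)) (Ioi 0) := by
  have hε : 0 < -w.re / 2 := by linarith
  have h1 : IntegrableOn (fun x : ℝ => Real.exp (w.re / 2 * x)) (Ioi 0) :=
    integrableOn_exp_mul_Ioi (by linarith) 0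
  refine Integrable.mono' (h1.const_mul (k.factorial / (-w.re / 2) ^ k))
    (Continuous.aestronglyMeasurable (by fun_prop)) ?_
  filter_upwards [ae_restrict_mem measurableSet_Ioi] with x hx
  have hx0 : (0 : ℝ) < x := hx
  rw [norm_mul, norm_pow, Complex.norm_real, Real.norm_of_nonneg hx0.le, Complex.norm_exp]
  simp only [Complex.mul_re, Complex.ofReal_re, Complex.ofReal_im, mul_zero, sub_zero]
  calc x ^ k * Real.exp (w.re * x)
      ≤ (k.factorial / (-w.re / 2) ^ k * Real.exp (-w.re / 2 * x)) * Real.exp (w.re * x) := by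
        gcongr; exact pow_le_mul_exp k hε hx0.le
    _ = _ := by
        rw [mul_assoc, ← Real.exp_add]
        congr 2
        ring

/-- By induction, integrating the derivative of `x^(k+1) e^{wx}`, whose boundary values at `0` and
at infinity vanish. -/
theorem integral_pow_mul_exp (k : ℕ) {w : ℂ} (hw : w.re < 0) :
    ∫ x : ℝ in Ioi 0, (x : ℂ) ^ k * Complex.exp (w * x) = k.factorial / (-w) ^ (k + 1) := by
  have hw0 : w ≠ 0 := by rintro rfl; simp at hw
  induction k with
  | zero =>
    simp only [pow_zero, one_mul]
    rw [integral_exp_mul_complex_Ioi hw]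
    simp [neg_div, div_neg]
  | succ k ih =>
    have hd : ∀ x : ℝ, HasDerivAt (fun x : ℝ => (x : ℂ) ^ (k + 1) * Complex.exp (w * x))
        ((k + 1) * ((x : ℂ) ^ k * Complex.exp (w * x))
          + w * ((x : ℂ) ^ (k + 1) * Complex.exp (w * x))) x := by
      intro x
      have h1 : HasDerivAt (fun x : ℝ => (x : ℂ)) 1 x := Complex.ofRealCLM.hasDerivAt
      refine ((h1.pow (k + 1)).mul (h1.const_mul w).cexp).congr_deriv ?_
      simp
      ring
    have hi := ((integrableOn_pow_mul_exp k hw).const_mul (k + 1 : ℂ)).add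
      ((integrableOn_pow_mul_exp (k + 1) hw).const_mul w)
    have hlim := tendsto_zero_of_hasDerivAt_of_integrableOn_Ioi (fun x _ => hd x) hi
      (integrableOn_pow_mul_exp (k + 1) hw)
    have h := integral_Ioi_of_hasDerivAt_of_tendsto (hd 0).continuousAt.continuousWithinAt
      (fun x _ => hd x) hi hlim
    rw [integral_add ((integrableOn_pow_mul_exp k hw).const_mul (k + 1 : ℂ))
      ((integrableOn_pow_mul_exp (k + 1) hw).const_mul w), integral_const_mul, integral_const_mul,
      ih] at h
    have h2 : w * ∫ x : ℝ in Ioi 0, (x : ℂ) ^ (k + 1) * Complex.exp (w * x)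
        = -((k + 1) * (k.factorial / (-w) ^ (k + 1))) := by
      simp at h
      linear_combination h
    have h3 : -w ≠ 0 := neg_ne_zero.2 hw0
    apply mul_left_cancel₀ hw0
    rw [h2, Nat.factorial_succ, pow_succ _ (k + 1)]
    push_cast
    field_simp

/-- The Laplace transform of the distribution function of a measure on `[0, ∞)`. -/
theorem laplace_distribution {ν : Measure ℝ} [SFinite ν] (hν : ν (Iio 0) = 0) {z : ℂ}
    (hz : 0 < z.re) (hi : Integrable (fun x : ℝ => Real.exp (-z.re * x)) ν) :
    IntegrableOn (fun x : ℝ => Complex.exp (-z * x) * ν.real (Icc 0 x)) (Ioi 0) ∧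
    ∫ x : ℝ in Ioi 0, Complex.exp (-z * x) * ν.real (Icc 0 x)
      = z⁻¹ * ∫ x : ℝ, Complex.exp (-z * x) ∂ν := by
  have hz0 : z ≠ 0 := by rintro rfl; simp at hz
  -- The kernel `1_{y ≤ x} e^{-zx}` gives `ν.real (Icc 0 x)` when integrated in `y`, and `z⁻¹
  -- e^{-zy}` when integrated in `x`, for which `Re z > 0` is needed.
  set f : ℝ × ℝ → ℂ := fun q => (Ici q.2).indicator (fun x : ℝ => Complex.exp (-z * x)) q.1 with hf
  have hfm : Measurable f := by
    have : f = {q : ℝ × ℝ | q.2 ≤ q.1}.indicator fun q => Complex.exp (-z * q.1) := by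
      funext q
      simp only [hf, indicator]
      rfl
    rw [this]
    exact Measurable.indicator (by fun_prop) (measurableSet_le measurable_snd measurable_fst)
  have hsub : ∀ y : ℝ, 0 ≤ y → ∀ g : ℝ → ℂ,
      ∫ x in Ioi (0 : ℝ), (Ici y).indicator g x = ∫ x in Ioi y, g x := by
    intro y hy g
    rw [← integral_Ici_eq_integral_Ioi, ← integral_Ici_eq_integral_Ioi,
      setIntegral_indicator measurableSet_Ici]
    congr 2
    rw [Ici_inter_Ici]
    simp [hy]
  have hexp : ∀ y : ℝ, IntegrableOn (fun x : ℝ => Complex.exp (-z * x)) (Ioi y) := fun y =>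
    integrableOn_exp_mul_complex_Ioi (by simpa using hz) y
  have hinner : ∀ y : ℝ, 0 ≤ y →
      ∫ x in Ioi (0 : ℝ), f (x, y) = z⁻¹ * Complex.exp (-z * y) := by
    intro y hy
    rw [hsub y hy, integral_exp_mul_complex_Ioi (by simpa using hz) y]
    field_simp
  have hnorm : ∀ y : ℝ, 0 ≤ y →
      ∫ x in Ioi (0 : ℝ), ‖f (x, y)‖ = z.re⁻¹ * Real.exp (-z.re * y) := by
    intro y hy
    have h1 : ∀ x, ‖f (x, y)‖ = (Ici y).indicator (fun x : ℝ => Real.exp (-z.re * x)) x := by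
      intro x
      simp only [hf]
      rw [norm_indicator_eq_indicator_norm]
      simp only [norm_exp_neg_mul]
    simp only [h1]
    have h2 : ∫ x in Ioi (0 : ℝ), (Ici y).indicator (fun x : ℝ => Real.exp (-z.re * x)) x
        = ∫ x in Ioi y, Real.exp (-z.re * x) := by
      rw [← integral_Ici_eq_integral_Ioi, ← integral_Ici_eq_integral_Ioi,
        setIntegral_indicator measurableSet_Ici]
      congr 2
      rw [Ici_inter_Ici]
      simp [hy]
    rw [h2, integral_exp_mul_Ioi (by linarith) y]
    field_simp
  have hint : Integrable f ((volume.restrict (Ioi 0)).prod ν) := by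
    rw [integrable_prod_iff' hfm.aestronglyMeasurable]
    constructor
    · filter_upwards [ae_nonneg_of_measure_Iio hν] with y hy
      exact (hexp 0).indicator measurableSet_Ici
    · refine (hi.const_mul z.re⁻¹).congr ?_
      filter_upwards [ae_nonneg_of_measure_Iio hν] with y hy
      exact (hnorm y hy).symm
  have hν' : ∀ x : ℝ, ∫ y, f (x, y) ∂ν = Complex.exp (-z * x) * ν.real (Icc 0 x) := by
    intro x
    have h1 : ∀ y, f (x, y) = (Iic x).indicator (fun _ => Complex.exp (-z * x)) y := by
      intro y
      simp only [hf, indicator, mem_Ici, mem_Iic]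
    simp only [h1]
    rw [integral_indicator measurableSet_Iic, setIntegral_const, Complex.real_smul, mul_comm]
    congr 2
    refine measureReal_congr ?_
    filter_upwards [ae_nonneg_of_measure_Iio hν] with y hy
    apply propext
    exact ⟨fun h => ⟨hy, h⟩, fun h => h.2⟩
  refine ⟨hint.integral_prod_left.congr (Eventually.of_forall hν'), ?_⟩
  simp only [← hν']
  rw [integral_integral_swap hint, ← integral_const_mul]
  refine integral_congr_ae ?_
  filter_upwards [ae_nonneg_of_measure_Iio hν] with y hy
  exact hinner y hy

end MarkovRenewal

/-! ### The inverse in the strip: bounds, poles and decay. -/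

namespace MarkovRenewal

variable {p : ℕ} {μ : Fin p → Fin p → Measure ℝ}

theorem exists_norm_one_sub_laplace_le (hμ : ∀ i j, μ i j (Iio 0) = 0) {w : ℂ}
    (hw : w ∈ laplaceDomain μ) :
    ∃ B, ∀ z : ℂ, w.re ≤ z.re → ∀ i j, ‖(1 - laplace μ z) i j‖ ≤ B := by
  refine ⟨1 + ∑ i, ∑ j, ∫ x, Real.exp (-w.re * x) ∂(μ i j), fun z hz i j => ?_⟩
  rw [Matrix.sub_apply]
  refine (norm_sub_le _ _).trans (add_le_add ?_ ((norm_laplace_le hμ hw hz i j).trans ?_))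
  · rw [Matrix.one_apply]
    split_ifs <;> simp
  · have h0 : ∀ i j, 0 ≤ ∫ x, Real.exp (-w.re * x) ∂(μ i j) := fun i j =>
      integral_nonneg fun x => Real.exp_nonneg _
    exact (Finset.single_le_sum (f := fun j => ∫ x, Real.exp (-w.re * x) ∂(μ i j))
      (fun j _ => h0 i j) (Finset.mem_univ j)).trans
      (Finset.single_le_sum (f := fun i => ∑ j, ∫ x, Real.exp (-w.re * x) ∂(μ i j))
        (fun i _ => Finset.sum_nonneg fun j _ => h0 i j) (Finset.mem_univ i))

theorem differentiableAt_one_sub_laplace (hμ : ∀ i j, μ i j (Iio 0) = 0) {w z : ℂ}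
    (hw : w ∈ laplaceDomain μ) (h : w.re < z.re) (i j : Fin p) :
    DifferentiableAt ℂ (fun z => (1 - laplace μ z) i j) z := by
  simp only [Matrix.sub_apply]
  exact (differentiableAt_const _).sub (differentiableAt_laplace hμ hw h i j)

theorem analyticAt_one_sub_laplace (hμ : ∀ i j, μ i j (Iio 0) = 0) {w z : ℂ}
    (hw : w ∈ laplaceDomain μ) (h : w.re < z.re) (i j : Fin p) :
    AnalyticAt ℂ (fun z => (1 - laplace μ z) i j) z := by
  rw [Complex.analyticAt_iff_eventually_differentiableAt]
  filter_upwards [(isOpen_Ioi.preimage Complex.continuous_re).mem_nhds h] with y hy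
  exact differentiableAt_one_sub_laplace hμ hw hy i j

theorem det_ne_zero_of_boundedInverseOnLine {ϑ : ℝ} (h : BoundedInverseOnLine μ ϑ) :
    ∃ M, ∀ z : ℂ, z.re = ϑ → (1 - laplace μ z).det ≠ 0 ∧
      ∀ i j, ‖(1 - laplace μ z)⁻¹ i j‖ ≤ M := by
  obtain ⟨M, hM⟩ := h
  refine ⟨M, fun z hz => ?_⟩
  have h1 := hM z.im
  rwa [← hz, Complex.re_add_im] at h1

/-- High up in a strip without roots of the characteristic equation, the inverse is bounded. -/
theorem exists_norm_inv_le_in_strip (hμ : ∀ i j, μ i j (Iio 0) = 0) {ϑ δ b M : ℝ} (hδ : 0 < δ)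
    (hw : ((ϑ - δ : ℝ) : ℂ) ∈ laplaceDomain μ) (hbdd : BoundedInverseOnLine μ ϑ)
    (hfin : (charRootsAbove μ ϑ).Finite) (hb : ϑ < b)
    (hbM : ∀ z : ℂ, z.re = b → (1 - laplace μ z).det ≠ 0 ∧
      ∀ i j, ‖(1 - laplace μ z)⁻¹ i j‖ ≤ M) :
    ∃ B T, ∀ z : ℂ, ϑ ≤ z.re → z.re ≤ b → T ≤ |z.im| →
      ∀ i j, ‖(1 - laplace μ z)⁻¹ i j‖ ≤ B := by
  obtain ⟨B₀, hB₀⟩ := exists_norm_one_sub_laplace_le hμ hw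
  rw [Complex.ofReal_re] at hB₀
  obtain ⟨M', hM'⟩ := det_ne_zero_of_boundedInverseOnLine hbdd
  set M₀ := max M M' with hM₀
  have hM₀' : 0 < max M₀ 1 := lt_max_of_lt_right one_pos
  obtain ⟨T, hT⟩ : ∃ T : ℝ, ∀ z ∈ charRootsAbove μ ϑ, |z.im| ≤ T := by
    obtain ⟨T, hT⟩ := (hfin.image fun z : ℂ => |z.im|).bddAbove
    exact ⟨T, fun z hz => hT (mem_image_of_mem _ hz)⟩
  obtain ⟨c, T', hc, h⟩ := exists_norm_ge_in_strip (D := fun z => (1 - laplace μ z).det) (a := ϑ)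
    (b := b) (δ := δ) (B := p.factorial * B₀ ^ p) (c := (p.factorial * (max M₀ 1) ^ p)⁻¹) (T := T)
    hb hδ (by positivity)
    (fun z hz => (analyticAt_det fun i j => analyticAt_one_sub_laplace hμ hw
      (by simpa using hz) i j).differentiableAt)
    (fun z hz => norm_det_le (hB₀ z hz.le))
    (fun z hz => inv_le_norm_det (hM' z hz).1
      fun i j => ((hM' z hz).2 i j).trans (le_max_right _ _))
    (fun z hz => inv_le_norm_det (hbM z hz).1
      fun i j => ((hbM z hz).2 i j).trans (le_max_left _ _))
    (fun z hz hzT h0 => by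
      have : z ∈ charRootsAbove μ ϑ :=
        ⟨⟨laplaceDomain_mono hμ hw (by rw [Complex.ofReal_re]; linarith), h0⟩, hz⟩
      exact absurd (hT z this) (not_le.2 hzT))
  -- Cramer's rule: a bounded adjugate over a determinant bounded below.
  refine ⟨p.factorial * (max B₀ 1) ^ p / c, T', fun z hz1 hz2 hz3 i j => ?_⟩
  rw [inv_apply_eq_adjugate_div, norm_div]
  have h1 := norm_adjugate_le (hB₀ z (by linarith)) i j
  have h2 := h z hz1 hz2 hz3
  gcongr

/-- Far to the right, the inverse is the Laplace transform of the Markov renewal measure. -/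
theorem inverse_eq_laplace_renewalMeasure [∀ i j, SFinite (μ i j)]
    (hμ : ∀ i j, μ i j (Iio 0) = 0) {w : ℂ} (hw : w ∈ laplaceDomain (renewalMeasure μ)) {z : ℂ}
    (hz : w.re ≤ z.re) : (1 - laplace μ z).det ≠ 0 ∧
      (1 - laplace μ z)⁻¹ = laplace (renewalMeasure μ) z := by
  have h := one_sub_laplace_mul_laplace_renewalMeasure
    (laplaceDomain_mono (renewalMeasure_Iio hμ) hw hz)
  refine ⟨fun h0 => ?_, Matrix.inv_eq_right_inv h⟩
  have := congrArg Matrix.det h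
  rw [Matrix.det_mul, h0, zero_mul, Matrix.det_one] at this
  exact zero_ne_one this

/-- The poles of `z⁻¹ (I - ℒμ(z))⁻¹` in the half plane `ϑ ≤ Re z`. -/
noncomputable def poleSet {ϑ : ℝ} (hfin : (charRootsAbove μ ϑ).Finite) : Finset ℂ :=
  open Classical in hfin.toFinset ∪ if ϑ ≤ 0 then {0} else ∅

/-- The order of the pole of `z⁻¹ (I - ℒμ(z))⁻¹`. -/
noncomputable def renewalOrder (μ : Fin p → Fin p → Measure ℝ) (z : ℂ) : ℕ :=
  open Classical in poleOrder μ z + if z = 0 then 1 else 0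

theorem mem_poleSet {ϑ : ℝ} (hfin : (charRootsAbove μ ϑ).Finite) {z : ℂ} :
    z ∈ poleSet hfin ↔ z ∈ charRootsAbove μ ϑ ∨ (ϑ ≤ 0 ∧ z = 0) := by
  rw [poleSet, Finset.mem_union, Finite.mem_toFinset]
  split_ifs with h <;> simp [h]

theorem det_ne_zero_of_notMem (hμ : ∀ i j, μ i j (Iio 0) = 0) {w z : ℂ} {ϑ : ℝ}
    (hw : w ∈ laplaceDomain μ) (hwϑ : w.re < ϑ) (hbdd : BoundedInverseOnLine μ ϑ)
    (hz : ϑ ≤ z.re) (hzΛ : z ∉ charRootsAbove μ ϑ) : (1 - laplace μ z).det ≠ 0 := by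
  rcases hz.eq_or_lt with h | h
  · obtain ⟨M, hM⟩ := det_ne_zero_of_boundedInverseOnLine hbdd
    exact (hM z h.symm).1
  · exact fun h0 => hzΛ ⟨⟨laplaceDomain_mono hμ hw (by linarith), h0⟩, h⟩

theorem analyticAt_inv (hμ : ∀ i j, μ i j (Iio 0) = 0) {w z : ℂ} (hw : w ∈ laplaceDomain μ)
    (hz : w.re < z.re) (h0 : (1 - laplace μ z).det ≠ 0) (i j : Fin p) :
    AnalyticAt ℂ (fun z => (1 - laplace μ z)⁻¹ i j) z := by
  simp only [inv_apply_eq_adjugate_div]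
  exact (analyticAt_adjugate (fun i j => analyticAt_one_sub_laplace hμ hw hz i j) i j).div
    (analyticAt_det fun i j => analyticAt_one_sub_laplace hμ hw hz i j) h0

/-- The factor `z⁻¹` raises the order by one exactly at `0`. If `0` is a pole without lying in
`charRootsAbove μ ϑ`, the inverse is regular there and `poleOrder μ 0 = 0`. -/
theorem exists_analyticAt_of_mem_poleSet (hμ : ∀ i j, μ i j (Iio 0) = 0) {w : ℂ} {ϑ : ℝ}
    (hw : w ∈ laplaceDomain μ) (hwϑ : w.re < ϑ) (hbdd : BoundedInverseOnLine μ ϑ)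
    (hfin : (charRootsAbove μ ϑ).Finite) {s : ℂ} (hs : s ∈ poleSet hfin) (i j : Fin p) :
    ∃ G : ℂ → ℂ, AnalyticAt ℂ G s ∧ ∀ᶠ z in 𝓝[≠] s,
      (z - s) ^ renewalOrder μ s * (z⁻¹ * (1 - laplace μ z)⁻¹ i j) = G z := by
  have hinv : ∃ g : ℂ → ℂ, AnalyticAt ℂ g s ∧
      ∀ᶠ z in 𝓝[≠] s, (z - s) ^ poleOrder μ s * (1 - laplace μ z)⁻¹ i j = g z := by
    by_cases hsΛ : s ∈ charRootsAbove μ ϑ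
    · have hL : ∀ i j, AnalyticAt ℂ (fun z => (1 - laplace μ z) i j) s := fun i j =>
        analyticAt_one_sub_laplace hμ hw (hwϑ.trans hsΛ.2) i j
      refine poleOrder_spec hsΛ.1 hL ?_ i j
      have h1 : ∀ᶠ z in 𝓝[≠] s, z ∉ charRootsAbove μ ϑ := by
        have h2 : IsClosed (charRootsAbove μ ϑ \ {s}) := (hfin.subset sdiff_subset).isClosed
        have h3 : ∀ᶠ z in 𝓝 s, z ∉ charRootsAbove μ ϑ \ {s} :=
          h2.isOpen_compl.mem_nhds (by simp)
        filter_upwards [h3.filter_mono nhdsWithin_le_nhds, self_mem_nhdsWithin] with z hz hne h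
        exact hz ⟨h, hne⟩
      have h4 : ∀ᶠ z : ℂ in 𝓝[≠] s, ϑ < z.re :=
        Filter.Eventually.filter_mono nhdsWithin_le_nhds
          ((isOpen_Ioi.preimage Complex.continuous_re).mem_nhds hsΛ.2)
      have h5 : ∀ᶠ z : ℂ in 𝓝[≠] s, (1 - laplace μ z).det ≠ 0 := by
        filter_upwards [h1, h4] with z hz hz'
        exact det_ne_zero_of_notMem hμ hw hwϑ hbdd hz'.le hz
      exact h5.frequently.filter_mono nhdsWithin_le_nhds
    · have h0 : ϑ ≤ 0 ∧ s = 0 := ((mem_poleSet hfin).1 hs).resolve_left hsΛ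
      have hsre : ϑ ≤ s.re := by rw [h0.2]; exact h0.1
      have hdet := det_ne_zero_of_notMem hμ hw hwϑ hbdd hsre hsΛ
      have hk : poleOrder μ s = 0 := by
        rw [poleOrder, if_neg]
        exact fun h => hdet h.2
      exact ⟨_, analyticAt_inv hμ hw (hwϑ.trans_le hsre) hdet i j,
        Eventually.of_forall fun z => by rw [hk, pow_zero, one_mul]⟩
  obtain ⟨g, hg, hge⟩ := hinv
  by_cases hs0 : s = 0
  · refine ⟨g, hg, ?_⟩
    filter_upwards [hge, self_mem_nhdsWithin] with z hz hne
    rw [← hz, renewalOrder, if_pos hs0, pow_succ]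
    have : z ≠ 0 := by rwa [← hs0]
    rw [hs0, sub_zero]
    field_simp
  · refine ⟨fun z => z⁻¹ * g z, (analyticAt_id.inv hs0).mul hg, ?_⟩
    filter_upwards [hge] with z hz
    rw [← hz, renewalOrder, if_neg hs0, add_zero]
    ring

/-- `f` decays like `1 / |Im z|` in a vertical strip. -/
def DecaysInStrip (a b : ℝ) (f : ℂ → ℂ) : Prop :=
  ∃ M T : ℝ, ∀ z : ℂ, a ≤ z.re → z.re ≤ b → T ≤ |z.im| → ‖f z‖ ≤ M / (1 + |z.im|)

theorem DecaysInStrip.sub {a b : ℝ} {f g : ℂ → ℂ} (hf : DecaysInStrip a b f)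
    (hg : DecaysInStrip a b g) : DecaysInStrip a b fun z => f z - g z := by
  obtain ⟨M, T, h⟩ := hf
  obtain ⟨M', T', h'⟩ := hg
  refine ⟨M + M', max T T', fun z h1 h2 h3 => (norm_sub_le _ _).trans ?_⟩
  rw [add_div]
  exact add_le_add (h z h1 h2 ((le_max_left _ _).trans h3)) (h' z h1 h2 ((le_max_right _ _).trans h3))

theorem DecaysInStrip.sum {a b : ℝ} {ι : Type*} (s : Finset ι) {f : ι → ℂ → ℂ}
    (hf : ∀ i ∈ s, DecaysInStrip a b (f i)) : DecaysInStrip a b fun z => ∑ i ∈ s, f i z := by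
  classical
  induction s using Finset.induction_on with
  | empty => exact ⟨0, 0, fun z _ _ _ => by simp⟩
  | insert i s hi ih =>
    obtain ⟨M, T, h⟩ := hf i (Finset.mem_insert_self i s)
    obtain ⟨M', T', h'⟩ := ih fun j hj => hf j (Finset.mem_insert_of_mem hj)
    refine ⟨M + M', max T T', fun z h1 h2 h3 => ?_⟩
    simp only [Finset.sum_insert hi, add_div]
    exact (norm_add_le _ _).trans
      (add_le_add (h z h1 h2 ((le_max_left _ _).trans h3))
        (h' z h1 h2 ((le_max_right _ _).trans h3)))

theorem decaysInStrip_div_pow (a b : ℝ) (c s : ℂ) (k : ℕ) :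
    DecaysInStrip a b fun z => c / (z - s) ^ (k + 1) := by
  -- From this height on `‖z - s‖` is at least `1`, so higher powers only help, and at least `(1 +
  -- |Im z|) / 4`.
  refine ⟨‖c‖ * 4, 2 * |s.im| + 2, fun z _ _ hz => ?_⟩
  have h1 := Complex.abs_im_le_norm (z - s)
  rw [Complex.sub_im] at h1
  have h2 := abs_sub_abs_le_abs_sub z.im s.im
  have h3 := abs_nonneg s.im
  have h4 : 1 ≤ ‖z - s‖ := by linarith
  have h5 : (1 + |z.im|) / 4 ≤ ‖z - s‖ := by linarith
  have h6 : ‖z - s‖ ≤ ‖z - s‖ ^ (k + 1) := le_self_pow₀ h4 (by simp)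
  rw [norm_div, norm_pow]
  calc ‖c‖ / ‖z - s‖ ^ (k + 1) ≤ ‖c‖ / ((1 + |z.im|) / 4) := by
        have := abs_nonneg z.im
        gcongr
        exact h5.trans h6
    _ = _ := by field_simp

theorem DecaysInStrip.exists_bound {a b : ℝ} {f : ℂ → ℂ} (hf : DecaysInStrip a b f)
    (hd : ∀ z : ℂ, a ≤ z.re → z.re ≤ b → ContinuousAt f z) :
    ∃ M, ∀ z : ℂ, a ≤ z.re → z.re ≤ b → ‖f z‖ ≤ M / (1 + |z.im|) := by
  obtain ⟨M, T, h⟩ := hf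
  obtain ⟨K, hK⟩ := (isCompact_Icc.reProdIm isCompact_Icc).exists_bound_of_continuousOn
    (s := Icc a b ×ℂ Icc (-T) T) (f := f) (fun z hz => by
      rw [Complex.mem_reProdIm] at hz
      exact (hd z hz.1.1 hz.1.2).continuousWithinAt)
  refine ⟨max M (|K| * (1 + T)), fun z h1 h2 => ?_⟩
  have h0 : 0 < 1 + |z.im| := by positivity
  rcases le_total T |z.im| with hT | hT
  · refine (h z h1 h2 hT).trans ?_
    gcongr
    exact le_max_left _ _
  · have h3 : ‖f z‖ ≤ |K| := (hK z (by
      rw [Complex.mem_reProdIm]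
      exact ⟨⟨h1, h2⟩, abs_le.1 hT⟩)).trans (le_abs_self K)
    rw [le_div_iff₀ h0]
    calc ‖f z‖ * (1 + |z.im|) ≤ |K| * (1 + T) := by gcongr
      _ ≤ _ := le_max_right _ _

end MarkovRenewal

/-! ### The expansion of a single entry of the renewal function. -/

namespace MarkovRenewal

variable {p : ℕ} {μ : Fin p → Fin p → Measure ℝ}

theorem hasDerivAt_expPoly (a w : ℂ) (k : ℕ) (t : ℝ) :
    HasDerivAt (fun t : ℝ => a * ((t : ℂ) ^ k * Complex.exp (w * t)))
      (a * ((k * (t : ℂ) ^ (k - 1) + w * (t : ℂ) ^ k) * Complex.exp (w * t))) t := by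
  have h1 : HasDerivAt (fun x : ℝ => (x : ℂ)) 1 t := Complex.ofRealCLM.hasDerivAt
  refine (((h1.pow k).mul (h1.const_mul w).cexp).const_mul a).congr_deriv ?_
  simp only [Pi.pow_apply]
  ring

theorem norm_pow_mul_exp_le (w : ℂ) (k : ℕ) {s : ℝ} (hs : w.re < s) :
    ∃ K, 0 ≤ K ∧ ∀ t : ℝ, 0 ≤ t → ‖(t : ℂ) ^ k * Complex.exp (w * t)‖ ≤ K * Real.exp (s * t) := by
  have hε : 0 < s - w.re := sub_pos.2 hs
  refine ⟨k.factorial / (s - w.re) ^ k, by positivity, fun t ht => ?_⟩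
  rw [norm_mul, norm_pow, Complex.norm_real, Real.norm_of_nonneg ht, Complex.norm_exp]
  simp only [Complex.mul_re, Complex.ofReal_re, Complex.ofReal_im, mul_zero, sub_zero]
  calc t ^ k * Real.exp (w.re * t)
      ≤ (k.factorial / (s - w.re) ^ k * Real.exp ((s - w.re) * t)) * Real.exp (w.re * t) := by
        gcongr; exact pow_le_mul_exp k hε ht
    _ = _ := by
        rw [mul_assoc, ← Real.exp_add]
        congr 2
        ring

theorem norm_deriv_expPoly_le (a w : ℂ) (k : ℕ) {s : ℝ} (hs : w.re < s) :
    ∃ K, ∀ t : ℝ, 0 ≤ t →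
      ‖a * ((k * (t : ℂ) ^ (k - 1) + w * (t : ℂ) ^ k) * Complex.exp (w * t))‖
        ≤ K * Real.exp (s * t) := by
  obtain ⟨K₁, hK₁, h₁⟩ := norm_pow_mul_exp_le w (k - 1) hs
  obtain ⟨K₂, hK₂, h₂⟩ := norm_pow_mul_exp_le w k hs
  refine ⟨‖a‖ * (k * K₁ + ‖w‖ * K₂), fun t ht => ?_⟩
  rw [norm_mul, mul_assoc, add_mul, mul_assoc, mul_assoc]
  gcongr
  refine (norm_add_le _ _).trans ?_
  rw [add_mul, mul_assoc (k : ℝ), mul_assoc ‖w‖, norm_mul, norm_mul w, Complex.norm_natCast]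
  gcongr
  · exact h₁ t ht
  · exact h₂ t ht

theorem exp_mul_expPoly (a w z : ℂ) (k : ℕ) (x : ℝ) :
    Complex.exp (-z * x) * (a * ((x : ℂ) ^ k * Complex.exp (w * x)))
      = a * ((x : ℂ) ^ k * Complex.exp ((w - z) * x)) := by
  rw [show (w - z) * (x : ℂ) = -z * x + w * x by ring, Complex.exp_add]
  ring

theorem exists_bound_finset {ι : Type*} (S : Finset ι) {E : Type*} [NormedAddCommGroup E]
    {f : ι → ℝ → E} {g : ℝ → ℝ}
    (h : ∀ i ∈ S, ∃ K, ∀ t : ℝ, 0 ≤ t → ‖f i t‖ ≤ K * g t) :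
    ∃ K, ∀ t : ℝ, 0 ≤ t → ‖∑ i ∈ S, f i t‖ ≤ K * g t := by
  choose! K hK using h
  refine ⟨∑ i ∈ S, K i, fun t ht => ?_⟩
  rw [Finset.sum_mul]
  exact norm_sum_le_of_le _ fun i hi => hK i hi t ht

theorem monotone_real_Icc {ν : Measure ℝ} (h : ∀ t, ν (Icc 0 t) < ∞) :
    Monotone fun t => ν.real (Icc 0 t) := fun _ t hst =>
  measureReal_mono (Icc_subset_Icc_right hst) (h t).ne

/-- The expansion of the renewal function, entrywise. -/
theorem exists_renewal_expansion_apply [∀ i j, SFinite (μ i j)] (hμ : ∀ i j, μ i j (Iio 0) = 0)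
    {ϑ δ s₀ : ℝ} (hδ : 0 < δ) (hw : ((ϑ - δ : ℝ) : ℂ) ∈ laplaceDomain μ)
    (hU : (s₀ : ℂ) ∈ laplaceDomain (renewalMeasure μ))
    (hbdd : BoundedInverseOnLine μ ϑ) (hfin : (charRootsAbove μ ϑ).Finite) (i j : Fin p) :
    ∃ (c : ℂ → ℕ → ℂ) (K : ℝ), ∀ t : ℝ, 1 ≤ t →
      ‖(((renewalMeasure μ i j).real (Icc 0 t) : ℝ) : ℂ) - ∑ w ∈ poleSet hfin,
        ∑ k ∈ Finset.range (renewalOrder μ w), c w k * ((t : ℂ) ^ k * Complex.exp (w * t))‖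
        ≤ K * t * Real.exp (ϑ * t) := by
  have hwϑ : ((ϑ - δ : ℝ) : ℂ).re < ϑ := by rw [Complex.ofReal_re]; linarith
  -- The line lies right of `s₀`, so that the inverse is `ℒU`; right of `0`, for
  -- `laplace_distribution`; and right of all poles, so that the terms of `m` have transforms.
  obtain ⟨σ, hσ₀, hσϑ, hσpos, hσS⟩ : ∃ σ : ℝ, s₀ ≤ σ ∧ ϑ < σ ∧ 0 < σ ∧
      ∀ w ∈ poleSet hfin, w.re < σ := by
    have h1 : ∀ᶠ σ : ℝ in atTop, ∀ w ∈ poleSet hfin, w.re < σ :=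
      (Finset.eventually_all _).2 fun w _ => eventually_gt_atTop _
    obtain ⟨σ, ⟨h2, h3⟩, h4, h5⟩ := (((eventually_ge_atTop s₀).and (eventually_gt_atTop ϑ)).and
      ((eventually_gt_atTop (0 : ℝ)).and h1)).exists
    exact ⟨σ, h2, h3, h4, h5⟩
  -- removal of the poles
  obtain ⟨c, H, hHd, hH⟩ := exists_sub_principal_parts (Ω := {z : ℂ | ϑ ≤ z.re}) (poleSet hfin)
    (renewalOrder μ) (φ := fun z => z⁻¹ * (1 - laplace μ z)⁻¹ i j)
    (fun z hz hzS => by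
      have hz' : ϑ ≤ z.re := hz
      rw [mem_poleSet, not_or] at hzS
      have hz0 : z ≠ 0 := by
        rintro rfl
        exact hzS.2 ⟨by simpa using hz', rfl⟩
      exact (differentiableAt_inv hz0).mul (analyticAt_inv hμ hw (hwϑ.trans_le hz')
        (det_ne_zero_of_notMem hμ hw hwϑ hbdd hz' hzS.1) i j).differentiableAt)
    (fun s hs => exists_analyticAt_of_mem_poleSet hμ hw hwϑ hbdd hfin hs i j)
  have hσU : ∀ z : ℂ, z.re = σ → (s₀ : ℂ).re ≤ z.re := fun z hz => by rwa [Complex.ofReal_re, hz]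
  -- decay in the strip
  obtain ⟨B, T, hBT⟩ := exists_norm_inv_le_in_strip hμ hδ hw hbdd hfin hσϑ
    (M := ∑ i, ∑ j, ∫ x, Real.exp (-s₀ * x) ∂(renewalMeasure μ i j)) (fun z hz => by
      obtain ⟨h1, h2⟩ := inverse_eq_laplace_renewalMeasure hμ hU (hσU z hz)
      refine ⟨h1, fun i j => ?_⟩
      rw [h2]
      refine (norm_laplace_le (renewalMeasure_Iio hμ) hU (hσU z hz) i j).trans ?_
      rw [Complex.ofReal_re]
      have h0 : ∀ i j, 0 ≤ ∫ x, Real.exp (-s₀ * x) ∂(renewalMeasure μ i j) := fun i j =>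
        integral_nonneg fun x => Real.exp_nonneg _
      exact (Finset.single_le_sum (f := fun j => ∫ x, Real.exp (-s₀ * x) ∂(renewalMeasure μ i j))
        (fun j _ => h0 i j) (Finset.mem_univ j)).trans
        (Finset.single_le_sum
          (f := fun i => ∑ j, ∫ x, Real.exp (-s₀ * x) ∂(renewalMeasure μ i j))
          (fun i _ => Finset.sum_nonneg fun j _ => h0 i j) (Finset.mem_univ i)))
  have hφ : DecaysInStrip ϑ σ fun z => z⁻¹ * (1 - laplace μ z)⁻¹ i j := by
    refine ⟨2 * |B|, max T 1, fun z h1 h2 h3 => ?_⟩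
    have h4 := hBT z h1 h2 ((le_max_left _ _).trans h3) i j
    have h5 : 1 ≤ |z.im| := (le_max_right _ _).trans h3
    have h6 := Complex.abs_im_le_norm z
    rw [norm_mul, norm_inv]
    calc ‖z‖⁻¹ * ‖(1 - laplace μ z)⁻¹ i j‖ ≤ ((1 + |z.im|) / 2)⁻¹ * |B| := by
          gcongr
          · linarith
          · exact h4.trans (le_abs_self B)
      _ = _ := by field_simp
  have hHdecay : DecaysInStrip ϑ σ H := by
    obtain ⟨M, T', h⟩ := hφ.sub (DecaysInStrip.sum (poleSet hfin) fun s _ =>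
      DecaysInStrip.sum (Finset.range (renewalOrder μ s)) fun k _ =>
        decaysInStrip_div_pow ϑ σ (c s k) s k)
    obtain ⟨T'', hT''⟩ := ((poleSet hfin).finite_toSet.image fun z : ℂ => |z.im|).bddAbove
    refine ⟨M, max T' (T'' + 1), fun z h1 h2 h3 => ?_⟩
    have hzS : z ∉ poleSet hfin := fun hz => by
      have h4 : |z.im| ≤ T'' := hT'' (mem_image_of_mem _ hz)
      linarith [(le_max_right T' (T'' + 1)).trans h3]
    rw [hH z hzS]
    exact h z h1 h2 ((le_max_left _ _).trans h3)
  obtain ⟨M, hM⟩ := hHdecay.exists_bound fun z h1 _ => (hHd z h1).continuousAt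
  -- the main term
  set a : ℂ → ℕ → ℂ := fun w k => c w k / k.factorial with ha
  set m : ℝ → ℂ := fun t => ∑ w ∈ poleSet hfin, ∑ k ∈ Finset.range (renewalOrder μ w),
    a w k * ((t : ℂ) ^ k * Complex.exp (w * t)) with hm
  have hmd : ∀ t : ℝ, HasDerivAt m (∑ w ∈ poleSet hfin, ∑ k ∈ Finset.range (renewalOrder μ w),
      a w k * ((k * (t : ℂ) ^ (k - 1) + w * (t : ℂ) ^ k) * Complex.exp (w * t))) t := fun t =>
    HasDerivAt.fun_sum fun w _ => HasDerivAt.fun_sum fun k _ => hasDerivAt_expPoly _ w k t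
  obtain ⟨K, hK⟩ := exists_bound_finset (poleSet hfin) (fun w hw =>
    exists_bound_finset (Finset.range (renewalOrder μ w)) (fun k _ =>
      norm_deriv_expPoly_le (a w k) w k (hσS w hw)))
  -- The `1 / k!` in `a` cancels the factorial of `integral_pow_mul_exp`: the transform of `m` is
  -- exactly the sum of the principal parts removed.
  have hmi : ∀ z : ℂ, z.re = σ → IntegrableOn (fun x : ℝ => Complex.exp (-z * x) * m x) (Ioi 0) ∧
      ∫ x : ℝ in Ioi 0, Complex.exp (-z * x) * m x
        = ∑ w ∈ poleSet hfin, ∑ k ∈ Finset.range (renewalOrder μ w),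
          c w k / (z - w) ^ (k + 1) := by
    intro z hz
    have h1 : ∀ x : ℝ, Complex.exp (-z * x) * m x = ∑ w ∈ poleSet hfin,
        ∑ k ∈ Finset.range (renewalOrder μ w),
          a w k * ((x : ℂ) ^ k * Complex.exp ((w - z) * x)) := by
      intro x
      simp only [hm, Finset.mul_sum, exp_mul_expPoly]
    simp only [h1]
    have h2 : ∀ w ∈ poleSet hfin, (w - z).re < 0 := fun w hw => by
      rw [Complex.sub_re, hz]
      linarith [hσS w hw]
    have h3 : ∀ w ∈ poleSet hfin, ∀ k ∈ Finset.range (renewalOrder μ w),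
        IntegrableOn (fun x : ℝ => a w k * ((x : ℂ) ^ k * Complex.exp ((w - z) * x))) (Ioi 0) :=
      fun w hw k _ => (integrableOn_pow_mul_exp k (h2 w hw)).const_mul _
    have h4 : ∀ w ∈ poleSet hfin, IntegrableOn (fun x : ℝ => ∑ k ∈ Finset.range (renewalOrder μ w),
        a w k * ((x : ℂ) ^ k * Complex.exp ((w - z) * x))) (Ioi 0) :=
      fun w hw => integrable_finsetSum _ (h3 w hw)
    refine ⟨integrable_finsetSum _ h4, ?_⟩
    rw [integral_finsetSum _ h4]
    refine Finset.sum_congr rfl fun w hw => ?_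
    rw [integral_finsetSum _ (h3 w hw)]
    refine Finset.sum_congr rfl fun k hk => ?_
    rw [integral_const_mul, integral_pow_mul_exp k (h2 w hw), neg_sub, ha]
    have : (k.factorial : ℂ) ≠ 0 := by exact_mod_cast k.factorial_ne_zero
    field_simp
  -- the distribution function
  set u : ℝ → ℝ := fun t => (renewalMeasure μ i j).real (Icc 0 t) with hu
  have hufin : ∀ t, renewalMeasure μ i j (Icc 0 t) < ∞ := fun t => by
    have := hU i j
    rw [Complex.ofReal_re] at this
    exact measure_Icc_lt_top this 0 t
  have hui : ∀ z : ℂ, z.re = σ → IntegrableOn (fun x : ℝ => Complex.exp (-z * x) * u x) (Ioi 0) ∧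
      ∫ x : ℝ in Ioi 0, Complex.exp (-z * x) * u x = z⁻¹ * (1 - laplace μ z)⁻¹ i j := by
    intro z hz
    obtain ⟨h1, h2⟩ := laplace_distribution (renewalMeasure_Iio hμ i j) (z := z) (by rwa [hz])
      (laplaceDomain_mono (renewalMeasure_Iio hμ) hU (hσU z hz) i j)
    refine ⟨h1, h2.trans ?_⟩
    rw [(inverse_eq_laplace_renewalMeasure hμ hU (hσU z hz)).2]
    rfl
  -- Cut off at `0`, since the inversion theorem uses the two-sided transform.
  set R : ℝ → ℂ := (Ici (0 : ℝ)).indicator fun t => (u t : ℂ) - m t with hR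
  have hRi : ∀ z : ℂ, z.re = σ → Integrable (fun x : ℝ => Complex.exp (-z * x) * R x) ∧
      ∫ x : ℝ, Complex.exp (-z * x) * R x = H z := by
    intro z hz
    have h1 : (fun x : ℝ => Complex.exp (-z * x) * R x) = (Ici (0 : ℝ)).indicator fun x : ℝ =>
        Complex.exp (-z * x) * u x - Complex.exp (-z * x) * m x := by
      funext x
      rw [hR]
      by_cases hx : x ∈ Ici (0 : ℝ)
      · rw [indicator_of_mem hx, indicator_of_mem hx, mul_sub]
      · rw [indicator_of_notMem hx, indicator_of_notMem hx, mul_zero]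
    rw [h1]
    constructor
    · rw [integrable_indicator_iff measurableSet_Ici, integrableOn_Ici_iff_integrableOn_Ioi]
      exact (hui z hz).1.sub (hmi z hz).1
    · rw [integral_indicator measurableSet_Ici, integral_Ici_eq_integral_Ioi,
        integral_sub (hui z hz).1 (hmi z hz).1, (hui z hz).2, (hmi z hz).2, hH]
      intro hzS
      have := hσS z hzS
      linarith
  -- The growth rate of `m'` may be taken to be `σ` itself: in the Tauberian theorem it affects only
  -- the window and the constant.
  obtain ⟨K', hK'⟩ := norm_monotone_sub_le (monotone_real_Icc hufin) hmd hσpos.le hσϑ le_rfl hK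
    (R := R) (fun t ht => by rw [hR, indicator_of_mem (mem_Ici.2 ht)])
    (by simpa using (hRi σ (by simp)).1)
    (fun z hz => (hRi z hz).2) (fun z h1 _ => hHd z h1) hM
  exact ⟨a, K', hK'⟩

end MarkovRenewal

/-! ### Exponentially integrable variation and distribution functions. -/

namespace MarkovRenewal

/-- A measure on `[0, ∞)` whose distribution function grows at most like `e^{θ x}`, in an integrated
sense as well. -/
structure IsExpBounded (θ : ℝ) (ν : Measure ℝ) : Prop where
  locallyFinite : IsLocallyFiniteMeasure ν
  measure_Iio : ν (Iio 0) = 0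
  measure_Iic_lt_top : ∀ x, ν (Iic x) < ∞
  integrable : Integrable (fun s : ℝ => Real.exp (-θ * s)) ν
  exists_bound : ∃ K, ∀ x, ν.real (Iic x) ≤ K * Real.exp (θ * x)

theorem exp_window (θ : ℝ) {s x : ℝ} (h1 : s ≤ x) (h2 : x ≤ s + 2) :
    Real.exp (-(2 * |θ|)) * Real.exp (-θ * s) ≤ Real.exp (-θ * x) := by
  rw [← Real.exp_add]
  apply Real.exp_le_exp.2
  have : θ * (x - s) ≤ |θ| * 2 := by
    calc θ * (x - s) ≤ |θ| * (x - s) :=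
          mul_le_mul_of_nonneg_right (le_abs_self θ) (by linarith)
      _ ≤ |θ| * 2 := by gcongr; linarith
  linarith

/-- The window starts at `s + 1`, leaving a gap of length one in which the right limit of a monotone
function at `x - 1` is dominated by its value at `x`. -/
theorem lintegral_exp_window (θ : ℝ) (s : ℝ) :
    ENNReal.ofReal (Real.exp (-(2 * |θ|)) * Real.exp (-θ * s))
      ≤ ∫⁻ x in Icc (s + 1) (s + 2), ENNReal.ofReal (Real.exp (-θ * x)) := by
  calc ENNReal.ofReal (Real.exp (-(2 * |θ|)) * Real.exp (-θ * s))
      = ∫⁻ _ in Icc (s + 1) (s + 2),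
        ENNReal.ofReal (Real.exp (-(2 * |θ|)) * Real.exp (-θ * s)) := by
        rw [setLIntegral_const, Real.volume_Icc]
        norm_num
    _ ≤ _ := by
      refine setLIntegral_mono (by fun_prop) fun x hx => ENNReal.ofReal_le_ofReal ?_
      exact exp_window θ (by linarith [hx.1]) hx.2

/-- A monotone function with finite exponential integral is exponentially bounded. -/
theorem exists_le_exp_of_lintegral {g : ℝ → ℝ} {θ : ℝ} (hg : Monotone g)
    (h0 : ∀ x < 0, g x = 0)
    (hi : ∫⁻ x in Ioi (0 : ℝ), ENNReal.ofReal (Real.exp (-θ * x)) * ENNReal.ofReal (g x) < ∞) :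
    ∃ K, 0 ≤ K ∧ ∀ x, g x ≤ K * Real.exp (θ * x) := by
  set I := ∫⁻ x in Ioi (0 : ℝ), ENNReal.ofReal (Real.exp (-θ * x)) * ENNReal.ofReal (g x) with hI
  refine ⟨I.toReal * Real.exp (2 * |θ|), by positivity, fun t => ?_⟩
  rcases lt_or_ge t 0 with ht | ht
  · rw [h0 t ht]
    positivity
  have h1 : ENNReal.ofReal (Real.exp (-(2 * |θ|)) * Real.exp (-θ * t)) * ENNReal.ofReal (g t)
      ≤ I := by
    calc _ ≤ (∫⁻ x in Icc (t + 1) (t + 2), ENNReal.ofReal (Real.exp (-θ * x)))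
            * ENNReal.ofReal (g t) := by gcongr; exact lintegral_exp_window θ t
      _ = ∫⁻ x in Icc (t + 1) (t + 2), ENNReal.ofReal (Real.exp (-θ * x))
            * ENNReal.ofReal (g t) := by rw [lintegral_mul_const _ (by fun_prop)]
      _ ≤ ∫⁻ x in Icc (t + 1) (t + 2), ENNReal.ofReal (Real.exp (-θ * x))
            * ENNReal.ofReal (g x) := by
          refine setLIntegral_mono' measurableSet_Icc fun x hx => ?_
          gcongr
          exact hg (by linarith [hx.1])
      _ ≤ I := lintegral_mono_set fun x hx => by
          rw [mem_Ioi]; linarith [hx.1]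
  rw [← ENNReal.ofReal_mul (by positivity), ENNReal.ofReal_le_iff_le_toReal hi.ne] at h1
  have h2 : Real.exp (-(2 * |θ|)) * Real.exp (2 * |θ|) = 1 := by
    rw [← Real.exp_add]; simp
  have h3 : Real.exp (-θ * t) * Real.exp (θ * t) = 1 := by
    rw [← Real.exp_add]; simp
  calc g t = Real.exp (-(2 * |θ|)) * Real.exp (-θ * t) * g t
        * (Real.exp (2 * |θ|) * Real.exp (θ * t)) := by
        linear_combination (-g t) * h3 - g t * (Real.exp (-θ * t) * Real.exp (θ * t)) * h2
    _ ≤ I.toReal * (Real.exp (2 * |θ|) * Real.exp (θ * t)) := by gcongr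
    _ = _ := by ring

/-- The measure is the Stieltjes measure of the right-continuous version `G`. By
`lintegral_exp_window` and Tonelli, `∫ e^{-θs} ν(ds)` is at most a constant times `∫ e^{-θx} G(x -
1) dx`, and `G(x - 1) ≤ g x`. -/
theorem exists_isExpBounded_of_monotone {g : ℝ → ℝ} {θ : ℝ} (hg : Monotone g)
    (h0 : ∀ x < 0, g x = 0)
    (hi : ∫⁻ x in Ioi (0 : ℝ), ENNReal.ofReal (Real.exp (-θ * x)) * ENNReal.ofReal (g x) < ∞) :
    ∃ ν : Measure ℝ, IsExpBounded θ ν ∧ ∀ x, ν.real (Iic x) = Function.rightLim g x := by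
  obtain ⟨K, hK0, hK⟩ := exists_le_exp_of_lintegral hg h0 hi
  set G := hg.stieltjesFunction with hG
  have hGr : ∀ x, G x = Function.rightLim g x := hg.stieltjesFunction_eq
  have hle : ∀ {x y}, x < y → G x ≤ g y := fun h => by
    rw [hGr]; exact hg.rightLim_le h
  have hge : ∀ x, g x ≤ G x := fun x => by rw [hGr]; exact hg.le_rightLim le_rfl
  have hG0 : ∀ x < 0, G x = 0 := fun x hx => by
    have h1 := hle (show x < x / 2 by linarith)
    have h2 := hge x
    rw [h0 _ (by linarith)] at h1
    rw [h0 x hx] at h2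
    exact le_antisymm h1 h2
  have hGnn : ∀ x, 0 ≤ G x := fun x => by
    rcases lt_or_ge x 0 with hx | hx
    · exact (hG0 x hx).ge
    · have := G.mono (show (-1 : ℝ) ≤ x by linarith)
      rwa [hG0 _ (by norm_num)] at this
  have hlim : Tendsto G atBot (𝓝 0) := by
    refine tendsto_const_nhds.congr' ?_
    filter_upwards [eventually_lt_atBot 0] with x hx
    exact (hG0 x hx).symm
  have hIic : ∀ x, G.measure (Iic x) = ENNReal.ofReal (G x) := fun x => by
    rw [G.measure_Iic hlim, sub_zero]
  have hIio : G.measure (Iio 0) = 0 := by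
    rw [G.measure_Iio hlim, sub_zero]
    have : Function.leftLim G 0 ≤ 0 := by
      have h1 : Tendsto G (𝓝[<] 0) (𝓝 (Function.leftLim G 0)) := G.mono.tendsto_leftLim 0
      refine le_of_tendsto h1 ?_
      filter_upwards [self_mem_nhdsWithin] with x hx
      exact (hG0 x hx).le
    rw [ENNReal.ofReal_eq_zero]
    exact this
  refine ⟨G.measure, ⟨inferInstance, hIio, fun x => by rw [hIic]; exact ENNReal.ofReal_lt_top,
    ⟨by fun_prop, ?_⟩, ⟨K * Real.exp θ, fun x => ?_⟩⟩, fun x => ?_⟩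
  · rw [hasFiniteIntegral_iff_ofReal (Eventually.of_forall fun x => Real.exp_nonneg _)]
    set E : ℝ × ℝ → ℝ≥0∞ := fun q =>
      {q : ℝ × ℝ | q.1 ≤ q.2 - 1}.indicator (fun q => ENNReal.ofReal (Real.exp (-θ * q.2))) q
      with hE
    have hEm : Measurable E := by
      refine Measurable.indicator (by fun_prop) ?_
      exact measurableSet_le measurable_fst (by fun_prop)
    have h1 : ∀ᵐ s ∂G.measure, ENNReal.ofReal (Real.exp (-θ * s)) ≤
        ENNReal.ofReal (Real.exp (2 * |θ|)) * ∫⁻ x in Ioi (0 : ℝ), E (s, x) := by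
      have h2 : ∀ᵐ s ∂G.measure, 0 ≤ s := by
        rw [ae_iff]
        convert hIio using 2
        ext x
        simp
      filter_upwards [h2] with s hs
      have h3 : ENNReal.ofReal (Real.exp (-(2 * |θ|)) * Real.exp (-θ * s))
          ≤ ∫⁻ x in Ioi (0 : ℝ), E (s, x) := by
        refine (lintegral_exp_window θ s).trans ?_
        calc _ = ∫⁻ x in Icc (s + 1) (s + 2), E (s, x) := by
              refine setLIntegral_congr_fun measurableSet_Icc fun x hx => ?_
              have : (s, x) ∈ {q : ℝ × ℝ | q.1 ≤ q.2 - 1} := by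
                change s ≤ x - 1
                linarith [hx.1]
              simp only [hE]
              rw [indicator_of_mem this]
          _ ≤ _ := lintegral_mono_set fun x hx => by
              rw [mem_Ioi]; linarith [hx.1]
      calc ENNReal.ofReal (Real.exp (-θ * s))
          = ENNReal.ofReal (Real.exp (2 * |θ|)) *
            ENNReal.ofReal (Real.exp (-(2 * |θ|)) * Real.exp (-θ * s)) := by
            rw [← ENNReal.ofReal_mul (by positivity), ← mul_assoc, ← Real.exp_add, add_neg_cancel,
              Real.exp_zero, one_mul]
        _ ≤ _ := by gcongr
    calc ∫⁻ s, ENNReal.ofReal (Real.exp (-θ * s)) ∂G.measure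
        ≤ ∫⁻ s, (ENNReal.ofReal (Real.exp (2 * |θ|)) * ∫⁻ x in Ioi (0 : ℝ), E (s, x)) ∂G.measure :=
          lintegral_mono_ae h1
      _ = ENNReal.ofReal (Real.exp (2 * |θ|)) *
          ∫⁻ x in Ioi (0 : ℝ), ∫⁻ s, E (s, x) ∂G.measure := by
          rw [lintegral_const_mul _ (Measurable.lintegral_prod_right' hEm),
            lintegral_lintegral_swap hEm.aemeasurable]
      _ ≤ ENNReal.ofReal (Real.exp (2 * |θ|)) * ∫⁻ x in Ioi (0 : ℝ),
          ENNReal.ofReal (Real.exp (-θ * x)) * ENNReal.ofReal (g x) := by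
          gcongr with x
          have h4 : ∀ s, E (s, x)
              = (Iic (x - 1)).indicator (fun _ => ENNReal.ofReal (Real.exp (-θ * x))) s := by
            intro s
            simp only [hE, indicator, mem_ofPred_eq, mem_Iic]
          simp only [h4]
          rw [lintegral_indicator measurableSet_Iic, setLIntegral_const, hIic]
          gcongr
          exact hle (by linarith)
      _ < ∞ := ENNReal.mul_lt_top ENNReal.ofReal_lt_top hi
  · rw [Measure.real, hIic, ENNReal.toReal_ofReal (hGnn x)]
    calc G x ≤ g (x + 1) := hle (by linarith)
      _ ≤ K * Real.exp (θ * (x + 1)) := hK _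
      _ = _ := by rw [mul_add, mul_one, Real.exp_add]; ring
  · rw [Measure.real, hIic, ENNReal.toReal_ofReal (hGnn x), hGr]

/-- Superadditivity of the variation over adjacent intervals; it makes both `V` and `V - f`
monotone. -/
theorem eVariationOn_Iic_add_edist_le (f : ℝ → ℝ) {x y : ℝ} (hxy : x ≤ y) :
    totalVar f x + edist (f y) (f x) ≤ totalVar f y := by
  have h1 : edist (f y) (f x) ≤ eVariationOn f (Icc x y) :=
    eVariationOn.edist_le f ⟨hxy, le_rfl⟩ ⟨le_rfl, hxy⟩
  have h2 := eVariationOn.add_le_union f (s := Iic x) (t := Icc x y)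
    fun a ha b hb => le_trans ha hb.1
  rw [Iic_union_Icc_eq_Iic hxy] at h2
  exact (add_le_add le_rfl h1).trans h2

/-- A right-continuous function of exponentially integrable variation is the difference of two
distribution functions. -/
theorem exists_isExpBounded_sub {f : ℝ → ℝ} {θ : ℝ}
    (hf : ∀ x, ContinuousWithinAt f (Ici x) x) (h0 : ∀ x < 0, f x = 0)
    (hV : ∫⁻ x in Ioi (0 : ℝ), ENNReal.ofReal (Real.exp (-θ * x)) * totalVar f x < ∞) :
    ∃ ν₁ ν₂ : Measure ℝ, IsExpBounded θ ν₁ ∧ IsExpBounded θ ν₂ ∧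
      ∀ x, f x = ν₁.real (Iic x) - ν₂.real (Iic x) := by
  have hmono : Monotone (totalVar f) := fun x y hxy => eVariationOn.mono f (Iic_subset_Iic.2 hxy)
  -- Integrability gives finiteness almost everywhere, hence at points beyond any `x`, and
  -- monotonicity carries it back.
  have hfin : ∀ x, totalVar f x < ∞ := by
    intro x
    have h1 : ∀ᵐ y ∂(volume.restrict (Ioi (0 : ℝ))),
        ENNReal.ofReal (Real.exp (-θ * y)) * totalVar f y < ∞ :=
      ae_lt_top (Measurable.mul (by fun_prop) hmono.measurable) hV.ne
    have h2 : ∀ᵐ y ∂(volume.restrict (Ioi (max x 0))),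
        ENNReal.ofReal (Real.exp (-θ * y)) * totalVar f y < ∞ :=
      ae_restrict_of_ae_restrict_of_subset (Ioi_subset_Ioi (le_max_right _ _)) h1
    have h3 : (volume.restrict (Ioi (max x 0))) ≠ (0 : Measure ℝ) := by
      rw [Ne, Measure.restrict_eq_zero]
      simp
    have : (ae (volume.restrict (Ioi (max x 0)))).NeBot := ae_neBot.2 h3
    obtain ⟨y, hy, hxy⟩ := (h2.and (ae_restrict_mem measurableSet_Ioi)).exists
    have hxy' : x ≤ y := (le_max_left x 0).trans (le_of_lt hxy)
    refine (hmono hxy').trans_lt ?_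
    by_contra h4
    rw [not_lt, top_le_iff] at h4
    rw [h4, ENNReal.mul_top (by simp [Real.exp_pos])] at hy
    exact lt_irrefl _ hy
  set V : ℝ → ℝ := fun x => (totalVar f x).toReal with hVdef
  have hVe : ∀ x, ENNReal.ofReal (V x) = totalVar f x := fun x => ENNReal.ofReal_toReal (hfin x).ne
  have hVf : ∀ {x y}, x ≤ y → |f y - f x| ≤ V y - V x := by
    intro x y hxy
    have h1 := eVariationOn_Iic_add_edist_le f hxy
    have h2 := ENNReal.toReal_mono (hfin y).ne h1
    rw [ENNReal.toReal_add (hfin x).ne (edist_ne_top _ _), edist_dist,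
      ENNReal.toReal_ofReal dist_nonneg, Real.dist_eq] at h2
    simp only [hVdef]
    linarith
  have hV0 : ∀ x < 0, V x = 0 := by
    intro x hx
    have : totalVar f x = 0 := by
      refine eVariationOn.constant_on ?_
      rintro _ ⟨a, ha, rfl⟩ _ ⟨b, hb, rfl⟩
      rw [h0 a (lt_of_le_of_lt ha hx), h0 b (lt_of_le_of_lt hb hx)]
    simp only [hVdef, this, ENNReal.toReal_zero]
  have hVm : Monotone V := fun x y hxy => by
    linarith [hVf hxy, abs_nonneg (f y - f x)]
  have hWm : Monotone fun x => V x - f x := fun x y hxy => by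
    have := hVf hxy
    have := le_abs_self (f y - f x)
    simp only
    linarith
  -- As `f` and `V` vanish on the negative axis, `|f| ≤ V`; thus `V - f` inherits the exponential
  -- integrability.
  have hW2 : ∀ x, V x - f x ≤ 2 * V x := by
    intro x
    have h1 := hVf (show min x (-1) ≤ x from min_le_left _ _)
    have h2 : min x (-1 : ℝ) < 0 := lt_of_le_of_lt (min_le_right _ _) (by norm_num)
    rw [hV0 _ h2, h0 _ h2, sub_zero, sub_zero] at h1
    linarith [neg_abs_le (f x)]
  have hiV : ∫⁻ x in Ioi (0 : ℝ), ENNReal.ofReal (Real.exp (-θ * x)) * ENNReal.ofReal (V x) < ∞ := by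
    simpa only [hVe] using hV
  have hiW : ∫⁻ x in Ioi (0 : ℝ),
      ENNReal.ofReal (Real.exp (-θ * x)) * ENNReal.ofReal (V x - f x) < ∞ := by
    calc _ ≤ ∫⁻ x in Ioi (0 : ℝ),
          2 * (ENNReal.ofReal (Real.exp (-θ * x)) * ENNReal.ofReal (V x)) := by
          refine lintegral_mono fun x => ?_
          rw [mul_left_comm]
          gcongr
          calc ENNReal.ofReal (V x - f x) ≤ ENNReal.ofReal (2 * V x) :=
                ENNReal.ofReal_le_ofReal (hW2 x)
            _ = _ := by rw [ENNReal.ofReal_mul (by norm_num)]; norm_num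
      _ = 2 * ∫⁻ x in Ioi (0 : ℝ), ENNReal.ofReal (Real.exp (-θ * x)) * ENNReal.ofReal (V x) := by
          rw [lintegral_const_mul' _ _ (by norm_num)]
      _ < ∞ := ENNReal.mul_lt_top (by norm_num) hiV
  obtain ⟨ν₁, hν₁, h₁⟩ := exists_isExpBounded_of_monotone hVm hV0 hiV
  obtain ⟨ν₂, hν₂, h₂⟩ := exists_isExpBounded_of_monotone hWm
    (fun x hx => by rw [hV0 x hx, h0 x hx, sub_zero]) hiW
  refine ⟨ν₁, ν₂, hν₁, hν₂, fun x => ?_⟩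
  rw [h₁, h₂]
  -- The measures carry the right limits of `V` and `V - f`; their difference is the right limit of
  -- `f`, which is `f x`.
  have l1 := (hVm.tendsto_rightLim x).sub (hWm.tendsto_rightLim x)
  simp only [sub_sub_cancel] at l1
  exact tendsto_nhds_unique ((hf x).mono_left (nhdsWithin_mono x Ioi_subset_Ici_self)) l1

end MarkovRenewal

/-! ### Convolution with distribution functions. -/

namespace MarkovRenewal

theorem real_Iic_eq_real_Icc {ν : Measure ℝ} (h : ν (Iio 0) = 0) (x : ℝ) :
    ν.real (Iic x) = ν.real (Icc 0 x) := by
  refine measureReal_congr ?_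
  have h1 : ∀ᵐ y ∂ν, 0 ≤ y := by
    rw [ae_iff]
    convert h using 2
    ext y
    simp
  filter_upwards [h1] with y hy
  exact propext ⟨fun h => ⟨hy, h⟩, fun h => h.2⟩

theorem measurable_real_Iic_sub {ν : Measure ℝ} (h : ∀ x, ν (Iic x) < ∞) (t : ℝ) :
    Measurable fun x => ν.real (Iic (t - x)) := by
  have : Antitone fun x => ν.real (Iic (t - x)) := fun x y hxy =>
    measureReal_mono (Iic_subset_Iic.2 (by linarith)) (h _).ne
  exact this.measurable

/-- Symmetry of the convolution of two measures on the line, evaluated on half lines. -/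
theorem integral_real_Iic_sub_comm {ν κ : Measure ℝ} [SFinite ν] [SFinite κ]
    (hν : ∀ x, ν (Iic x) < ∞) (hκ : ∀ x, κ (Iic x) < ∞) (t : ℝ) :
    ∫ x, ν.real (Iic (t - x)) ∂κ = ∫ s, κ.real (Iic (t - s)) ∂ν := by
  have hm : MeasurableSet {q : ℝ × ℝ | q.1 + q.2 ≤ t} :=
    measurableSet_le (by fun_prop) measurable_const
  have hmν : Measurable fun x => ν (Iic (t - x)) := by
    have : Antitone fun x => ν (Iic (t - x)) := fun x y hxy =>
      measure_mono (Iic_subset_Iic.2 (by linarith))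
    exact this.measurable
  have hmκ : Measurable fun x => κ (Iic (t - x)) := by
    have : Antitone fun x => κ (Iic (t - x)) := fun x y hxy =>
      measure_mono (Iic_subset_Iic.2 (by linarith))
    exact this.measurable
  simp only [Measure.real]
  rw [integral_toReal hmν.aemeasurable (Eventually.of_forall fun x => hν _),
    integral_toReal hmκ.aemeasurable (Eventually.of_forall fun x => hκ _)]
  congr 1
  -- Both integrals compute the product measure of the half plane `q.1 + q.2 ≤ t`, sliced in the two
  -- directions.
  have h1 := Measure.prod_apply (μ := κ) (ν := ν) hm
  have h2 := Measure.prod_apply_symm (μ := κ) (ν := ν) hm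
  have h3 : ∀ x, Prod.mk x ⁻¹' {q : ℝ × ℝ | q.1 + q.2 ≤ t} = Iic (t - x) := by
    intro x
    ext y
    change x + y ≤ t ↔ y ≤ t - x
    constructor <;> intro h <;> linarith
  have h4 : ∀ y, (fun x => (x, y)) ⁻¹' {q : ℝ × ℝ | q.1 + q.2 ≤ t} = Iic (t - y) := by
    intro y
    ext x
    change x + y ≤ t ↔ x ≤ t - y
    constructor <;> intro h <;> linarith
  simp only [h3] at h1
  simp only [h4] at h2
  rw [← h1, ← h2]

theorem integrable_real_Iic_sub {ν κ : Measure ℝ} (hν : ∀ x, ν (Iic x) < ∞)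
    (hν0 : ν (Iio 0) = 0) (hκ0 : κ (Iio 0) = 0) (hκ : ∀ x, κ (Iic x) < ∞) (t : ℝ) :
    Integrable (fun x => ν.real (Iic (t - x))) κ := by
  have h1 : ∀ᵐ x ∂κ, 0 ≤ x := by
    rw [ae_iff]
    convert hκ0 using 2
    ext x
    simp
  have h2 : Integrable ((Iic t).indicator fun _ => ν.real (Iic t)) κ := by
    rw [integrable_indicator_iff measurableSet_Iic]
    exact integrableOn_const (hκ t).ne
  refine h2.mono' (measurable_real_Iic_sub hν t).aestronglyMeasurable ?_
  filter_upwards [h1] with x hx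
  rw [Real.norm_of_nonneg measureReal_nonneg]
  by_cases hxt : x ∈ Iic t
  · rw [indicator_of_mem hxt]
    exact measureReal_mono (Iic_subset_Iic.2 (by linarith)) (hν _).ne
  · rw [indicator_of_notMem hxt, Measure.real, measure_mono_null _ hν0, ENNReal.toReal_zero]
    intro y hy
    have h3 : t < x := not_le.1 hxt
    have h4 : y ≤ t - x := hy
    change y < 0
    linarith

/-- Integration by parts for distribution functions. -/
theorem integral_real_Iic_mul_deriv {ν : Measure ℝ} [IsLocallyFiniteMeasure ν]
    (hν0 : ν (Iio 0) = 0) {m m' : ℝ → ℂ} (hm : ∀ t, HasDerivAt m (m' t) t) (hm' : Continuous m')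
    {t : ℝ} (ht : 0 ≤ t) :
    ∫ x in (0 : ℝ)..t, (ν.real (Iic x) : ℂ) * m' (t - x)
      = ∫ s in Icc 0 t, (m (t - s) - m 0) ∂ν := by
  -- Both sides integrate `m'(t - x)` over the triangle `0 ≤ s ≤ x ≤ t`; the inner integral in `x`
  -- is evaluated by the fundamental theorem of calculus.
  set f : ℝ × ℝ → ℂ := fun q => {q : ℝ × ℝ | q.2 ≤ q.1}.indicator (fun q => m' (t - q.1)) q with hf
  have hfm : Measurable f :=
    Measurable.indicator (by fun_prop) (measurableSet_le measurable_snd measurable_fst)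
  have hfin : IsFiniteMeasure (ν.restrict (Icc 0 t)) :=
    ⟨by rw [Measure.restrict_apply_univ]; exact isCompact_Icc.measure_lt_top⟩
  obtain ⟨K, hK⟩ := (isCompact_Icc (a := (0 : ℝ)) (b := t)).exists_bound_of_continuousOn
    (f := fun x => m' (t - x)) (by fun_prop)
  have hint : Integrable f ((volume.restrict (Ioc 0 t)).prod (ν.restrict (Icc 0 t))) := by
    refine Integrable.of_bound hfm.aestronglyMeasurable |K| ?_
    have h1 : ∀ᵐ q : ℝ × ℝ ∂((volume.restrict (Ioc 0 t)).prod (ν.restrict (Icc 0 t))),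
        q.1 ∈ Ioc 0 t :=
      Measure.quasiMeasurePreserving_fst.ae (ae_restrict_mem measurableSet_Ioc)
    filter_upwards [h1] with q hq
    refine (norm_indicator_le_norm_self _ _).trans ((hK q.1 ⟨hq.1.le, hq.2⟩).trans (le_abs_self K))
  have h1 : ∀ x ∈ Ioc 0 t, ∫ s in Icc 0 t, f (x, s) ∂ν = (ν.real (Iic x) : ℂ) * m' (t - x) := by
    intro x hx
    have h2 : ∀ s, f (x, s) = (Iic x).indicator (fun _ => m' (t - x)) s := by
      intro s
      simp only [hf, indicator, mem_ofPred_eq, mem_Iic]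
    simp only [h2]
    rw [setIntegral_indicator measurableSet_Iic, setIntegral_const, Complex.real_smul,
      real_Iic_eq_real_Icc hν0]
    congr 3
    ext s
    simp only [mem_inter_iff, mem_Icc, mem_Iic]
    constructor
    · rintro ⟨⟨h3, -⟩, h4⟩
      exact ⟨h3, h4⟩
    · rintro ⟨h3, h4⟩
      exact ⟨⟨h3, h4.trans hx.2⟩, h4⟩
  have h2 : ∀ s ∈ Icc 0 t, ∫ x in Ioc 0 t, f (x, s) = m (t - s) - m 0 := by
    intro s hs
    have h3 : ∀ x, f (x, s) = (Ici s).indicator (fun x => m' (t - x)) x := by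
      intro x
      simp only [hf, indicator, mem_ofPred_eq, mem_Ici]
    simp only [h3]
    rw [← integral_Icc_eq_integral_Ioc, setIntegral_indicator measurableSet_Ici]
    have h4 : Icc 0 t ∩ Ici s = Icc s t := by
      ext x
      simp only [mem_inter_iff, mem_Icc, mem_Ici]
      constructor
      · rintro ⟨⟨-, h5⟩, h6⟩
        exact ⟨h6, h5⟩
      · rintro ⟨h5, h6⟩
        exact ⟨⟨hs.1.trans h5, h6⟩, h5⟩
    rw [h4, integral_Icc_eq_integral_Ioc, ← intervalIntegral.integral_of_le hs.2,
      intervalIntegral.integral_comp_sub_left (fun x => m' x) t,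
      intervalIntegral.integral_eq_sub_of_hasDerivAt (fun x _ => hm x)
        (hm'.intervalIntegrable _ _), sub_self]
  rw [intervalIntegral.integral_of_le ht, ← setIntegral_congr_fun measurableSet_Ioc h1,
    integral_integral_swap hint]
  exact setIntegral_congr_fun measurableSet_Icc h2

/-- The convolution with a distribution function inherits an asymptotic expansion. -/
theorem exists_norm_integral_sub_le {κ ν : Measure ℝ} [SFinite κ] (hκ0 : κ (Iio 0) = 0)
    (hκ : ∀ x, κ (Iic x) < ∞) {θ : ℝ} (hν : IsExpBounded θ ν) {m m' : ℝ → ℂ}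
    (hm : ∀ t, HasDerivAt m (m' t) t) (hm' : Continuous m') {K : ℝ}
    (hK : ∀ t, 0 ≤ t → ‖(κ.real (Icc 0 t) : ℂ) - m t‖ ≤ K * Real.exp (θ * t)) :
    ∃ K', ∀ t, 0 ≤ t → ‖((∫ x, ν.real (Iic (t - x)) ∂κ : ℝ) : ℂ)
      - ∫ x in (0 : ℝ)..t, (ν.real (Iic x) : ℂ) * m' (t - x)‖ ≤ K' * Real.exp (θ * t) := by
  have := hν.locallyFinite
  obtain ⟨A, hA⟩ := hν.exists_bound
  set J := ∫ s, Real.exp (-θ * s) ∂ν with hJ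
  -- `K * J` pays for replacing the distribution function of `κ` by `m`, as `e^{θ(t-s)}` is
  -- integrated against `ν`; `‖m 0‖ * A` pays for the boundary term of the integration by parts.
  refine ⟨K * J + ‖m 0‖ * A, fun t ht => ?_⟩
  have hmc : Continuous m := continuous_iff_continuousAt.2 fun t => (hm t).continuousAt
  have hfin : IsFiniteMeasure (ν.restrict (Icc 0 t)) :=
    ⟨by rw [Measure.restrict_apply_univ]; exact isCompact_Icc.measure_lt_top⟩
  have h1 : ∫ s, κ.real (Iic (t - s)) ∂ν = ∫ s in Icc 0 t, κ.real (Icc 0 (t - s)) ∂ν := by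
    have h2 : ∀ s, κ.real (Icc 0 (t - s)) = κ.real (Iic (t - s)) := fun s =>
      (real_Iic_eq_real_Icc hκ0 _).symm
    simp only [h2]
    refine (setIntegral_eq_integral_of_ae_compl_eq_zero ?_).symm
    have h3 : ∀ᵐ y ∂ν, 0 ≤ y := by
      rw [ae_iff]
      convert hν.measure_Iio using 2
      ext y
      simp
    filter_upwards [h3] with s hs hsn
    have h4 : t < s := by
      by_contra h
      exact hsn ⟨hs, not_lt.1 h⟩
    rw [Measure.real, measure_mono_null _ hκ0, ENNReal.toReal_zero]
    intro y hy
    have h5 : y ≤ t - s := hy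
    change y < 0
    linarith
  have hi1 : Integrable (fun s => κ.real (Icc 0 (t - s))) (ν.restrict (Icc 0 t)) := by
    have h2 := (integrable_real_Iic_sub hκ hκ0 hν.measure_Iio hν.measure_Iic_lt_top t).restrict
      (s := Icc 0 t)
    refine h2.congr (Eventually.of_forall fun s => ?_)
    exact real_Iic_eq_real_Icc hκ0 _
  have hi1' : Integrable (fun s => ((κ.real (Icc 0 (t - s)) : ℝ) : ℂ)) (ν.restrict (Icc 0 t)) :=
    hi1.ofReal
  have hi2 : Integrable (fun s => m (t - s)) (ν.restrict (Icc 0 t)) :=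
    ContinuousOn.integrableOn_compact isCompact_Icc (by fun_prop)
  have hi3 : Integrable (fun s => m (t - s) - m 0) (ν.restrict (Icc 0 t)) :=
    hi2.sub (integrable_const _)
  rw [integral_real_Iic_sub_comm hν.measure_Iic_lt_top hκ, h1,
    integral_real_Iic_mul_deriv hν.measure_Iio hm hm' ht, ← integral_complex_ofReal,
    ← integral_sub hi1' hi3]
  have h2 : ∫ s in Icc 0 t, ((κ.real (Icc 0 (t - s)) : ℂ) - (m (t - s) - m 0)) ∂ν
      = (∫ s in Icc 0 t, ((κ.real (Icc 0 (t - s)) : ℂ) - m (t - s)) ∂ν)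
        + ν.real (Icc 0 t) * m 0 := by
    have h3 : ∀ s, ((κ.real (Icc 0 (t - s)) : ℂ) - (m (t - s) - m 0))
        = ((κ.real (Icc 0 (t - s)) : ℂ) - m (t - s)) + m 0 := fun s => by ring
    simp only [h3]
    have hi4 : Integrable (fun s => ((κ.real (Icc 0 (t - s)) : ℝ) : ℂ) - m (t - s))
        (ν.restrict (Icc 0 t)) := hi1'.sub hi2
    rw [integral_add hi4 (integrable_const _), setIntegral_const,
      Complex.real_smul]
  rw [h2, add_mul]
  refine (norm_add_le _ _).trans (add_le_add ?_ ?_)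
  · have h3 : ∀ s ∈ Icc 0 t, ‖(κ.real (Icc 0 (t - s)) : ℂ) - m (t - s)‖
        ≤ K * Real.exp (θ * t) * Real.exp (-θ * s) := by
      intro s hs
      refine (hK _ (by linarith [hs.2])).trans_eq ?_
      rw [mul_assoc, ← Real.exp_add]
      congr 2
      ring
    have hK0 : 0 ≤ K := by
      have := (norm_nonneg _).trans (hK 0 le_rfl)
      simpa using this
    calc _ ≤ ∫ s in Icc 0 t, K * Real.exp (θ * t) * Real.exp (-θ * s) ∂ν := by
          refine norm_integral_le_of_norm_le (hν.integrable.restrict.const_mul _) ?_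
          filter_upwards [ae_restrict_mem measurableSet_Icc] with s hs
          exact h3 s hs
      _ ≤ ∫ s, K * Real.exp (θ * t) * Real.exp (-θ * s) ∂ν :=
          setIntegral_le_integral (hν.integrable.const_mul _)
            (Eventually.of_forall fun s => by positivity)
      _ = K * J * Real.exp (θ * t) := by rw [integral_const_mul]; ring
  · rw [norm_mul, Complex.norm_real, Real.norm_of_nonneg measureReal_nonneg,
      ← real_Iic_eq_real_Icc hν.measure_Iio]
    calc ν.real (Iic t) * ‖m 0‖ ≤ A * Real.exp (θ * t) * ‖m 0‖ := by gcongr; exact hA t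
      _ = _ := by ring

/-- A difference of two exponentially bounded distribution functions. -/
structure IsExpBoundedVariation (θ : ℝ) (f : ℝ → ℝ) : Prop where
  exists_sub : ∃ ν₁ ν₂ : Measure ℝ, IsExpBounded θ ν₁ ∧ IsExpBounded θ ν₂ ∧
      ∀ x, f x = ν₁.real (Iic x) - ν₂.real (Iic x)

namespace IsExpBoundedVariation

variable {θ : ℝ} {f : ℝ → ℝ}

theorem measurable (hf : IsExpBoundedVariation θ f) : Measurable f := by
  obtain ⟨ν₁, ν₂, h₁, h₂, h⟩ := hf.exists_sub
  have hmono : ∀ ν : Measure ℝ, IsExpBounded θ ν → Measurable fun x => ν.real (Iic x) := by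
    intro ν hν
    have : Monotone fun x => ν.real (Iic x) := fun x y hxy =>
      measureReal_mono (Iic_subset_Iic.2 hxy) (hν.measure_Iic_lt_top _).ne
    exact this.measurable
  rw [funext h]
  exact (hmono ν₁ h₁).sub (hmono ν₂ h₂)

theorem exists_bound (hf : IsExpBoundedVariation θ f) :
    ∃ K, 0 ≤ K ∧ ∀ x, |f x| ≤ K * Real.exp (θ * x) := by
  obtain ⟨ν₁, ν₂, h₁, h₂, h⟩ := hf.exists_sub
  obtain ⟨A, hA⟩ := h₁.exists_bound
  obtain ⟨B, hB⟩ := h₂.exists_bound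
  have hA0 := (measureReal_nonneg (μ := ν₁) (s := Iic 0)).trans (hA 0)
  have hB0 := (measureReal_nonneg (μ := ν₂) (s := Iic 0)).trans (hB 0)
  simp only [mul_zero, Real.exp_zero, mul_one] at hA0 hB0
  refine ⟨A + B, by linarith, fun x => ?_⟩
  rw [h, add_mul, abs_le]
  have h3 := hA x
  have h4 := hB x
  have h5 := measureReal_nonneg (μ := ν₁) (s := Iic x)
  have h6 := measureReal_nonneg (μ := ν₂) (s := Iic x)
  constructor <;> linarith

theorem integrable_comp_sub (hf : IsExpBoundedVariation θ f) {κ : Measure ℝ}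
    (hκ0 : κ (Iio 0) = 0) (hκ : ∀ x, κ (Iic x) < ∞) (t : ℝ) :
    Integrable (fun x => f (t - x)) κ := by
  obtain ⟨ν₁, ν₂, h₁, h₂, h⟩ := hf.exists_sub
  simp only [h]
  exact (integrable_real_Iic_sub h₁.measure_Iic_lt_top h₁.measure_Iio hκ0 hκ t).sub
    (integrable_real_Iic_sub h₂.measure_Iic_lt_top h₂.measure_Iio hκ0 hκ t)

theorem intervalIntegrable_mul (hf : IsExpBoundedVariation θ f) {g : ℝ → ℂ} (hg : Continuous g)
    (a b : ℝ) : IntervalIntegrable (fun x => (f x : ℂ) * g x) volume a b := by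
  obtain ⟨ν₁, ν₂, h₁, h₂, h⟩ := hf.exists_sub
  have hmono : ∀ ν : Measure ℝ, IsExpBounded θ ν →
      IntervalIntegrable (fun x => ν.real (Iic x)) volume a b := by
    intro ν hν
    have : Monotone fun x => ν.real (Iic x) := fun x y hxy =>
      measureReal_mono (Iic_subset_Iic.2 hxy) (hν.measure_Iic_lt_top _).ne
    exact this.intervalIntegrable
  have h3 : IntervalIntegrable f volume a b := by
    rw [funext h]
    exact (hmono ν₁ h₁).sub (hmono ν₂ h₂)
  have h4 : IntervalIntegrable (fun x => (f x : ℂ)) volume a b := ⟨h3.1.ofReal, h3.2.ofReal⟩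
  exact h4.mul_continuousOn hg.continuousOn

theorem exists_norm_convolution_sub_le (hf : IsExpBoundedVariation θ f) {κ : Measure ℝ} [SFinite κ]
    (hκ0 : κ (Iio 0) = 0) (hκ : ∀ x, κ (Iic x) < ∞) {m m' : ℝ → ℂ}
    (hm : ∀ t, HasDerivAt m (m' t) t) (hm' : Continuous m') {K : ℝ}
    (hK : ∀ t, 0 ≤ t → ‖(κ.real (Icc 0 t) : ℂ) - m t‖ ≤ K * Real.exp (θ * t)) :
    ∃ K', ∀ t, 0 ≤ t → ‖((∫ x, f (t - x) ∂κ : ℝ) : ℂ)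
      - ∫ x in (0 : ℝ)..t, (f x : ℂ) * m' (t - x)‖ ≤ K' * Real.exp (θ * t) := by
  obtain ⟨ν₁, ν₂, h₁, h₂, h⟩ := hf.exists_sub
  obtain ⟨A, hA⟩ := exists_norm_integral_sub_le hκ0 hκ h₁ hm hm' hK
  obtain ⟨B, hB⟩ := exists_norm_integral_sub_le hκ0 hκ h₂ hm hm' hK
  refine ⟨A + B, fun t ht => ?_⟩
  have hmono : ∀ ν : Measure ℝ, IsExpBounded θ ν →
      IntervalIntegrable (fun x => (ν.real (Iic x) : ℂ) * m' (t - x)) volume 0 t := by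
    intro ν hν
    have h1 : Monotone fun x => ν.real (Iic x) := fun x y hxy =>
      measureReal_mono (Iic_subset_Iic.2 hxy) (hν.measure_Iic_lt_top _).ne
    have h2 : IntervalIntegrable (fun x => ν.real (Iic x)) volume 0 t := h1.intervalIntegrable
    have h3 : IntervalIntegrable (fun x => (ν.real (Iic x) : ℂ)) volume 0 t :=
      ⟨h2.1.ofReal, h2.2.ofReal⟩
    exact h3.mul_continuousOn (by fun_prop)
  simp only [h, Complex.ofReal_sub, sub_mul]
  rw [integral_sub (integrable_real_Iic_sub h₁.measure_Iic_lt_top h₁.measure_Iio hκ0 hκ t)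
    (integrable_real_Iic_sub h₂.measure_Iic_lt_top h₂.measure_Iio hκ0 hκ t),
    intervalIntegral.integral_sub (hmono ν₁ h₁) (hmono ν₂ h₂), Complex.ofReal_sub, sub_sub_sub_comm,
    add_mul]
  exact (norm_sub_le _ _).trans (add_le_add (hA t ht) (hB t ht))

end IsExpBoundedVariation

end MarkovRenewal

/-! ### Exponential polynomials, their derivatives, and tail integrals. -/

namespace MarkovRenewal

section ExpPoly

variable (Λ : Finset ℂ) (n : ℂ → ℕ) (c : ℂ → ℕ → ℂ)

/-- An exponential polynomial, with an additional monomial at the exponent `0`. -/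
noncomputable def expPoly (t : ℝ) : ℂ :=
  (∑ z ∈ Λ, Complex.exp (z * t) * ∑ k ∈ Finset.range (n z), (t : ℂ) ^ k * c z k)
    + (t : ℂ) ^ n 0 * c 0 (n 0)

variable {Λ n c}

/-- The cases for `0`: it is in `Λ` and the monomial extends its range by one; it is added with
order `0`, so that the monomial is constant; or it is absent and its coefficients vanish. -/
theorem expPoly_eq_sum {S : Finset ℂ} {N : ℂ → ℕ} (hN : ∀ w, N w = n w + if w = 0 then 1 else 0)
    (hS : (0 ∈ Λ ∧ S = Λ) ∨ (0 ∉ Λ ∧ S = insert 0 Λ ∧ n 0 = 0) ∨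
      (0 ∉ Λ ∧ S = Λ ∧ ∀ k, c 0 k = 0)) (t : ℝ) :
    expPoly Λ n c t
      = ∑ w ∈ S, ∑ k ∈ Finset.range (N w), c w k * ((t : ℂ) ^ k * Complex.exp (w * t)) := by
  have h1 : ∀ w, ∑ k ∈ Finset.range (n w), c w k * ((t : ℂ) ^ k * Complex.exp (w * t))
      = Complex.exp (w * t) * ∑ k ∈ Finset.range (n w), (t : ℂ) ^ k * c w k := by
    intro w
    rw [Finset.mul_sum]
    exact Finset.sum_congr rfl fun k _ => by ring
  have h2 : ∀ w, ∑ k ∈ Finset.range (N w), c w k * ((t : ℂ) ^ k * Complex.exp (w * t))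
      = (Complex.exp (w * t) * ∑ k ∈ Finset.range (n w), (t : ℂ) ^ k * c w k)
        + if w = 0 then (t : ℂ) ^ n 0 * c 0 (n 0) else 0 := by
    intro w
    rw [hN]
    split_ifs with h
    · subst h
      rw [Finset.sum_range_succ, h1]
      simp
      ring
    · rw [add_zero, add_zero, h1]
  simp only [h2, Finset.sum_add_distrib, Finset.sum_ite_eq']
  rw [expPoly]
  rcases hS with ⟨h0, rfl⟩ | ⟨h0, rfl, hn⟩ | ⟨h0, rfl, hc⟩
  · rw [if_pos h0]
  · rw [if_pos (Finset.mem_insert_self _ _), Finset.sum_insert h0, hn]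
    simp
  · rw [if_neg h0, hc]
    simp

/-- An index shift with the top term split off; the truncated exponent at `k = 0` is harmless
because of the factor `k`. -/
theorem sum_range_mul_pow_pred (a : ℕ → ℂ) (m : ℕ) (x : ℂ) :
    ∑ k ∈ Finset.range m, k * x ^ (k - 1) * a k
      = ∑ k ∈ Finset.range m, ((k : ℂ) + 1) * x ^ k * a (k + 1) - m * x ^ (m - 1) * a m := by
  rw [eq_sub_iff_add_eq, ← Finset.sum_range_succ (fun k => (k : ℂ) * x ^ (k - 1) * a k),
    Finset.sum_range_succ']
  simp

/-- This is the source of the formula for `B`. The index shift leaves a top term at each `z`: it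
vanishes for `z ≠ 0` by `ha`, and at `0` the derivative of the extra monomial cancels it. -/
theorem hasDerivAt_expPoly' (ha : ∀ z ∈ Λ, z ≠ 0 → c z (n z) = 0)
    (hb : 0 ∉ Λ → n 0 = 0 ∨ c 0 (n 0) = 0) (t : ℝ) :
    HasDerivAt (expPoly Λ n c) (∑ z ∈ Λ, Complex.exp (z * t) *
      ∑ k ∈ Finset.range (n z), (t : ℂ) ^ k * (((k : ℂ) + 1) * c z (k + 1) + z * c z k)) t := by
  have h1 : HasDerivAt (fun x : ℝ => (x : ℂ)) 1 t := Complex.ofRealCLM.hasDerivAt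
  have hp : ∀ k : ℕ, HasDerivAt (fun x : ℝ => (x : ℂ) ^ k) (k * (t : ℂ) ^ (k - 1)) t := by
    intro k
    refine (h1.fun_pow k).congr_deriv ?_
    ring
  have hz : ∀ z ∈ Λ, HasDerivAt (fun t : ℝ => Complex.exp (z * t) *
      ∑ k ∈ Finset.range (n z), (t : ℂ) ^ k * c z k)
      (Complex.exp (z * t) * z * (∑ k ∈ Finset.range (n z), (t : ℂ) ^ k * c z k)
        + Complex.exp (z * t) * ∑ k ∈ Finset.range (n z), k * (t : ℂ) ^ (k - 1) * c z k) t := by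
    intro z _
    refine ((h1.const_mul z).cexp.mul
      (HasDerivAt.fun_sum fun k _ => (hp k).mul_const (c z k))).congr_deriv ?_
    ring
  have hder := (HasDerivAt.fun_sum hz).add ((hp (n 0)).mul_const (c 0 (n 0)))
  refine hder.congr_deriv ?_
  have h2 : ∑ z ∈ Λ, Complex.exp (z * t) * (n z * (t : ℂ) ^ (n z - 1) * c z (n z))
      = n 0 * (t : ℂ) ^ (n 0 - 1) * c 0 (n 0) := by
    by_cases h0 : 0 ∈ Λ
    · rw [Finset.sum_eq_single_of_mem 0 h0 fun z hz hz0 => by rw [ha z hz hz0]; ring]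
      simp
    · rw [Finset.sum_eq_zero fun z hz => by
        rw [ha z hz (by rintro rfl; exact h0 hz)]; ring]
      rcases hb h0 with h | h <;> simp [h]
  rw [← h2, ← Finset.sum_add_distrib]
  refine Finset.sum_congr rfl fun z _ => ?_
  rw [sum_range_mul_pow_pred]
  have h3 : ∑ k ∈ Finset.range (n z), (t : ℂ) ^ k * (((k : ℂ) + 1) * c z (k + 1) + z * c z k)
      = ∑ k ∈ Finset.range (n z), ((k : ℂ) + 1) * (t : ℂ) ^ k * c z (k + 1)
        + z * ∑ k ∈ Finset.range (n z), (t : ℂ) ^ k * c z k := by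
    rw [Finset.mul_sum, ← Finset.sum_add_distrib]
    exact Finset.sum_congr rfl fun k _ => by ring
  rw [h3]
  ring

end ExpPoly

theorem integrableOn_sub_pow_mul_exp (t : ℝ) (k : ℕ) {w : ℂ} (hw : w.re < 0) :
    IntegrableOn (fun x : ℝ => ((t : ℂ) - x) ^ k * Complex.exp (w * x)) (Ioi 0) := by
  have h1 : ∀ x : ℝ, ((t : ℂ) - x) ^ k * Complex.exp (w * x) = ∑ l ∈ Finset.range (k + 1),
      ((t : ℂ) ^ l * (-1) ^ (k - l) * k.choose l) * ((x : ℂ) ^ (k - l) * Complex.exp (w * x)) := by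
    intro x
    rw [sub_eq_add_neg, add_pow, Finset.sum_mul]
    refine Finset.sum_congr rfl fun l _ => ?_
    rw [neg_pow]
    ring
  simp only [h1]
  exact integrable_finsetSum _ fun l _ => (integrableOn_pow_mul_exp _ hw).const_mul _

namespace IsExpBoundedVariation

variable {θ : ℝ} {f : ℝ → ℝ}

theorem integrableOn_mul_exp (hf : IsExpBoundedVariation θ f) (t : ℝ) (k : ℕ) {z : ℂ}
    (hz : θ < z.re) :
    IntegrableOn (fun x : ℝ => (f x : ℂ) * ((t : ℂ) - x) ^ k * Complex.exp (-z * x)) (Ioi 0) := by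
  obtain ⟨K, hK0, hK⟩ := hf.exists_bound
  have h1 := integrableOn_sub_pow_mul_exp t k (w := θ - z) (by simpa using hz)
  have h2 : Integrable (fun x : ℝ => ((f x : ℂ) * Complex.exp (-θ * x)) *
      (((t : ℂ) - x) ^ k * Complex.exp ((θ - z) * x))) (volume.restrict (Ioi 0)) := by
    refine h1.bdd_mul (c := K) ?_ (Eventually.of_forall fun x => ?_)
    · have := hf.measurable
      exact Measurable.aestronglyMeasurable (by fun_prop)
    · rw [norm_mul, Complex.norm_real, Real.norm_eq_abs]
      have h3 : ‖Complex.exp (-(θ : ℂ) * x)‖ = Real.exp (-θ * x) := by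
        rw [Complex.norm_exp]; simp
      rw [h3]
      calc |f x| * Real.exp (-θ * x) ≤ K * Real.exp (θ * x) * Real.exp (-θ * x) := by
            gcongr; exact hK x
        _ = K := by rw [mul_assoc, ← Real.exp_add]; simp
  refine h2.congr (Eventually.of_forall fun x => ?_)
  have h4 : Complex.exp (-z * x) = Complex.exp (-θ * x) * Complex.exp ((θ - z) * x) := by
    rw [← Complex.exp_add]; ring_nf
  simp only [h4]
  ring

/-- On `x > t` one has `|f x| ≤ K e^{θx}`, and `(x - t)^k` is absorbed at rate `ε`, half the gap `Re
z - θ`. Since the power is centred at `t`, no polynomial factor is lost: `Re z - 2ε = θ`. -/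
theorem exists_norm_tail_le (hf : IsExpBoundedVariation θ f) (k : ℕ) {z : ℂ} (hz : θ < z.re) :
    ∃ K, ∀ t : ℝ, 0 ≤ t → ‖Complex.exp (z * t) * ((∫ x in Ioi (0 : ℝ),
        (f x : ℂ) * ((t : ℂ) - x) ^ k * Complex.exp (-z * x))
      - ∫ x in (0 : ℝ)..t, (f x : ℂ) * ((t : ℂ) - x) ^ k * Complex.exp (-z * x))‖
      ≤ K * Real.exp (θ * t) := by
  obtain ⟨K, hK0, hK⟩ := hf.exists_bound
  set ε := (z.re - θ) / 2 with hε
  have hε0 : 0 < ε := by rw [hε]; linarith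
  refine ⟨K * (k.factorial / ε ^ k) / ε, fun t ht => ?_⟩
  have hint := hf.integrableOn_mul_exp t k hz
  have h1 : (∫ x in Ioi (0 : ℝ), (f x : ℂ) * ((t : ℂ) - x) ^ k * Complex.exp (-z * x))
      - ∫ x in (0 : ℝ)..t, (f x : ℂ) * ((t : ℂ) - x) ^ k * Complex.exp (-z * x)
      = ∫ x in Ioi t, (f x : ℂ) * ((t : ℂ) - x) ^ k * Complex.exp (-z * x) := by
    rw [intervalIntegral.integral_of_le ht, ← Ioc_union_Ioi_eq_Ioi ht,
      setIntegral_union (Ioc_disjoint_Ioi le_rfl) measurableSet_Ioi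
        (hint.mono_set Ioc_subset_Ioi_self) (hint.mono_set (Ioi_subset_Ioi ht))]
    ring
  have h2 : ‖∫ x in Ioi t, (f x : ℂ) * ((t : ℂ) - x) ^ k * Complex.exp (-z * x)‖
      ≤ ∫ x in Ioi t, (K * (k.factorial / ε ^ k) * Real.exp (-(ε * t))) * Real.exp (-ε * x) := by
    refine norm_integral_le_of_norm_le
      ((integrableOn_exp_mul_Ioi (by linarith) t).const_mul _) ?_
    filter_upwards [ae_restrict_mem measurableSet_Ioi] with x hx
    have hx' : 0 ≤ x - t := sub_nonneg.2 (le_of_lt hx)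
    rw [norm_mul, norm_mul, Complex.norm_real, Real.norm_eq_abs, norm_pow, norm_exp_neg_mul,
      ← Complex.ofReal_sub, Complex.norm_real, Real.norm_eq_abs, abs_sub_comm, abs_of_nonneg hx']
    calc |f x| * (x - t) ^ k * Real.exp (-z.re * x)
        ≤ (K * Real.exp (θ * x)) * (k.factorial / ε ^ k * Real.exp (ε * (x - t)))
          * Real.exp (-z.re * x) := by
          gcongr
          · exact hK x
          · exact pow_le_mul_exp k hε0 hx'
      _ = (K * (k.factorial / ε ^ k)) *
          (Real.exp (θ * x) * Real.exp (ε * (x - t)) * Real.exp (-z.re * x)) := by ring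
      _ = (K * (k.factorial / ε ^ k)) * (Real.exp (-(ε * t)) * Real.exp (-ε * x)) := by
          rw [← Real.exp_add, ← Real.exp_add, ← Real.exp_add]
          congr 2
          rw [hε]
          ring
      _ = _ := by ring
  rw [integral_const_mul, integral_exp_mul_Ioi (by linarith) t] at h2
  rw [h1, norm_mul, Complex.norm_exp]
  have h3 : (z * t).re = z.re * t := by simp
  rw [h3]
  calc _ ≤ Real.exp (z.re * t) * ((K * (k.factorial / ε ^ k) * Real.exp (-(ε * t))) *
        (-Real.exp (-ε * t) / -ε)) := by gcongr
    _ = K * (k.factorial / ε ^ k) / ε *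
        (Real.exp (z.re * t) * Real.exp (-(ε * t)) * Real.exp (-ε * t)) := by
        rw [neg_div_neg_eq]; ring
    _ = _ := by
        rw [← Real.exp_add, ← Real.exp_add]
        congr 2
        rw [hε]
        ring

/-- The binomial theorem at the level of integrals. Summing up to `n` instead of `k` is free because
the binomial coefficients vanish, and a range common to all `k` lets the powers of `t` be collected.
-/
theorem integral_sub_pow_mul_exp (hf : IsExpBoundedVariation θ f) (t : ℝ) {k n : ℕ} (hk : k < n)
    {z : ℂ} (hz : θ < z.re) :
    ∫ x in Ioi (0 : ℝ), (f x : ℂ) * ((t : ℂ) - x) ^ k * Complex.exp (-z * x)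
      = ∑ l ∈ Finset.range n, (t : ℂ) ^ l * (k.choose l * ∫ x in Ioi (0 : ℝ),
        (f x : ℂ) * ((0 : ℝ) - x) ^ (k - l) * Complex.exp (-z * x)) := by
  have h1 : ∀ x : ℝ, (f x : ℂ) * ((t : ℂ) - x) ^ k * Complex.exp (-z * x)
      = ∑ l ∈ Finset.range (k + 1), ((t : ℂ) ^ l * k.choose l) *
        ((f x : ℂ) * (((0 : ℝ) : ℂ) - x) ^ (k - l) * Complex.exp (-z * x)) := by
    intro x
    rw [sub_eq_add_neg, add_pow, Finset.mul_sum, Finset.sum_mul]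
    refine Finset.sum_congr rfl fun l _ => ?_
    rw [Complex.ofReal_zero, zero_sub]
    ring
  simp only [h1]
  rw [integral_finsetSum _ fun l _ => (hf.integrableOn_mul_exp 0 (k - l) hz).const_mul _]
  simp only [integral_const_mul]
  rw [← Finset.sum_subset (Finset.range_subset_range.2 hk)]
  · exact Finset.sum_congr rfl fun l _ => by ring
  · intro l _ hl
    rw [Finset.mem_range, not_lt] at hl
    rw [Nat.choose_eq_zero_of_lt hl]
    simp

end IsExpBoundedVariation

end MarkovRenewal

/-! ### The Markov renewal equation and the coefficient matrices. -/

namespace MarkovRenewal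

variable {p : ℕ} {μ : Fin p → Fin p → Measure ℝ}

/-- The convolution with the Markov renewal measure solves the Markov renewal equation. -/
theorem convVec_renewalMeasure [∀ i j, SFinite (μ i j)] {f : ℝ → Fin p → ℝ}
    (hf : ∀ i j t, Integrable (fun x => f (t - x) j) (renewalMeasure μ i j)) (t : ℝ) (i : Fin p) :
    convVec (renewalMeasure μ) f t i
      = f t i + convVec μ (convVec (renewalMeasure μ) f) t i := by
  have h1 : ∀ j, Integrable (fun x => f (t - x) j) (if i = j then Measure.dirac 0 else 0) ∧
      ∀ k, Integrable (fun x => f (t - x) j) ((μ i k).conv (renewalMeasure μ k j)) := by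
    intro j
    have h := hf i j t
    rw [renewalMeasure_eq, integrable_add_measure, integrable_finsetSum_measure] at h
    exact ⟨h.1, fun k => h.2 k (Finset.mem_univ k)⟩
  have h2 : ∀ j k, Integrable (fun x => ∫ y, f (t - x - y) j ∂(renewalMeasure μ k j)) (μ i k) ∧
      ∫ x, f (t - x) j ∂((μ i k).conv (renewalMeasure μ k j))
        = ∫ x, ∫ y, f (t - x - y) j ∂(renewalMeasure μ k j) ∂(μ i k) := by
    intro j k
    have h := (h1 j).2 k
    constructor
    · rw [Measure.conv] at h
      have h3 := ((integrable_map_measure h.aestronglyMeasurable (by fun_prop)).1 h)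
      refine h3.integral_prod_left.congr (Eventually.of_forall fun x => ?_)
      simp only [Function.comp_apply, sub_sub]
    · rw [integral_conv h]
      simp only [sub_sub]
  have h3 : ∀ j, ∫ x, f (t - x) j ∂(renewalMeasure μ i j) = (if i = j then f t j else 0)
      + ∑ k, ∫ x, ∫ y, f (t - x - y) j ∂(renewalMeasure μ k j) ∂(μ i k) := by
    intro j
    conv_lhs => rw [renewalMeasure_eq]
    rw [integral_add_measure (h1 j).1 (integrable_finsetSum_measure.2 fun k _ => (h1 j).2 k),
      integral_finsetSum_measure fun k _ => (h1 j).2 k]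
    congr 1
    · split_ifs <;> simp
    · exact Finset.sum_congr rfl fun k _ => (h2 j k).2
  simp only [convVec]
  rw [Finset.sum_congr rfl fun j _ => h3 j, Finset.sum_add_distrib, Finset.sum_comm]
  congr 1
  · simp
  · refine Finset.sum_congr rfl fun k _ => ?_
    rw [integral_finsetSum _ fun j _ => (h2 j k).1]

/-- The gap `θ - ϑ` absorbs the factor `t`; the interval `[0, 1]`, where the expansion gives
nothing, is covered by monotonicity of `u` and compactness for `m`. -/
theorem exists_norm_sub_le_exp {u : ℝ → ℝ} (hu : Monotone u) (h0 : 0 ≤ u 0) {m : ℝ → ℂ}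
    (hm : Continuous m) {K ϑ θ : ℝ} (hθ : ϑ < θ)
    (h : ∀ t, 1 ≤ t → ‖(u t : ℂ) - m t‖ ≤ K * t * Real.exp (ϑ * t)) :
    ∃ K', ∀ t, 0 ≤ t → ‖(u t : ℂ) - m t‖ ≤ K' * Real.exp (θ * t) := by
  obtain ⟨A, hA⟩ := isCompact_Icc.exists_bound_of_continuousOn (s := Icc (0 : ℝ) 1) hm.continuousOn
  have hA0 : 0 ≤ A := (norm_nonneg _).trans (hA 0 ⟨le_rfl, zero_le_one⟩)
  have hK0 : 0 ≤ K := by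
    have := (norm_nonneg _).trans (h 1 le_rfl)
    rw [mul_one] at this
    exact nonneg_of_mul_nonneg_left this (Real.exp_pos _)
  have hu1 : 0 ≤ u 1 := h0.trans (hu zero_le_one)
  have hε : 0 < θ - ϑ := sub_pos.2 hθ
  refine ⟨K * (1 / (θ - ϑ)) + (u 1 + A) * Real.exp |θ|, fun t ht => ?_⟩
  rw [add_mul]
  rcases le_total 1 t with h1 | h1
  · have h2 := pow_le_mul_exp 1 hε ht
    rw [pow_one, Nat.factorial_one, pow_one, Nat.cast_one] at h2
    refine (h t h1).trans (le_add_of_le_of_nonneg ?_ (by positivity))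
    calc K * t * Real.exp (ϑ * t)
        ≤ K * (1 / (θ - ϑ) * Real.exp ((θ - ϑ) * t)) * Real.exp (ϑ * t) := by gcongr
      _ = K * (1 / (θ - ϑ)) * (Real.exp ((θ - ϑ) * t) * Real.exp (ϑ * t)) := by ring
      _ = _ := by rw [← Real.exp_add]; congr 2; ring
  · refine le_add_of_nonneg_of_le (by positivity) ?_
    have h2 : 1 ≤ Real.exp |θ| * Real.exp (θ * t) := by
      rw [← Real.exp_add]
      apply Real.one_le_exp
      have : |θ * t| ≤ |θ| := by
        rw [abs_mul, abs_of_nonneg ht]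
        exact mul_le_of_le_one_right (abs_nonneg _) h1
      linarith [neg_abs_le (θ * t)]
    calc ‖(u t : ℂ) - m t‖ ≤ u 1 + A := by
          refine (norm_sub_le _ _).trans (add_le_add ?_ (hA t ⟨ht, h1⟩))
          rw [Complex.norm_real, Real.norm_of_nonneg (h0.trans (hu ht))]
          exact hu h1
      _ ≤ (u 1 + A) * (Real.exp |θ| * Real.exp (θ * t)) :=
          le_mul_of_one_le_right (by positivity) h2
      _ = _ := by ring

/-- The coefficients of the expansion of the renewal function. -/
theorem exists_renewal_expansion [∀ i j, SFinite (μ i j)] (hμ : ∀ i j, μ i j (Iio 0) = 0)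
    {ϑ δ s₀ : ℝ} (hδ : 0 < δ) (hw : ((ϑ - δ : ℝ) : ℂ) ∈ laplaceDomain μ)
    (hU : (s₀ : ℂ) ∈ laplaceDomain (renewalMeasure μ))
    (hbdd : BoundedInverseOnLine μ ϑ) (hfin : (charRootsAbove μ ϑ).Finite) :
    ∃ C : ℂ → ℕ → Matrix (Fin p) (Fin p) ℂ,
      (∀ i j, ∃ K, ∀ t : ℝ, 1 ≤ t → ‖(((renewalMeasure μ i j).real (Icc 0 t) : ℝ) : ℂ)
        - expPoly hfin.toFinset (poleOrder μ) (fun z k => C z k i j) t‖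
        ≤ K * t * Real.exp (ϑ * t)) ∧
      (∀ z ∈ charRootsAbove μ ϑ, z ≠ 0 → C z (poleOrder μ z) = 0) ∧
      (0 ∉ charRootsAbove μ ϑ → poleOrder μ 0 = 0 ∨ ∀ k, C 0 k = 0) := by
  classical
  have hwϑ : ((ϑ - δ : ℝ) : ℂ).re < ϑ := by rw [Complex.ofReal_re]; linarith
  choose a K hK using fun i j => exists_renewal_expansion_apply hμ hδ hw hU hbdd hfin i j
  -- Extension by zero outside the index range of the expansion makes the required vanishing of top
  -- coefficients automatic.
  obtain ⟨C, hC⟩ : ∃ C : ℂ → ℕ → Matrix (Fin p) (Fin p) ℂ, ∀ z k i j,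
      C z k i j = if z ∈ poleSet hfin ∧ k < renewalOrder μ z then a i j z k else 0 :=
    ⟨fun z k => Matrix.of fun i j =>
      if z ∈ poleSet hfin ∧ k < renewalOrder μ z then a i j z k else 0, fun _ _ _ _ => rfl⟩
  have hN : ∀ w, renewalOrder μ w = poleOrder μ w + if w = 0 then 1 else 0 := by
    intro w
    rw [renewalOrder]
  have hcases : (0 ∈ hfin.toFinset ∧ poleSet hfin = hfin.toFinset) ∨
      (0 ∉ hfin.toFinset ∧ poleSet hfin = insert 0 hfin.toFinset ∧ poleOrder μ 0 = 0) ∨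
      (0 ∉ hfin.toFinset ∧ poleSet hfin = hfin.toFinset ∧ ∀ k, C 0 k = 0) := by
    by_cases h0 : 0 ∈ charRootsAbove μ ϑ
    · refine Or.inl ⟨hfin.mem_toFinset.2 h0, ?_⟩
      ext z
      rw [mem_poleSet, hfin.mem_toFinset]
      exact ⟨fun h => h.elim id fun h => h.2 ▸ h0, Or.inl⟩
    · refine Or.inr ?_
      rcases le_or_gt ϑ 0 with hϑ | hϑ
      · refine Or.inl ⟨fun h => h0 (hfin.mem_toFinset.1 h), ?_, ?_⟩
        · ext z
          rw [mem_poleSet, Finset.mem_insert, hfin.mem_toFinset]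
          tauto
        · rw [poleOrder, if_neg]
          exact fun h => det_ne_zero_of_notMem hμ hw hwϑ hbdd (by simpa using hϑ) h0 h.2
      -- For `ϑ > 0` the point `0` lies left of the line, where `poleOrder μ 0` is not controlled;
      -- the monomial is removed by its zero coefficient.
      · refine Or.inr ⟨fun h => h0 (hfin.mem_toFinset.1 h), ?_, fun k => ?_⟩
        · ext z
          rw [mem_poleSet, hfin.mem_toFinset]
          exact ⟨fun h => h.elim id fun h => absurd h.1 (not_le.2 hϑ), Or.inl⟩
        · ext i j
          rw [hC, if_neg, Matrix.zero_apply]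
          rintro ⟨h, -⟩
          rw [mem_poleSet] at h
          exact h.elim h0 fun h => absurd h.1 (not_le.2 hϑ)
  refine ⟨C, fun i j => ⟨K i j, fun t ht => ?_⟩, fun z hz hz0 => ?_, fun h0 => ?_⟩
  · rw [expPoly_eq_sum hN (hcases.imp_right (Or.imp_right fun h =>
      ⟨h.1, h.2.1, fun k => by rw [h.2.2 k, Matrix.zero_apply]⟩)) t]
    refine le_trans (le_of_eq ?_) (hK i j t ht)
    congr 2
    refine Finset.sum_congr rfl fun w hw => Finset.sum_congr rfl fun k hk => ?_
    rw [hC, if_pos ⟨hw, Finset.mem_range.1 hk⟩]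
  · ext i j
    rw [hC, if_neg, Matrix.zero_apply]
    rintro ⟨-, h⟩
    rw [hN, if_neg hz0, add_zero] at h
    exact lt_irrefl _ h
  · have h0' : 0 ∉ hfin.toFinset := fun h => h0 (hfin.mem_toFinset.1 h)
    rcases hcases with h | h | h
    · exact absurd h.1 h0'
    · exact Or.inl h.2.2
    · exact Or.inr h.2.2

end MarkovRenewal

/-! ### Assembly of the vector-valued expansions. -/

namespace MarkovRenewal

variable {p : ℕ} {μ : Fin p → Fin p → Measure ℝ}

theorem continuous_sum_exp (Λ : Finset ℂ) (n : ℂ → ℕ) (b : ℂ → ℕ → ℂ) :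
    Continuous fun t : ℝ => ∑ z ∈ Λ, Complex.exp (z * t) *
      ∑ k ∈ Finset.range (n z), (t : ℂ) ^ k * b z k := by
  fun_prop

theorem continuous_expPoly (Λ : Finset ℂ) (n : ℂ → ℕ) (c : ℂ → ℕ → ℂ) :
    Continuous (expPoly Λ n c) := by
  unfold expPoly
  fun_prop

theorem IsExpBoundedVariation.integral_mul_sum_exp {θ : ℝ} {f : ℝ → ℝ}
    (hf : IsExpBoundedVariation θ f) (Λ : Finset ℂ) (n : ℂ → ℕ) (b : ℂ → ℕ → ℂ) (t : ℝ) :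
    ∫ x in (0 : ℝ)..t, (f x : ℂ) * (∑ z ∈ Λ, Complex.exp (z * (t - x : ℝ)) *
      ∑ k ∈ Finset.range (n z), ((t - x : ℝ) : ℂ) ^ k * b z k)
      = ∑ z ∈ Λ, Complex.exp (z * t) * ∑ k ∈ Finset.range (n z), b z k *
        ∫ x in (0 : ℝ)..t, (f x : ℂ) * ((t : ℂ) - x) ^ k * Complex.exp (-z * x) := by
  have h1 : ∀ x : ℝ, (f x : ℂ) * (∑ z ∈ Λ, Complex.exp (z * (t - x : ℝ)) *
      ∑ k ∈ Finset.range (n z), ((t - x : ℝ) : ℂ) ^ k * b z k)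
      = ∑ z ∈ Λ, Complex.exp (z * t) * ∑ k ∈ Finset.range (n z), b z k *
        ((f x : ℂ) * (((t : ℂ) - x) ^ k * Complex.exp (-z * x))) := by
    intro x
    rw [Finset.mul_sum]
    refine Finset.sum_congr rfl fun z _ => ?_
    rw [Complex.ofReal_sub, mul_sub, sub_eq_add_neg, Complex.exp_add, neg_mul, Finset.mul_sum,
      Finset.mul_sum, Finset.mul_sum]
    exact Finset.sum_congr rfl fun k _ => by ring
  have h2 : ∀ (z : ℂ) (k : ℕ), IntervalIntegrable (fun x : ℝ => b z k *
      ((f x : ℂ) * (((t : ℂ) - x) ^ k * Complex.exp (-z * x)))) volume 0 t := fun z k =>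
    (hf.intervalIntegrable_mul (by fun_prop) 0 t).const_mul _
  have h3 : ∀ z : ℂ, IntervalIntegrable (fun x : ℝ => Complex.exp (z * t) *
      ∑ k ∈ Finset.range (n z), b z k *
        ((f x : ℂ) * (((t : ℂ) - x) ^ k * Complex.exp (-z * x)))) volume 0 t := by
    intro z
    have h := IntervalIntegrable.sum (Finset.range (n z)) fun k _ => h2 z k
    simp only [Finset.sum_fn] at h
    exact h.const_mul _
  simp only [h1]
  rw [intervalIntegral.integral_finsetSum fun z _ => h3 z]
  refine Finset.sum_congr rfl fun z _ => ?_
  rw [intervalIntegral.integral_const_mul, intervalIntegral.integral_finsetSum fun k _ => h2 z k]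
  simp only [intervalIntegral.integral_const_mul, mul_assoc]

theorem sum_exp_mulVec (Λ : Finset ℂ) (n : ℂ → ℕ) (B : ℂ → ℕ → Matrix (Fin p) (Fin p) ℂ)
    (v : ℂ → ℕ → Fin p → ℂ) (t : ℝ) (i : Fin p) :
    ∑ z ∈ Λ, Complex.exp (z * t) * ∑ k ∈ Finset.range (n z), (B z k *ᵥ v z k) i
      = ∑ j, ∑ z ∈ Λ, Complex.exp (z * t) * ∑ k ∈ Finset.range (n z), B z k i j * v z k j := by
  simp only [Matrix.mulVec, dotProduct]
  rw [Finset.sum_comm]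
  refine Finset.sum_congr rfl fun z _ => ?_
  rw [← Finset.mul_sum, Finset.sum_comm]

/-- The expansion of the convolution with a renewal measure with a known expansion. -/
theorem exists_norm_convVec_sub_le {U : Fin p → Fin p → Measure ℝ} [∀ i j, SFinite (U i j)]
    (hU0 : ∀ i j, U i j (Iio 0) = 0) (hU : ∀ i j x, U i j (Iic x) < ∞) {θ : ℝ}
    {f : ℝ → Fin p → ℝ} (hf : ∀ j, IsExpBoundedVariation θ fun x => f x j)
    {Λ : Finset ℂ} {n : ℂ → ℕ} {C B : ℂ → ℕ → Matrix (Fin p) (Fin p) ℂ}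
    (hC : ∀ i j, ∃ K, ∀ t : ℝ, 0 ≤ t → ‖(((U i j).real (Icc 0 t) : ℝ) : ℂ)
        - expPoly Λ n (fun z k => C z k i j) t‖ ≤ K * Real.exp (θ * t))
    (ha : ∀ z ∈ Λ, z ≠ 0 → C z (n z) = 0) (hb : 0 ∉ Λ → n 0 = 0 ∨ ∀ k, C 0 k = 0)
    (hB : ∀ z k, B z k = ((k : ℂ) + 1) • C z (k + 1) + z • C z k) (i : Fin p) :
    ∃ K, ∀ t : ℝ, 0 ≤ t → ‖((convVec U f t i : ℝ) : ℂ)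
      - ∑ z ∈ Λ, Complex.exp (z * t) * ∑ k ∈ Finset.range (n z), (B z k *ᵥ fun j =>
          ∫ x in (0 : ℝ)..t, (f x j : ℂ) * ((t : ℂ) - x) ^ k * Complex.exp (-z * x)) i‖
      ≤ K * Real.exp (θ * t) := by
  have h : ∀ j, ∃ K, ∀ t : ℝ, 0 ≤ t → ‖((∫ x, f (t - x) j ∂(U i j) : ℝ) : ℂ)
      - ∑ z ∈ Λ, Complex.exp (z * t) * ∑ k ∈ Finset.range (n z), B z k i j *
          ∫ x in (0 : ℝ)..t, (f x j : ℂ) * ((t : ℂ) - x) ^ k * Complex.exp (-z * x)‖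
      ≤ K * Real.exp (θ * t) := by
    intro j
    obtain ⟨K, hK⟩ := hC i j
    have hder : ∀ t : ℝ, HasDerivAt (expPoly Λ n fun z k => C z k i j)
        (∑ z ∈ Λ, Complex.exp (z * t) * ∑ k ∈ Finset.range (n z), (t : ℂ) ^ k * B z k i j) t := by
      intro t
      refine (hasDerivAt_expPoly' (fun z hz hz0 => by rw [ha z hz hz0, Matrix.zero_apply])
        (fun h0 => (hb h0).imp_right fun h => by rw [h, Matrix.zero_apply]) t).congr_deriv ?_
      refine Finset.sum_congr rfl fun z _ => ?_
      congr 1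
      refine Finset.sum_congr rfl fun k _ => ?_
      simp [hB]
    obtain ⟨K', hK'⟩ := (hf j).exists_norm_convolution_sub_le (hU0 i j) (hU i j) hder
      (continuous_sum_exp Λ n fun z k => B z k i j) hK
    refine ⟨K', fun t ht => ?_⟩
    rw [← (hf j).integral_mul_sum_exp Λ n (fun z k => B z k i j) t]
    exact hK' t ht
  choose K hK using h
  refine ⟨∑ j, K j, fun t ht => ?_⟩
  rw [sum_exp_mulVec Λ n B (fun z k j =>
    ∫ x in (0 : ℝ)..t, (f x j : ℂ) * ((t : ℂ) - x) ^ k * Complex.exp (-z * x)), convVec,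
    Complex.ofReal_sum, ← Finset.sum_sub_distrib, Finset.sum_mul]
  exact norm_sum_le_of_le _ fun j _ => hK j t ht

theorem exists_norm_sum_tail_le {θ : ℝ}
    {f : ℝ → Fin p → ℝ} (hf : ∀ j, IsExpBoundedVariation θ fun x => f x j)
    {Λ : Finset ℂ} (hΛ : ∀ z ∈ Λ, θ < z.re) (n : ℂ → ℕ)
    (B : ℂ → ℕ → Matrix (Fin p) (Fin p) ℂ) (i : Fin p) :
    ∃ K, ∀ t : ℝ, 0 ≤ t → ‖(∑ z ∈ Λ, Complex.exp (z * t) *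
        ∑ k ∈ Finset.range (n z), (B z k *ᵥ fun j =>
          ∫ x in Ioi (0 : ℝ), (f x j : ℂ) * ((t : ℂ) - x) ^ k * Complex.exp (-z * x)) i)
      - ∑ z ∈ Λ, Complex.exp (z * t) * ∑ k ∈ Finset.range (n z), (B z k *ᵥ fun j =>
          ∫ x in (0 : ℝ)..t, (f x j : ℂ) * ((t : ℂ) - x) ^ k * Complex.exp (-z * x)) i‖
      ≤ K * Real.exp (θ * t) := by
  have h : ∀ z j k, ∃ K, z ∈ Λ → ∀ t : ℝ, 0 ≤ t → ‖Complex.exp (z * t) *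
      ((∫ x in Ioi (0 : ℝ), (f x j : ℂ) * ((t : ℂ) - x) ^ k * Complex.exp (-z * x))
      - ∫ x in (0 : ℝ)..t, (f x j : ℂ) * ((t : ℂ) - x) ^ k * Complex.exp (-z * x))‖
      ≤ K * Real.exp (θ * t) := by
    intro z j k
    by_cases hz : z ∈ Λ
    · obtain ⟨K, hK⟩ := (hf j).exists_norm_tail_le k (hΛ z hz)
      exact ⟨K, fun _ => hK⟩
    · exact ⟨0, fun h => absurd h hz⟩
  choose K hK using h
  refine ⟨∑ j, ∑ z ∈ Λ, ∑ k ∈ Finset.range (n z), ‖B z k i j‖ * K z j k, fun t ht => ?_⟩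
  rw [sum_exp_mulVec Λ n B (fun z k j =>
    ∫ x in (0 : ℝ)..t, (f x j : ℂ) * ((t : ℂ) - x) ^ k * Complex.exp (-z * x)),
    sum_exp_mulVec Λ n B (fun z k j =>
    ∫ x in Ioi (0 : ℝ), (f x j : ℂ) * ((t : ℂ) - x) ^ k * Complex.exp (-z * x)),
    ← Finset.sum_sub_distrib, Finset.sum_mul]
  refine norm_sum_le_of_le _ fun j _ => ?_
  rw [← Finset.sum_sub_distrib, Finset.sum_mul]
  refine norm_sum_le_of_le _ fun z hz => ?_
  rw [← mul_sub, ← Finset.sum_sub_distrib, Finset.mul_sum, Finset.sum_mul]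
  refine norm_sum_le_of_le _ fun k _ => ?_
  rw [← mul_sub, mul_left_comm, norm_mul, mul_assoc]
  exact mul_le_mul_of_nonneg_left (hK z j k hz t ht) (norm_nonneg _)

/-- The vectors come from the binomial expansion of `(t - x)^k` and involve the integrals only at `t
= 0`, so they depend neither on `t` nor on any error rate. -/
theorem exists_sum_eq_sum_pow {θ : ℝ}
    {f : ℝ → Fin p → ℝ} (hf : ∀ j, IsExpBoundedVariation θ fun x => f x j)
    {Λ : Finset ℂ} (hΛ : ∀ z ∈ Λ, θ < z.re) (n : ℂ → ℕ)
    (B : ℂ → ℕ → Matrix (Fin p) (Fin p) ℂ) :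
    ∃ b : ℂ → ℕ → Fin p → ℂ, ∀ (i : Fin p) (t : ℝ), ∑ z ∈ Λ, Complex.exp (z * t) *
        ∑ k ∈ Finset.range (n z), (B z k *ᵥ fun j =>
          ∫ x in Ioi (0 : ℝ), (f x j : ℂ) * ((t : ℂ) - x) ^ k * Complex.exp (-z * x)) i
      = ∑ z ∈ Λ, Complex.exp (z * t) * ∑ k ∈ Finset.range (n z), (t : ℂ) ^ k * b z k i := by
  refine ⟨fun z l => ∑ k ∈ Finset.range (n z), B z k *ᵥ fun j => k.choose l *
    ∫ x in Ioi (0 : ℝ), (f x j : ℂ) * ((0 : ℝ) - x) ^ (k - l) * Complex.exp (-z * x),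
    fun i t => Finset.sum_congr rfl fun z hz => ?_⟩
  congr 1
  simp only [Finset.sum_apply, Finset.mul_sum]
  rw [Finset.sum_comm]
  refine Finset.sum_congr rfl fun k hk => ?_
  simp only [Matrix.mulVec, dotProduct, Finset.mul_sum]
  rw [Finset.sum_comm]
  refine Finset.sum_congr rfl fun j _ => ?_
  rw [(hf j).integral_sub_pow_mul_exp t (Finset.mem_range.1 hk) (hΛ z hz), Finset.mul_sum]
  exact Finset.sum_congr rfl fun l _ => by ring

theorem isExpBoundedVariation_of_isCadlag {f : ℝ → Fin p → ℝ} (hf : IsCadlag f)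
    (h0 : ∀ x < 0, f x = 0) {θ : ℝ} (j : Fin p)
    (hV : ∫⁻ x in Ioi (0 : ℝ),
      ENNReal.ofReal (Real.exp (-θ * x)) * totalVar (fun y => f y j) x < ∞) :
    IsExpBoundedVariation θ fun x => f x j :=
  ⟨exists_isExpBounded_sub (fun x => continuousWithinAt_pi.1 (hf x).1 j)
    (fun x hx => by rw [h0 x hx, Pi.zero_apply]) hV⟩

end MarkovRenewal

/-! ### The expansion theorem. -/

open MarkovRenewal in
theorem mainTheorem2 (p : ℕ) (hp : 1 ≤ p) (μ : Fin p → Fin p → Measure ℝ)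
    (hμ_loc : ∀ i j, IsLocallyFiniteMeasure (μ i j))
    (hμ_supp : ∀ i j, μ i j (Iio 0) = 0)
    (ϑ : ℝ) (hϑ : (ϑ : ℂ) ∈ interior (laplaceDomain μ))
    (hμ_zero : spectralRadius ℂ (massAtZero μ) < 1)
    (hbdd : BoundedInverseOnLine μ ϑ)
    (hfin : (charRootsAbove μ ϑ).Finite) :
    -- the renewal function is finite
    (∀ i j (t : ℝ), renewalMeasure μ i j (Icc 0 t) < ∞) ∧
    ∃ C B : ℂ → ℕ → Matrix (Fin p) (Fin p) ℂ,
      -- `C` is the family of coefficients of the expansion of the renewal function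
      (∀ i j, (fun t : ℝ => (((renewalMeasure μ i j).real (Icc 0 t) : ℝ) : ℂ)
          - (∑ z ∈ hfin.toFinset, Complex.exp (z * t) *
                ∑ k ∈ Finset.range (poleOrder μ z), (t : ℂ) ^ k * C z k i j)
          - (t : ℂ) ^ poleOrder μ 0 * C 0 (poleOrder μ 0) i j)
        =O[atTop] fun t : ℝ => t * Real.exp (ϑ * t)) ∧
      (∀ z ∈ charRootsAbove μ ϑ, z ≠ 0 → C z (poleOrder μ z) = 0) ∧
      (∀ z ∈ charRootsAbove μ ϑ, ∀ k < poleOrder μ z,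
        B z k = ((k : ℂ) + 1) • C z (k + 1) + z • C z k) ∧
      -- the expansion of the solution `F = U * f`
      ∀ (f : ℝ → Fin p → ℝ), IsCadlag f → (∀ x < 0, f x = 0) →
      ∀ θ : ℝ, ϑ < θ → charRootsAbove μ ϑ = charRootsAbove μ θ →
        (∀ i, ∫⁻ x in Ioi (0 : ℝ),
          ENNReal.ofReal (Real.exp (-θ * x)) * totalVar (fun y => f y i) x < ∞) →
      ∀ F : ℝ → Fin p → ℝ, F = convVec (renewalMeasure μ) f →
        (∀ t, F t = f t + convVec μ F t) ∧
        (∀ i, (fun t : ℝ => ((F t i : ℝ) : ℂ)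
            - ∑ z ∈ hfin.toFinset, Complex.exp (z * t) *
                ∑ k ∈ Finset.range (poleOrder μ z), (B z k *ᵥ fun j =>
                  ∫ x in (0 : ℝ)..t,
                    (f x j : ℂ) * ((t : ℂ) - x) ^ k * Complex.exp (-z * x)) i)
          =O[atTop] fun t : ℝ => Real.exp (θ * t)) ∧
        (∀ z ∈ charRootsAbove μ ϑ, ∀ k < poleOrder μ z, ∀ j, ∀ t : ℝ,
          IntegrableOn (fun x : ℝ =>
            (f x j : ℂ) * ((t : ℂ) - x) ^ k * Complex.exp (-z * x)) (Ioi 0)) ∧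
        (∀ ε > 0, ∀ i, (fun t : ℝ => ((F t i : ℝ) : ℂ)
            - ∑ z ∈ hfin.toFinset, Complex.exp (z * t) *
                ∑ k ∈ Finset.range (poleOrder μ z), (B z k *ᵥ fun j =>
                  ∫ x in Ioi (0 : ℝ),
                    (f x j : ℂ) * ((t : ℂ) - x) ^ k * Complex.exp (-z * x)) i)
          =O[atTop] fun t : ℝ => Real.exp ((θ + ε) * t)) ∧
        ∃ b : ℂ → ℕ → Fin p → ℂ, ∀ ε > 0, ∀ i, (fun t : ℝ => ((F t i : ℝ) : ℂ)
            - ∑ z ∈ hfin.toFinset, Complex.exp (z * t) *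
                ∑ k ∈ Finset.range (poleOrder μ z), (t : ℂ) ^ k * b z k i)
          =O[atTop] fun t : ℝ => Real.exp ((θ + ε) * t) := by
  have : NeZero p := ⟨by lia⟩
  obtain ⟨δ, hδ, hw⟩ := exists_mem_laplaceDomain_of_interior hϑ
  -- `s₀ ≥ ϑ - δ` keeps `s₀` in the domain of `ℒμ`, and the spectral radius there makes the renewal
  -- measure transformable at `s₀`.
  obtain ⟨s₀, hs₀, hs₁⟩ := ((eventually_spectralRadius_laplace_lt_one hμ_supp hw hμ_zero).and
    (eventually_ge_atTop (ϑ - δ))).exists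
  have hU : (s₀ : ℂ) ∈ laplaceDomain (renewalMeasure μ) :=
    laplaceDomain_renewalMeasure μ (laplaceDomain_mono hμ_supp hw (by simpa using hs₁)) hs₀
  have hUfin : ∀ i j (t : ℝ), renewalMeasure μ i j (Icc 0 t) < ∞ := fun i j t =>
    measure_Icc_lt_top (by simpa using hU i j) 0 t
  have hU0 := renewalMeasure_Iio hμ_supp
  have hUIic : ∀ i j x, renewalMeasure μ i j (Iic x) < ∞ := by
    intro i j x
    have h : Iic x ⊆ Iio 0 ∪ Icc 0 x := fun y hy =>
      (lt_or_ge y 0).imp_right fun h => ⟨h, hy⟩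
    refine (measure_mono h).trans_lt ((measure_union_le _ _).trans_lt ?_)
    rw [hU0, zero_add]
    exact hUfin i j x
  obtain ⟨C, hC, hC0, hC1⟩ := exists_renewal_expansion hμ_supp hδ hw hU hbdd hfin
  refine ⟨hUfin, C, fun z k => ((k : ℂ) + 1) • C z (k + 1) + z • C z k, fun i j => ?_, hC0,
    fun _ _ _ _ => rfl, ?_⟩
  · obtain ⟨K, hK⟩ := hC i j
    refine IsBigO.of_bound K ?_
    filter_upwards [eventually_ge_atTop 1] with t ht
    rw [sub_sub, Real.norm_of_nonneg (by positivity), ← mul_assoc]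
    exact hK t ht
  intro f hf hf0 θ hθ hΛ hV F hF
  subst hF
  have hfv : ∀ j, IsExpBoundedVariation θ fun x => f x j := fun j =>
    isExpBoundedVariation_of_isCadlag hf hf0 j (hV j)
  -- This is where `Λ_ϑ = Λ_θ` enters: every root lies strictly right of `θ`, so the infinite
  -- integrals converge and their tails are small.
  have hre : ∀ z ∈ hfin.toFinset, θ < z.re := fun z hz => by
    rw [hfin.mem_toFinset, hΛ] at hz
    exact hz.2
  have hCθ : ∀ i j, ∃ K, ∀ t : ℝ, 0 ≤ t → ‖(((renewalMeasure μ i j).real (Icc 0 t) : ℝ) : ℂ)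
      - expPoly hfin.toFinset (poleOrder μ) (fun z k => C z k i j) t‖
      ≤ K * Real.exp (θ * t) := by
    intro i j
    obtain ⟨K, hK⟩ := hC i j
    exact exists_norm_sub_le_exp (monotone_real_Icc (hUfin i j)) measureReal_nonneg
      (continuous_expPoly _ _ _) hθ hK
  have h2 := exists_norm_convVec_sub_le hU0 hUIic hfv hCθ
    (fun z hz => hC0 z (hfin.mem_toFinset.1 hz))
    (fun h => hC1 fun h' => h (hfin.mem_toFinset.2 h')) (fun z k => rfl)
  have h4 : ∀ ε > 0, ∀ i, (fun t : ℝ => ((convVec (renewalMeasure μ) f t i : ℝ) : ℂ)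
      - ∑ z ∈ hfin.toFinset, Complex.exp (z * t) * ∑ k ∈ Finset.range (poleOrder μ z),
        ((((k : ℂ) + 1) • C z (k + 1) + z • C z k) *ᵥ fun j => ∫ x in Ioi (0 : ℝ),
          (f x j : ℂ) * ((t : ℂ) - x) ^ k * Complex.exp (-z * x)) i)
      =O[atTop] fun t : ℝ => Real.exp ((θ + ε) * t) := by
    intro ε hε i
    obtain ⟨K, hK⟩ := h2 i
    obtain ⟨K', hK'⟩ := exists_norm_sum_tail_le hfv hre (poleOrder μ)
      (fun z k => ((k : ℂ) + 1) • C z (k + 1) + z • C z k) i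
    -- The main error and the tails are both `O(e^{θt})`; `ε` enters only through this weakening.
    have hO : (fun t : ℝ => Real.exp (θ * t)) =O[atTop] fun t : ℝ => Real.exp ((θ + ε) * t) := by
      refine IsBigO.of_bound 1 ?_
      filter_upwards [eventually_ge_atTop 0] with t ht
      rw [one_mul, Real.norm_of_nonneg (Real.exp_nonneg _), Real.norm_of_nonneg (Real.exp_nonneg _)]
      exact Real.exp_le_exp.2 (by nlinarith)
    refine IsBigO.trans (IsBigO.of_bound (K + K') ?_) hO
    filter_upwards [eventually_ge_atTop 0] with t ht
    rw [Real.norm_of_nonneg (Real.exp_nonneg _), add_mul]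
    refine le_trans (le_of_eq ?_) ((norm_sub_le _ _).trans (add_le_add (hK t ht) (hK' t ht)))
    congr 1
    abel
  refine ⟨fun t => ?_, fun i => ?_, fun z hz k _ j t => ?_, h4, ?_⟩
  · ext i
    exact convVec_renewalMeasure
      (fun i j t => (hfv j).integrable_comp_sub (hU0 i j) (hUIic i j) t) t i
  · obtain ⟨K, hK⟩ := h2 i
    refine IsBigO.of_bound K ?_
    filter_upwards [eventually_ge_atTop 0] with t ht
    rw [Real.norm_of_nonneg (Real.exp_nonneg _)]
    exact hK t ht
  · exact (hfv j).integrableOn_mul_exp t k (hre z (hfin.mem_toFinset.2 hz))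
  · obtain ⟨b, hb⟩ := exists_sum_eq_sum_pow hfv hre (poleOrder μ)
      (fun z k => ((k : ℂ) + 1) • C z (k + 1) + z • C z k)
    refine ⟨b, fun ε hε i => ?_⟩
    simp only [← hb]
    exact h4 ε hε i
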